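/- Let $n\ge 1$. A dyadic grid $\mathcal D$ on $\mathbb R^n$ is a collection of (half-open, axis-parallel) cubes with side lengths $2^k$, $k\in\mathbb Z$, such that for every $k$ the cubes of side length $2^k$ partition $\mathbb R^n$ and $P\cap Q\in\{P,Q,\emptyset\}$ for $P,Q\in\mathcal D$. Let $h_Q^\epsilon$ ($Q\in\mathcal D$, $\epsilon\in\{0,1\}^n$, $\epsilon\not\equiv 1$) be the cancellative Haar functions, $(\cdot,\cdot)$ the inner product of $L^2(dx)$, $\langle f\rangle_Q=\frac1{|Q|}\int_Q f\,dx$. A weight is a locally integrable, a.e. positive function $w$, and $w(Q)=\int_Q w\,dx$; we write $w\in A_2^{\mathcal D}$ if $[w]_{A_2}:=\sup_{Q\in\mathcal D}\langle w\rangle_Q\langle w^{-1}\rangle_Q<\infty$. A locally integrable $b$ is in $BMO^{\mathcal D}(w)$ if $\|b\|_{BMO^{\mathcal D}(w)}:=\sup_{Q\in\mathcal D}\frac1{w(Q)}\int_Q|b-\langle b\rangle_Q|\,dx<\infty$; $\|b\|_{BMO(w)}$ is the same supremum over all cubes $Q\subset\mathbb R^n$. Let $$\Pi_b f=\sum_{Q\in\mathcal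 D,\ \epsilon\not\equiv 1}(b,h_Q^\epsilon)\langle f\rangle_Q h_Q^\epsilon,\qquad S_{\mathcal D}f=\Big(\sum_{Q\in\mathcal D,\ \epsilon\not\equiv1}(f,h_Q^\epsilon)^2\frac{1_Q}{|Q|}\Big)^{1/2},$$ the first series being unconditionally convergent in the target space. Write $\|\Pi_b\|$ for the operator norm of $\Pi_b:L^2(w)\to L^2(w^{-1})$ (equal to $\infty$ if $\Pi_b$ is not bounded) and $\|S_{\mathcal D}\|$ for that of $S_{\mathcal D}:L^2(w)\to L^2(w)$. 1. For every weight $w$ on $\mathbb R^n$, $\|w\|_{BMO(w)}\le 2$. 2. For every $\mathcal D$, every $w\in A_2^{\mathcal D}$ and every $b\in BMO^{\mathcal D}(w)$, $\|b\|_{BMO^{\mathcal D}(w)}\le 2\|\Pi_b\|$. 3. (The quadratic bound is sharp.) There are constants $C,c>0$ depending only on $n$ such that for every dyadic grid $\mathcal D$ on $\mathbb R^n$: (a) for all $w\in A_2^{\mathcal D}$ and $b\in BMO^{\mathcal D}(w)$, $\|\Pi_b\|\le C\,\|b\|_{BMO^{\mathcal D}(w)}[w]_{A_2}^2$; (b)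 for every $t\ge 2$ there is $w\in A_2^{\mathcal D}$ with $[w]_{A_2}=t$ such that the paraproduct with symbol $b=w$ satisfies $\|\Pi_w\|\ge c\,t^2$; (c) if $\varphi:[0,\infty]\to[0,\infty]$ is such that $\|\Pi_b\|\le\|b\|_{BMO^{\mathcal D}(w)}\,\varphi([w]_{A_2})$ for all $w\in A_2^{\mathcal D}$ and $b\in BMO^{\mathcal D}(w)$, then $\varphi(t)\ge c\,t^2$ for all real $t\ge1$. 4. Let $n=1$ and $w\in A_2^{\mathcal D}$. Then $\|S_{\mathcal D}f\|_{L^2(w)}^2\le(1+2\|\Pi_w\|)\|f\|_{L^2(w)}^2$ for all $f\in L^2(w)$, and $$\|S_{\mathcal D}\|^2\le 6\,\sup\Big\{\frac{\|\Pi_b\|}{\|b\|_{BMO^{\mathcal D}(w)}}: b\in BMO^{\mathcal D}(w),\ \|b\|_{BMO^{\mathcal D}(w)}\ne0\Big\}.$$ 5. Let $n=1$. There are absolute constants $C,c>0$ such that for every dyadic grid $\mathcal D$ on $\mathbb R$: $\|S_{\mathcal D}\|\le C[w]_{A_2}$ for all $w\in A_2^{\mathcal D}$, and for every $t\ge1$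 there is $w\in A_2^{\mathcal D}$ with $[w]_{A_2}=t$ and $\|S_{\mathcal D}\|\ge c\,t$. -/

import Mathlib

open MeasureTheory Filter Topology
open scoped ENNReal

noncomputable section

namespace Bloom

/-- The half-open axis-parallel cube in `ℝⁿ` with lower corner `a` and side length `l`. -/
def cube {n : ℕ} (a : Fin n → ℝ) (l : ℝ) : Set (Fin n → ℝ) :=
  {x | ∀ i, a i ≤ x i ∧ x i < a i + l}

/-- All cubes in `ℝⁿ`. -/
def allCubes (n : ℕ) : Set (Set (Fin n → ℝ)) :=
  {Q | ∃ (a : Fin n → ℝ) (l : ℝ), 0 < l ∧ Q = cube a l}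

/-- A cube whose side length is `2 ^ gen`, given by its lower corner. -/
structure DyadicCube (n : ℕ) where
  gen : ℤ
  corner : Fin n → ℝ

/-- The side length of a dyadic cube. -/
def DyadicCube.side {n : ℕ} (Q : DyadicCube n) : ℝ := (2 : ℝ) ^ Q.gen

/-- The dyadic cube as a set of points. -/
def DyadicCube.toSet {n : ℕ} (Q : DyadicCube n) : Set (Fin n → ℝ) := cube Q.corner Q.side

/-- A dyadic grid on `ℝⁿ`: cubes with side lengths `2 ^ k`, `k ∈ ℤ`, such that for every `k` the
cubes of side length `2 ^ k` partition `ℝⁿ`, and the intersection of two cubes of the grid is one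
of the two cubes or empty. -/
structure DyadicGrid (n : ℕ) where
  cubes : Set (DyadicCube n)
  partition : ∀ (k : ℤ) (x : Fin n → ℝ), ∃! Q : DyadicCube n, Q ∈ cubes ∧ Q.gen = k ∧ x ∈ Q.toSet
  nested : ∀ P ∈ cubes, ∀ Q ∈ cubes,
    P.toSet ∩ Q.toSet = P.toSet ∨ P.toSet ∩ Q.toSet = Q.toSet ∨ P.toSet ∩ Q.toSet = ∅

/-- The cubes of the grid, as sets. -/
def DyadicGrid.sets {n : ℕ} (D : DyadicGrid n) : Set (Set (Fin n → ℝ)) :=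
  DyadicCube.toSet '' D.cubes

/-! ### Haar functions -/

/-- The one-dimensional Haar functions of the interval `I = [a, a + l)`: for `e = 0` the cancellative
one `|I|^{-1/2} (1_{I₊} - 1_{I₋})` (`I₊` the right half, `I₋` the left half), for `e = 1` the
non-cancellative one `|I|^{-1/2} 1_I`. -/
def haar1 (a l : ℝ) (e : Fin 2) (t : ℝ) : ℝ :=
  (Real.sqrt l)⁻¹ *
    (if e = 0 then
      (Set.Ico (a + l / 2) (a + l)).indicator 1 t - (Set.Ico a (a + l / 2)).indicator 1 t
    else (Set.Ico a (a + l)).indicator 1 t)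

/-- The signatures of the cancellative Haar functions on `ℝⁿ`: all `ε ∈ {0,1}ⁿ` with `ε ≢ 1`. -/
abbrev Signature (n : ℕ) : Type := {e : Fin n → Fin 2 // e ≠ fun _ => 1}

/-- The cancellative Haar function `h_Q^ε (x) = ∏ₖ h_{Iₖ}^{εₖ} (xₖ)`, where `Q = I₁ × ⋯ × Iₙ`. -/
def haar {n : ℕ} (Q : DyadicCube n) (e : Signature n) (x : Fin n → ℝ) : ℝ :=
  ∏ k, haar1 (Q.corner k) Q.side (e.1 k) (x k)

/-- The index set of the cancellative Haar system of a grid. -/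
abbrev HaarIndex {n : ℕ} (D : DyadicGrid n) : Type := D.cubes × Signature n

/-- The Haar coefficient `(f, h_Q^ε) = ∫ f h_Q^ε dx`. -/
def haarCoeff {n : ℕ} (f : (Fin n → ℝ) → ℝ) (Q : DyadicCube n) (e : Signature n) : ℝ :=
  ∫ x, f x * haar Q e x

/-- The average `⟨f⟩_Q = |Q|⁻¹ ∫_Q f dx`. -/
def avg {n : ℕ} (f : (Fin n → ℝ) → ℝ) (Q : Set (Fin n → ℝ)) : ℝ := ⨍ x in Q, f x

/-! ### Weights -/

/-- A weight: a locally integrable, almost everywhere positive function. -/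
def IsWeight {n : ℕ} (w : (Fin n → ℝ) → ℝ) : Prop :=
  LocallyIntegrable w volume ∧ ∀ᵐ x, 0 < w x

/-- The measure `w(x) dx`. -/
def weightMeasure {n : ℕ} (w : (Fin n → ℝ) → ℝ) : Measure (Fin n → ℝ) :=
  volume.withDensity fun x => ENNReal.ofReal (w x)

/-- The dyadic characteristic `[w]_{A₂} = sup_{Q ∈ D} ⟨w⟩_Q ⟨w⁻¹⟩_Q`. -/
def a2Char {n : ℕ} (D : DyadicGrid n) (w : (Fin n → ℝ) → ℝ) : ℝ≥0∞ :=
  ⨆ Q ∈ D.sets,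
    ((∫⁻ x in Q, ENNReal.ofReal (w x)) / volume Q) *
      ((∫⁻ x in Q, ENNReal.ofReal ((w x)⁻¹)) / volume Q)

/-- `w` is a dyadic `A₂` weight. -/
def MemA2 {n : ℕ} (D : DyadicGrid n) (w : (Fin n → ℝ) → ℝ) : Prop :=
  IsWeight w ∧ a2Char D w < ⊤

/-! ### Weighted BMO -/

/-- `sup_Q w(Q)⁻¹ ∫_Q |b - ⟨b⟩_Q| dx`, the supremum being over a given family of cubes. -/
def bmoNorm {n : ℕ} (F : Set (Set (Fin n → ℝ))) (w b : (Fin n → ℝ) → ℝ) : ℝ≥0∞ :=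
  ⨆ Q ∈ F, (∫⁻ x in Q, ENNReal.ofReal |b x - avg b Q|) / weightMeasure w Q

/-- `b` belongs to the weighted dyadic space `BMO^D(w)`. -/
def MemBMO {n : ℕ} (D : DyadicGrid n) (w b : (Fin n → ℝ) → ℝ) : Prop :=
  LocallyIntegrable b volume ∧ bmoNorm D.sets w b < ⊤

/-! ### The paraproduct and its operator norm -/

/-- The term of index `(Q, ε)` of the paraproduct: `(b, h_Q^ε) ⟨f⟩_Q h_Q^ε`. -/
def paraTerm {n : ℕ} (D : DyadicGrid n) (b f : (Fin n → ℝ) → ℝ) (i : HaarIndex D)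
    (x : Fin n → ℝ) : ℝ :=
  haarCoeff b i.1 i.2 * avg f (i.1 : DyadicCube n).toSet * haar i.1 i.2 x

/-- `g = Π_b f = ∑_{Q, ε} (b, h_Q^ε) ⟨f⟩_Q h_Q^ε`, the series being unconditionally convergent to
`g` in `L²(v)`. -/
def IsParaproduct {n : ℕ} (D : DyadicGrid n) (v b f g : (Fin n → ℝ) → ℝ) : Prop :=
  MemLp g 2 (weightMeasure v) ∧
    Tendsto
      (fun F : Finset (HaarIndex D) =>
        eLpNorm (fun x => (∑ i ∈ F, paraTerm D b f i x) - g x) 2 (weightMeasure v))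
      atTop (𝓝 0)

/-- The operator norm `‖Π_b : L²(u) → L²(v)‖`, equal to `∞` if `Π_b` does not map `L²(u)` boundedly
to `L²(v)`. -/
def paraNorm {n : ℕ} (D : DyadicGrid n) (b u v : (Fin n → ℝ) → ℝ) : ℝ≥0∞ :=
  sInf {K : ℝ≥0∞ | ∀ f : (Fin n → ℝ) → ℝ, MemLp f 2 (weightMeasure u) →
    ∃ g : (Fin n → ℝ) → ℝ, IsParaproduct D v b f g ∧
      eLpNorm g 2 (weightMeasure v) ≤ K * eLpNorm f 2 (weightMeasure u)}

/-! ### The dyadic square function -/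

/-- The dyadic square function `S_D f = (∑_{Q, ε} (f, h_Q^ε)² 1_Q / |Q|)^{1/2}`. -/
def squareFunction {n : ℕ} (D : DyadicGrid n) (f : (Fin n → ℝ) → ℝ) (x : Fin n → ℝ) : ℝ≥0∞ :=
  (∑' i : HaarIndex D, (i.1 : DyadicCube n).toSet.indicator
    (fun _ => ENNReal.ofReal (haarCoeff f i.1 i.2 ^ 2) / volume (i.1 : DyadicCube n).toSet) x)
      ^ (1 / 2 : ℝ)

/-- The operator norm `‖S_D : L²(w) → L²(w)‖`. -/
def squareNorm {n : ℕ} (D : DyadicGrid n) (w : (Fin n → ℝ) → ℝ) : ℝ≥0∞ :=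
  sInf {K : ℝ≥0∞ | ∀ f : (Fin n → ℝ) → ℝ, MemLp f 2 (weightMeasure w) →
    eLpNorm (squareFunction D f) 2 (weightMeasure w) ≤ K * eLpNorm f 2 (weightMeasure w)}

end Bloom

end

/-! The `BMO` norm is bounded by testing the paraproduct on `1_R`. Inside `R` the function `Π_b 1_R`
has the same martingale differences as `b`, so by Lebesgue differentiation the two differ by a
constant on `R` (`ae_eq_const`), and Cauchy–Schwarz between `L²(w⁻¹)` and `L²(w)` bounds the
oscillation (`mass_dev_le_of_paraproduct`).

The quadratic upper bound is, by duality, an estimate of `∑ |(b,h)| |⟨f⟩| |(g,h)|` with `f, g ∈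
L²(w)`; `sum_treeTerm_le` carries it. Starting from a cube `R`, stop where the averages of `|f|` or
`|g|`, or the oscillation of `b` about `⟨b⟩_R`, become large. The stopped martingales are bounded,
and Cauchy–Schwarz bounds the contribution of the region above the stopping cubes by a multiple of
`B ⟨f⟩⟨g⟩⟨w⟩|R|`. With `σ = w⁻¹`, one factor of the characteristic turns this into `(f/σ)(g/σ)
σ(R)`, and a second one replaces `σ(R)` by the `σ` mass of the part of `R` that is never stopped.
These parts are summed by the concave Bellman function `4φ - 2f²/σ`, where `φ` is the mass of `f²
w`; its tangent planes are additive in the cube, and this takes the place of a Carleson embedding.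
The bound holds for all signed partial sums, which in a Hilbert space gives unconditional
convergence (`summable_of_signed_bound`).

For sharpness, let `w = r ^ k` on the layers of a chain of cubes shrinking to a corner and let `f =
w⁻¹` on the top cube. Averages are geometric series, so the characteristic is explicit and tends to
infinity as `r` decreases to `2⁻ⁿ`. Since `w` decreases and `f` increases towards the corner, all
terms of `∫ f Π_w f` have the same sign and add up to a multiple of `t² ‖f‖²`
(`paraNorm_extremal_ge`).

On the line a squared Haar function is constant on its interval, so expanding `∫ (E_N f)² w` over
one generation gives exactly `(f,h)² ⟨w⟩ + 2 (w,h)⟨f⟩(f,h)` (`sum_energy_child`). Telescoping yields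
`‖S f‖² ≤ ‖f‖² + 2 |∫ f Π_w f|`. Together with `‖w‖ ≤ 2` in `BMO(w)` this transfers the quadratic
bound for paraproducts to the linear one for the square function; the same chain weight shows that
the latter is sharp. -/

noncomputable section

namespace Bloom

set_option linter.unusedSectionVars false

section

variable {n : ℕ}

/-! ### Geometry of cubes and grids -/

theorem cube_eq_pi (a : Fin n → ℝ) (l : ℝ) :
    cube a l = Set.pi Set.univ fun i => Set.Ico (a i) (a i + l) := by
  ext x; simp [cube]

theorem measurableSet_cube (a : Fin n → ℝ) (l : ℝ) : MeasurableSet (cube a l) := by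
  rw [cube_eq_pi]
  exact MeasurableSet.univ_pi fun i => measurableSet_Ico

theorem volume_cube (a : Fin n → ℝ) (l : ℝ) : volume (cube a l) = ENNReal.ofReal l ^ n := by
  rw [cube_eq_pi, Real.volume_pi_Ico]; simp

theorem corner_mem_cube (a : Fin n → ℝ) {l : ℝ} (hl : 0 < l) : a ∈ cube a l :=
  fun i => ⟨le_rfl, by linarith⟩

/-- If the small cube reached beyond the large one in direction `i`, it would contain a point with
`i`-th coordinate `b i + m`, which the half-open large cube omits. -/
theorem cube_subset_bounds {a b : Fin n → ℝ} {l m : ℝ} (hl : 0 < l) (h : cube a l ⊆ cube b m)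
    (i : Fin n) : b i ≤ a i ∧ a i + l ≤ b i + m := by
  have h1 := h (corner_mem_cube a hl) i
  refine ⟨h1.1, ?_⟩
  by_contra! hc
  have hx : Function.update a i (b i + m) ∈ cube a l := by
    intro j
    by_cases hj : j = i
    · subst hj; simp only [Function.update_self]; exact ⟨h1.2.le, hc⟩
    · simp only [Function.update_of_ne hj]; exact ⟨le_rfl, by linarith⟩
  have := (h hx i).2
  simp at this

theorem DyadicCube.side_pos (Q : DyadicCube n) : 0 < Q.side := zpow_pos (by norm_num) _

theorem DyadicCube.measurableSet (Q : DyadicCube n) : MeasurableSet Q.toSet :=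
  measurableSet_cube _ _

/-- The volume of a dyadic cube. -/
def DyadicCube.vol (Q : DyadicCube n) : ℝ := Q.side ^ n

theorem DyadicCube.vol_pos (Q : DyadicCube n) : 0 < Q.vol := pow_pos Q.side_pos n

theorem DyadicCube.volume_toSet (Q : DyadicCube n) : volume Q.toSet = ENNReal.ofReal Q.vol := by
  rw [toSet, volume_cube, vol, ENNReal.ofReal_pow Q.side_pos.le]

theorem DyadicCube.volume_real (Q : DyadicCube n) : volume.real Q.toSet = Q.vol := by
  rw [Measure.real, Q.volume_toSet, ENNReal.toReal_ofReal Q.vol_pos.le]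

theorem DyadicCube.corner_mem (Q : DyadicCube n) : Q.corner ∈ Q.toSet :=
  corner_mem_cube _ Q.side_pos

theorem avg_eq (f : (Fin n → ℝ) → ℝ) (Q : DyadicCube n) :
    avg f Q.toSet = (∫ x in Q.toSet, f x) / Q.vol := by
  rw [avg, setAverage_eq, Q.volume_real, smul_eq_mul, inv_mul_eq_div]

/-- The children of a dyadic cube, indexed by the halves chosen in each coordinate. -/
def DyadicCube.child (Q : DyadicCube n) (s : Fin n → Bool) : DyadicCube n :=
  ⟨Q.gen - 1, fun i => Q.corner i + if s i then Q.side / 2 else 0⟩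

theorem DyadicCube.side_child (Q : DyadicCube n) (s : Fin n → Bool) :
    (Q.child s).side = Q.side / 2 := by
  simp only [side, child]
  rw [zpow_sub_one₀ (by norm_num)]; rfl

theorem DyadicCube.vol_child (Q : DyadicCube n) (s : Fin n → Bool) :
    (Q.child s).vol = Q.vol / 2 ^ n := by
  rw [vol, side_child, div_pow, vol]

/-- The index of the child which contains a given point. -/
def DyadicCube.childIdx (Q : DyadicCube n) (x : Fin n → ℝ) (i : Fin n) : Bool :=
  decide (Q.corner i + Q.side / 2 ≤ x i)

theorem DyadicCube.mem_child_iff (Q : DyadicCube n) (s : Fin n → Bool) (x : Fin n → ℝ) :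
    x ∈ (Q.child s).toSet ↔ x ∈ Q.toSet ∧ Q.childIdx x = s := by
  have hl := Q.side_pos
  simp only [toSet, side_child]
  constructor
  · intro h
    refine ⟨fun i => ?_, funext fun i => ?_⟩
    · have := h i
      simp only [child] at this
      split_ifs at this <;> constructor <;> linarith
    · have := h i
      simp only [child] at this
      cases hs : s i <;> simp only [hs, if_true, if_false, Bool.false_eq_true] at this <;>
        simp only [childIdx, decide_eq_true_eq, decide_eq_false_iff_not] <;> linarith
  · rintro ⟨h, rfl⟩ i
    have := h i
    simp only [child, childIdx, decide_eq_true_eq]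
    split_ifs with h1 <;> constructor <;> linarith

theorem DyadicCube.child_subset (Q : DyadicCube n) (s : Fin n → Bool) :
    (Q.child s).toSet ⊆ Q.toSet := fun x hx => ((Q.mem_child_iff s x).1 hx).1

theorem DyadicCube.iUnion_child (Q : DyadicCube n) : ⋃ s, (Q.child s).toSet = Q.toSet := by
  ext x; simp [mem_child_iff]

theorem DyadicCube.disjoint_child (Q : DyadicCube n) {s t : Fin n → Bool} (h : s ≠ t) :
    Disjoint (Q.child s).toSet (Q.child t).toSet := by
  rw [Set.disjoint_left]
  intro x hs ht
  exact h (((Q.mem_child_iff s x).1 hs).2.symm.trans ((Q.mem_child_iff t x).1 ht).2)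

theorem DyadicCube.setIntegral_eq_sum_child (Q : DyadicCube n) {f : (Fin n → ℝ) → ℝ}
    (hf : IntegrableOn f Q.toSet) :
    ∫ x in Q.toSet, f x = ∑ s, ∫ x in (Q.child s).toSet, f x := by
  rw [← Q.iUnion_child, integral_iUnion_fintype (fun s => (Q.child s).measurableSet)
    (fun s t h => Q.disjoint_child h) fun s => hf.mono_set (Q.child_subset s)]

/-! ### Combinatorics of a grid: children, finite trees, covers. -/

namespace DyadicGrid

variable (D : DyadicGrid n)

theorem eq_of_mem {P Q : DyadicCube n} (hP : P ∈ D.cubes) (hQ : Q ∈ D.cubes) (hg : P.gen = Q.gen)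
    {x : Fin n → ℝ} (hxP : x ∈ P.toSet) (hxQ : x ∈ Q.toSet) : P = Q :=
  (D.partition Q.gen x).unique ⟨hP, hg, hxP⟩ ⟨hQ, rfl, hxQ⟩

theorem side_le_side_iff {P Q : DyadicCube n} : P.side ≤ Q.side ↔ P.gen ≤ Q.gen :=
  zpow_le_zpow_iff_right₀ (by norm_num)

variable {D}

/-- The cube of a given generation which contains a given point. -/
def cubeAt (D : DyadicGrid n) (k : ℤ) (x : Fin n → ℝ) : D.cubes :=
  ⟨(D.partition k x).choose, (D.partition k x).choose_spec.1.1⟩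

theorem gen_cubeAt (k : ℤ) (x : Fin n → ℝ) : (cubeAt D k x).1.gen = k :=
  (D.partition k x).choose_spec.1.2.1

theorem mem_cubeAt (k : ℤ) (x : Fin n → ℝ) : x ∈ (cubeAt D k x).1.toSet :=
  (D.partition k x).choose_spec.1.2.2

theorem cubeAt_eq {k : ℤ} {x : Fin n → ℝ} {Q : D.cubes} (hg : Q.1.gen = k) (hx : x ∈ Q.1.toSet) :
    cubeAt D k x = Q :=
  Subtype.ext (D.eq_of_mem (cubeAt D k x).2 Q.2 ((gen_cubeAt k x).trans hg.symm)
    (mem_cubeAt k x) hx)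

theorem disjoint_of_gen_eq {P Q : D.cubes} (hg : P.1.gen = Q.1.gen) (hne : P ≠ Q) :
    Disjoint P.1.toSet Q.1.toSet := by
  rw [Set.disjoint_left]
  intro x hP hQ
  exact hne (Subtype.ext (D.eq_of_mem P.2 Q.2 hg hP hQ))

variable (D) [NeZero n]

/-- This is where positive dimension enters: in dimension zero all cubes are the same point set and
the generation cannot be read off. -/
theorem gen_le_of_subset {P Q : DyadicCube n} (h : P.toSet ⊆ Q.toSet) : P.gen ≤ Q.gen := by
  have := cube_subset_bounds P.side_pos h ⟨0, Nat.pos_of_ne_zero (NeZero.ne n)⟩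
  rw [← side_le_side_iff]; linarith

theorem subset_of_mem {P Q : DyadicCube n} (hP : P ∈ D.cubes) (hQ : Q ∈ D.cubes)
    (hg : P.gen ≤ Q.gen) {x : Fin n → ℝ} (hxP : x ∈ P.toSet) (hxQ : x ∈ Q.toSet) :
    P.toSet ⊆ Q.toSet := by
  rcases D.nested P hP Q hQ with h | h | h
  · exact Set.inter_eq_left.1 h
  · have h1 := Set.inter_eq_right.1 h
    rw [D.eq_of_mem hP hQ (le_antisymm hg (gen_le_of_subset h1)) hxP hxQ]
  · exact absurd (show x ∈ P.toSet ∩ Q.toSet from ⟨hxP, hxQ⟩) (by simp [h])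

/-- The grid axioms only say that cubes of half the side partition space and that those meeting `Q`
lie in `Q`. The grid cube through an interior point of the child is pinned to the right corner by
comparing it with the grid cubes through points close to the relevant faces. -/
theorem child_mem {Q : DyadicCube n} (hQ : Q ∈ D.cubes) (s : Fin n → Bool) :
    Q.child s ∈ D.cubes := by
  have hl := Q.side_pos
  have key : ∀ z ∈ Q.toSet, ∃ P ∈ D.cubes, P.gen = Q.gen - 1 ∧ z ∈ P.toSet ∧
      P.side = Q.side / 2 ∧ ∀ i, Q.corner i ≤ P.corner i ∧ P.corner i ≤ Q.corner i + Q.side / 2 := by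
    intro z hz
    obtain ⟨P, ⟨hP, hg, hzP⟩, -⟩ := D.partition (Q.gen - 1) z
    have hside : P.side = Q.side / 2 := by
      rw [DyadicCube.side, hg, zpow_sub_one₀ (by norm_num)]; rfl
    refine ⟨P, hP, hg, hzP, hside, fun i => ?_⟩
    have := cube_subset_bounds P.side_pos (D.subset_of_mem hP hQ (by omega) hzP hz) i
    exact ⟨this.1, by linarith [this.2]⟩
  set x : Fin n → ℝ := fun i => Q.corner i + if s i then Q.side * (3 / 4) else Q.side / 4 with hx
  obtain ⟨P, hP, hg, hxP, hside, hc⟩ := key x (fun i => by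
    simp only [hx]; split_ifs <;> constructor <;> linarith)
  have hlow : ∀ i, s i = false → P.corner i = Q.corner i := by
    -- Moving the low coordinates to the lower face forces the corner there to be that of `Q`; the
    -- cube obtained still contains `x`, so it is `P`.
    set z : Fin n → ℝ := fun i => Q.corner i + if s i then Q.side * (3 / 4) else 0 with hz
    obtain ⟨P', hP', hg', hzP', hside', hc'⟩ := key z (fun i => by
      simp only [hz]; split_ifs <;> constructor <;> linarith)
    have hcor : ∀ i, s i = false → P'.corner i = Q.corner i := by
      intro i hi
      have h1 := (hzP' i).1
      have h2 := (hc' i).1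
      simp only [hz, hi, Bool.false_eq_true, if_false] at h1
      linarith
    have : P = P' := by
      refine D.eq_of_mem hP hP' (hg.trans hg'.symm) hxP fun i => ?_
      have h1 := hzP' i
      rw [hside'] at h1 ⊢
      cases hi : s i
      · rw [hcor i hi]
        simp only [hx, hi, Bool.false_eq_true, if_false]
        constructor <;> linarith
      · simp only [hz, hx, hi, if_true] at h1 ⊢
        exact h1
    rw [this]; exact hcor
  have hhigh : ∀ i, s i = true → P.corner i = Q.corner i + Q.side / 2 := by
    intro i hi
    refine le_antisymm (hc i).2 (le_of_forall_pos_lt_add fun δ hδ => ?_)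
    set η := min δ (Q.side / 4) with hη
    have hη0 : 0 < η := lt_min hδ (by linarith)
    have hη1 : η ≤ δ := min_le_left _ _
    have hη2 : η ≤ Q.side / 4 := min_le_right _ _
    -- A point at distance `η` from the upper faces forces the corner above `Q.side / 2 - η` in the
    -- high coordinates. The upper faces are not in the cube, hence the limit in `η`.
    set z : Fin n → ℝ := fun i => Q.corner i + if s i then Q.side - η else Q.side / 4 with hz
    obtain ⟨P', hP', hg', hzP', hside', hc'⟩ := key z (fun i => by
      simp only [hz]; split_ifs <;> constructor <;> linarith)
    have : P = P' := by
      refine D.eq_of_mem hP hP' (hg.trans hg'.symm) hxP fun j => ?_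
      have h1 := hzP' j
      have h2 := hc' j
      rw [hside'] at h1 ⊢
      cases hj : s j
      · simp only [hz, hx, hj, Bool.false_eq_true, if_false] at h1 ⊢
        exact h1
      · simp only [hz, hx, hj, if_true] at h1 ⊢
        constructor <;> linarith
    have h1 := (hzP' i).2
    simp only [hz, hi, if_true, hside'] at h1
    rw [this]; linarith
  have : P = Q.child s := by
    have h1 : P.corner = (Q.child s).corner := by
      ext i
      cases hi : s i
      · simp [DyadicCube.child, hi, hlow i hi]
      · simp [DyadicCube.child, hi, hhigh i hi]
    cases P
    simp only [DyadicCube.child] at *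
    simp [h1, hg]
  rwa [← this]

variable {D}

/-- The children of a cube of the grid, as cubes of the grid. -/
def child (Q : D.cubes) (s : Fin n → Bool) : D.cubes := ⟨Q.1.child s, D.child_mem Q.2 s⟩

theorem coe_child (Q : D.cubes) (s : Fin n → Bool) : (child Q s : DyadicCube n) = Q.1.child s := rfl

theorem subset_child {P Q : D.cubes} (h : P.1.toSet ⊆ Q.1.toSet) (hne : P ≠ Q) :
    ∃ s, P.1.toSet ⊆ (child Q s).1.toSet := by
  have hx := P.1.corner_mem
  refine ⟨Q.1.childIdx P.1.corner, D.subset_of_mem P.2 (child Q _).2 ?_ hx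
    ((Q.1.mem_child_iff _ _).2 ⟨h hx, rfl⟩)⟩
  have h1 := gen_le_of_subset h
  have h2 : P.1.gen ≠ Q.1.gen := fun h2 => hne (Subtype.ext (D.eq_of_mem P.2 Q.2 h2 hx (h hx)))
  show P.1.gen ≤ Q.1.gen - 1
  omega

/-- The descendants of a cube of the grid, of the first `N` generations (itself included). -/
def tree : ℕ → D.cubes → Finset D.cubes
  | 0, _ => ∅
  | N + 1, Q => by
    classical exact insert Q (Finset.univ.biUnion fun s => tree N (child Q s))

/-- The inequality is strict because `N` counts generations with the root included; depth `0` is the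
empty tree. -/
theorem mem_tree {N : ℕ} {P Q : D.cubes} :
    P ∈ tree N Q ↔ P.1.toSet ⊆ Q.1.toSet ∧ Q.1.gen < P.1.gen + N := by
  classical
  induction N generalizing Q with
  | zero =>
    simp only [tree, Finset.notMem_empty, false_iff, not_and]
    intro h
    have := gen_le_of_subset h
    push_cast; omega
  | succ N ih =>
    simp only [tree, Finset.mem_insert, Finset.mem_biUnion, Finset.mem_univ, true_and, ih]
    have hg : ∀ s, (child Q s).1.gen = Q.1.gen - 1 := fun s => rfl
    constructor
    · rintro (rfl | ⟨s, h1, h2⟩)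
      · exact ⟨subset_rfl, by push_cast; omega⟩
      · refine ⟨h1.trans (Q.1.child_subset s), ?_⟩
        rw [hg] at h2; push_cast; omega
    · rintro ⟨h1, h2⟩
      by_cases hne : P = Q
      · exact Or.inl hne
      · obtain ⟨s, hs⟩ := subset_child h1 hne
        refine Or.inr ⟨s, hs, ?_⟩
        rw [hg]; push_cast at h2; omega

theorem sum_tree_succ (t : D.cubes → ℝ) (N : ℕ) (Q : D.cubes) :
    ∑ P ∈ tree (N + 1) Q, t P = t Q + ∑ s, ∑ P ∈ tree N (child Q s), t P := by
  classical
  rw [tree, Finset.sum_insert, Finset.sum_biUnion]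
  · intro s _ s' _ hs
    rw [Function.onFun, Finset.disjoint_left]
    intro P hP hP'
    have h1 := (mem_tree.1 hP).1 P.1.corner_mem
    have h2 := (mem_tree.1 hP').1 P.1.corner_mem
    exact Set.disjoint_left.1 (Q.1.disjoint_child hs) h1 h2
  · simp only [Finset.mem_biUnion, not_exists, not_and]
    intro s _ hQ
    have := gen_le_of_subset (mem_tree.1 hQ).1
    have hg : (child Q s).1.gen = Q.1.gen - 1 := rfl
    omega

theorem subset_cubeAt (P : D.cubes) {k : ℤ} (hk : P.1.gen ≤ k) :
    P.1.toSet ⊆ (cubeAt D k P.1.corner).1.toSet :=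
  D.subset_of_mem P.2 (cubeAt D k _).2 (by rwa [gen_cubeAt]) P.1.corner_mem (mem_cubeAt k _)

instance : Nonempty D.cubes := ⟨cubeAt D 0 0⟩

/-- Finitely many cubes of the grid lie in finitely many trees with roots of equal generation. -/
theorem exists_cover (F : Finset D.cubes) : ∃ (k : ℤ) (N : ℕ) (T : Finset D.cubes),
    (∀ R ∈ T, R.1.gen = k) ∧ ∀ P ∈ F, ∃ R ∈ T, P ∈ tree N R := by
  classical
  obtain ⟨k, hk⟩ : ∃ k : ℤ, ∀ P ∈ F, P.1.gen ≤ k := by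
    obtain ⟨k, hk⟩ := (F.image fun P => P.1.gen).bddAbove
    exact ⟨k, fun P hP => hk (by simpa using ⟨P.1, ⟨P.2, hP⟩, rfl⟩)⟩
  obtain ⟨m, hm⟩ : ∃ m : ℤ, ∀ P ∈ F, m ≤ P.1.gen := by
    obtain ⟨k, hk⟩ := (F.image fun P => P.1.gen).bddBelow
    exact ⟨k, fun P hP => hk (by simpa using ⟨P.1, ⟨P.2, hP⟩, rfl⟩)⟩
  refine ⟨k, (k - m).toNat + 1, F.image fun P => cubeAt D k P.1.corner, ?_, ?_⟩
  · intro R hR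
    obtain ⟨P, -, rfl⟩ := Finset.mem_image.1 hR
    exact gen_cubeAt _ _
  · intro P hP
    refine ⟨_, Finset.mem_image_of_mem _ hP, mem_tree.2 ⟨subset_cubeAt P (hk P hP), ?_⟩⟩
    rw [gen_cubeAt]
    have := hm P hP
    push_cast
    omega

theorem pairwiseDisjoint_tree {k : ℤ} {T : Finset D.cubes} (hT : ∀ R ∈ T, R.1.gen = k) (N : ℕ) :
    (T : Set D.cubes).PairwiseDisjoint (tree N) := by
  intro R hR R' hR' hne
  rw [Function.onFun, Finset.disjoint_left]
  intro P hP hP'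
  exact Set.disjoint_left.1 (disjoint_of_gen_eq ((hT R hR).trans (hT R' hR').symm) hne)
    ((mem_tree.1 hP).1 P.1.corner_mem) ((mem_tree.1 hP').1 P.1.corner_mem)

/-- Every cube contains a rational point, and with the generation this determines it. Needed to
interchange sum and integral for the square function. -/
instance : Countable D.cubes := by
  refine Function.Surjective.countable
    (f := fun p : ℤ × (Fin n → ℚ) => cubeAt D p.1 fun i => (p.2 i : ℝ)) fun Q => ?_
  have h : ∀ i, ∃ q : ℚ, Q.1.corner i < q ∧ (q : ℝ) < Q.1.corner i + Q.1.side :=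
    fun i => exists_rat_btwn (by linarith [Q.1.side_pos])
  choose q hq using h
  exact ⟨(Q.1.gen, q), cubeAt_eq rfl fun i => ⟨(hq i).1.le, (hq i).2⟩⟩

end DyadicGrid

end

section

namespace DyadicGrid

variable {n : ℕ} [NeZero n] {D : DyadicGrid n}

/-! ### A stopping time estimate on the dyadic tree -/

/-- An additive function of the cubes of a grid. -/
def IsAdditive (μ : D.cubes → ℝ) : Prop := ∀ Q, μ Q = ∑ s, μ (child Q s)

theorem IsAdditive.add {μ ν : D.cubes → ℝ} (h : IsAdditive μ) (h' : IsAdditive ν) :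
    IsAdditive fun Q => μ Q + ν Q := fun Q => by
  rw [Finset.sum_add_distrib, ← h, ← h']

theorem IsAdditive.const_mul {μ : D.cubes → ℝ} (h : IsAdditive μ) (c : ℝ) :
    IsAdditive fun Q => c * μ Q := fun Q => by
  rw [← Finset.mul_sum, ← h]

theorem IsAdditive.child_le {μ : D.cubes → ℝ} (h : IsAdditive μ) (h0 : ∀ Q, 0 ≤ μ Q)
    (Q : D.cubes) (s : Fin n → Bool) : μ (child Q s) ≤ μ Q := by
  rw [h Q]
  exact Finset.single_le_sum (f := fun s => μ (child Q s)) (fun s _ => h0 _) (Finset.mem_univ s)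

/-- The volume of a cube of the grid. -/
def vol (Q : D.cubes) : ℝ := Q.1.vol

theorem vol_pos (Q : D.cubes) : 0 < vol Q := Q.1.vol_pos

theorem vol_child (Q : D.cubes) (s : Fin n → Bool) : vol (child Q s) = vol Q / 2 ^ n :=
  Q.1.vol_child s

theorem vol_eq (Q : D.cubes) (s : Fin n → Bool) : vol Q = 2 ^ n * vol (child Q s) := by
  rw [vol_child]; field_simp

theorem isAdditive_vol : IsAdditive (vol (D := D)) := fun Q => by
  simp only [vol_child, Finset.sum_const, Finset.card_univ, Fintype.card_pi, Fintype.card_bool,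
    Finset.prod_const, Fintype.card_fin, nsmul_eq_mul]
  push_cast
  field_simp

/-- The square of the `L²` norm of the martingale difference of an additive function. -/
def sqDiff (a : D.cubes → ℝ) (Q : D.cubes) : ℝ :=
  ∑ s, a (child Q s) ^ 2 / vol (child Q s) - a Q ^ 2 / vol Q

/-- A martingale difference does not see constants: the cross terms are additive and cancel between
`Q` and its children. -/
theorem sqDiff_eq {a : D.cubes → ℝ} (ha : IsAdditive a) (c : ℝ) (Q : D.cubes) :
    sqDiff a Q = ∑ s, (a (child Q s) - c * vol (child Q s)) ^ 2 / vol (child Q s) -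
      (a Q - c * vol Q) ^ 2 / vol Q := by
  have h : ∀ P : D.cubes, (a P - c * vol P) ^ 2 / vol P =
      a P ^ 2 / vol P + ((-2 * c) * a P + c ^ 2 * vol P) := fun P => by
    have := (vol_pos P).ne'
    field_simp; ring
  simp only [h, Finset.sum_add_distrib, ← Finset.mul_sum, sqDiff]
  rw [← ha Q, ← isAdditive_vol Q]; ring

theorem sqDiff_nonneg {a : D.cubes → ℝ} (ha : IsAdditive a) (Q : D.cubes) : 0 ≤ sqDiff a Q := by
  have h := (vol_pos Q).ne'
  rw [sqDiff_eq ha (a Q / vol Q), div_mul_cancel₀ _ h, sub_self]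
  simp only [ne_eq, OfNat.ofNat_ne_zero, not_false_eq_true, zero_pow, zero_div, sub_zero]
  exact Finset.sum_nonneg fun s _ => div_nonneg (sq_nonneg _) (vol_pos _).le

open Classical in
/-- The sum over the descendants which have no bad ancestor. -/
def regionSum (Bad : D.cubes → Prop) (t : D.cubes → ℝ) : ℕ → D.cubes → ℝ
  | 0, _ => 0
  | N + 1, Q => if Bad Q then 0 else t Q + ∑ s, regionSum Bad t N (child Q s)

open Classical in
/-- The part of an additive function outside the maximal bad descendants. -/
def goodPart (Bad : D.cubes → Prop) (μ : D.cubes → ℝ) : ℕ → D.cubes → ℝ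
  | 0, Q => if Bad Q then 0 else μ Q
  | N + 1, Q => if Bad Q then 0 else ∑ s, goodPart Bad μ N (child Q s)

open Classical in
/-- The sum over the descendants which have a bad ancestor. -/
def badSum (Bad : D.cubes → Prop) (t : D.cubes → ℝ) : ℕ → D.cubes → ℝ
  | 0, _ => 0
  | N + 1, Q => if Bad Q then ∑ P ∈ tree (N + 1) Q, t P else ∑ s, badSum Bad t N (child Q s)

variable {Bad : D.cubes → Prop}

theorem regionSum_add_badSum (t : D.cubes → ℝ) (N : ℕ) (Q : D.cubes) :
    regionSum Bad t N Q + badSum Bad t N Q = ∑ P ∈ tree N Q, t P := by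
  induction N generalizing Q with
  | zero => simp [regionSum, badSum, tree]
  | succ N ih =>
    simp only [regionSum, badSum]
    split_ifs with h
    · simp
    · rw [sum_tree_succ, add_assoc, ← Finset.sum_add_distrib]
      simp only [ih]

theorem regionSum_mono {t u : D.cubes → ℝ} (h : ∀ Q, ¬ Bad Q → t Q ≤ u Q) (N : ℕ) (Q : D.cubes) :
    regionSum Bad t N Q ≤ regionSum Bad u N Q := by
  induction N generalizing Q with
  | zero => simp [regionSum]
  | succ N ih =>
    simp only [regionSum]
    split_ifs with hQ
    · exact le_rfl
    · exact add_le_add (h Q hQ) (Finset.sum_le_sum fun s _ => ih _)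

theorem regionSum_nonneg {t : D.cubes → ℝ} (h : ∀ Q, 0 ≤ t Q) (N : ℕ) (Q : D.cubes) :
    0 ≤ regionSum Bad t N Q := by
  induction N generalizing Q with
  | zero => simp [regionSum]
  | succ N ih =>
    simp only [regionSum]
    split_ifs with hQ
    · exact le_rfl
    · exact add_nonneg (h Q) (Finset.sum_nonneg fun s _ => ih _)

theorem regionSum_const_mul (c : ℝ) (t : D.cubes → ℝ) (N : ℕ) (Q : D.cubes) :
    regionSum Bad (fun P => c * t P) N Q = c * regionSum Bad t N Q := by
  induction N generalizing Q with
  | zero => simp [regionSum]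
  | succ N ih =>
    simp only [regionSum]
    split_ifs with hQ
    · simp
    · simp only [ih, ← Finset.mul_sum, mul_add]

theorem sqrt_mul_sqrt_add_le {x y z u : ℝ} (hx : 0 ≤ x) (hy : 0 ≤ y) (hz : 0 ≤ z) (hu : 0 ≤ u) :
    √x * √y + √z * √u ≤ √(x + z) * √(y + u) := by
  rw [← Real.sqrt_mul hx, ← Real.sqrt_mul hz, ← Real.sqrt_mul (by positivity)]
  apply Real.le_sqrt_of_sq_le
  have h1 : √(x * y) * √(z * u) = √(x * u) * √(z * y) := by
    rw [← Real.sqrt_mul (by positivity), ← Real.sqrt_mul (by positivity)]; ring_nf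
  have h2 := Real.sq_sqrt (mul_nonneg hx hy)
  have h3 := Real.sq_sqrt (mul_nonneg hz hu)
  have h4 := Real.sq_sqrt (mul_nonneg hx hu)
  have h5 := Real.sq_sqrt (mul_nonneg hz hy)
  nlinarith [sq_nonneg (√(x * u) - √(z * y))]

theorem regionSum_sqrt_mul_sqrt_le {x y : D.cubes → ℝ} (hx : ∀ Q, 0 ≤ x Q) (hy : ∀ Q, 0 ≤ y Q)
    (N : ℕ) (Q : D.cubes) :
    regionSum Bad (fun P => √(x P) * √(y P)) N Q ≤
      √(regionSum Bad x N Q) * √(regionSum Bad y N Q) := by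
  induction N generalizing Q with
  | zero => simp [regionSum]
  | succ N ih =>
    simp only [regionSum]
    split_ifs with hQ
    · simp
    · refine le_trans (add_le_add_right ((Finset.sum_le_sum fun s _ => ih _).trans
        (Real.sum_sqrt_mul_sqrt_le _ (fun s => regionSum_nonneg hx _ _)
          fun s => regionSum_nonneg hy _ _)) _) ?_
      exact sqrt_mul_sqrt_add_le (hx Q) (hy Q)
        (Finset.sum_nonneg fun s _ => regionSum_nonneg hx _ _)
        (Finset.sum_nonneg fun s _ => regionSum_nonneg hy _ _)

/-- Orthogonality for a stopped martingale. The second term on the left is what telescopes. A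
stopping cube has a good parent, whose volume is `2 ^ n` times larger, so the average of the
majorant overshoots `m` by at most this factor. -/
theorem regionSum_sqDiff_le {a α : D.cubes → ℝ} (ha : IsAdditive a) (hα : IsAdditive α)
    (hα0 : ∀ Q, 0 ≤ α Q) {c m : ℝ} (haα : ∀ Q, |a Q - c * vol Q| ≤ α Q)
    (hBad : ∀ Q, ¬ Bad Q → α Q ≤ m * vol Q) (N : ℕ) (Q : D.cubes)
    (hQ : α Q ≤ 2 ^ n * m * vol Q) :
    regionSum Bad (sqDiff a) N Q + (a Q - c * vol Q) ^ 2 / vol Q ≤ (2 ^ n * m) ^ 2 * vol Q := by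
  have hsmall : (a Q - c * vol Q) ^ 2 / vol Q ≤ (2 ^ n * m) ^ 2 * vol Q := by
    rw [div_le_iff₀ (vol_pos Q), ← sq_abs]
    have := pow_le_pow_left₀ (abs_nonneg _) ((haα Q).trans hQ) 2
    nlinarith
  induction N generalizing Q with
  | zero => simpa [regionSum] using hsmall
  | succ N ih =>
    simp only [regionSum]
    split_ifs with hb
    · simpa using hsmall
    · have hc : ∀ s, α (child Q s) ≤ 2 ^ n * m * vol (child Q s) := fun s => by
        refine (hα.child_le hα0 Q s).trans ((hBad Q hb).trans_eq ?_)
        rw [vol_eq Q s]; ring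
      have h1 := Finset.sum_le_sum fun s (_ : s ∈ Finset.univ) => ih (child Q s) (hc s) (by
        rw [div_le_iff₀ (vol_pos _), ← sq_abs]
        have := pow_le_pow_left₀ (abs_nonneg _) ((haα _).trans (hc s)) 2
        nlinarith)
      rw [Finset.sum_add_distrib, ← Finset.mul_sum, ← isAdditive_vol Q] at h1
      rw [sqDiff_eq ha c Q]
      linarith

theorem goodPart_nonneg {μ : D.cubes → ℝ} (h0 : ∀ Q, 0 ≤ μ Q) (N : ℕ) (Q : D.cubes) :
    0 ≤ goodPart Bad μ N Q := by
  induction N generalizing Q with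
  | zero => simp only [goodPart]; split_ifs; exacts [le_rfl, h0 Q]
  | succ N ih =>
    simp only [goodPart]; split_ifs
    exacts [le_rfl, Finset.sum_nonneg fun s _ => ih _]

theorem goodPart_le {μ : D.cubes → ℝ} (h : IsAdditive μ) (h0 : ∀ Q, 0 ≤ μ Q) (N : ℕ)
    (Q : D.cubes) : goodPart Bad μ N Q ≤ μ Q := by
  induction N generalizing Q with
  | zero => simp only [goodPart]; split_ifs; exacts [h0 Q, le_rfl]
  | succ N ih =>
    simp only [goodPart]; split_ifs
    · exact h0 Q
    · rw [h Q]; exact Finset.sum_le_sum fun s _ => ih _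

/-- The weak type bound: the maximal bad cubes are disjoint and on each the volume is less than `θ /
6`. -/
theorem vol_sub_goodPart_le {θ : D.cubes → ℝ} (h : IsAdditive θ) (h0 : ∀ Q, 0 ≤ θ Q) (N : ℕ)
    (hBad : ∀ Q, Bad Q → 6 * vol Q < θ Q) (Q : D.cubes) :
    vol Q - goodPart Bad vol N Q ≤ θ Q / 6 := by
  have h1 := h0 Q
  induction N generalizing Q with
  | zero =>
    simp only [goodPart]; split_ifs with hQ
    · have := hBad Q hQ; linarith
    · linarith
  | succ N ih =>
    simp only [goodPart]; split_ifs with hQ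
    · have := hBad Q hQ; linarith
    · have := Finset.sum_le_sum fun s (_ : s ∈ Finset.univ) => ih (child Q s) (h0 _)
      rw [Finset.sum_sub_distrib, ← Finset.sum_div, ← h Q, ← isAdditive_vol Q] at this
      exact this

/-- Cauchy–Schwarz over the unstopped leaves: the good part is large for `σ` when it is large for
Lebesgue measure. -/
theorem sq_goodPart_vol_le {w σ : D.cubes → ℝ} (hw : ∀ Q, 0 ≤ w Q) (hσ : ∀ Q, 0 ≤ σ Q)
    (h : ∀ Q, vol Q ^ 2 ≤ w Q * σ Q) (N : ℕ) (Q : D.cubes) :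
    goodPart Bad vol N Q ^ 2 ≤ goodPart Bad w N Q * goodPart Bad σ N Q := by
  induction N generalizing Q with
  | zero => simp only [goodPart]; split_ifs; exacts [by simp, h Q]
  | succ N ih =>
    simp only [goodPart]; split_ifs
    · simp
    · exact Finset.sum_sq_le_sum_mul_sum_of_sq_le_mul _ (fun s _ => goodPart_nonneg hw _ _)
        (fun s _ => goodPart_nonneg hσ _ _) fun s _ => ih _

/-- Maximal bad cubes and good leaves tile the root. An additive `V` that dominates the inductive
bound `Φ` on the former and `κ σ` on the latter therefore dominates both sums together. -/
theorem badSum_add_le {t σ Φ V : D.cubes → ℝ} {κ : ℝ} (hV : IsAdditive V) {N₀ : ℕ}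
    (ht : ∀ N ≤ N₀, ∀ Q, ∑ P ∈ tree N Q, t P ≤ Φ Q) (hΦ : ∀ Q, Φ Q ≤ V Q)
    (hσ : ∀ Q, κ * σ Q ≤ V Q) (hV0 : ∀ Q, 0 ≤ V Q) (N : ℕ) (hN : N ≤ N₀) (Q : D.cubes) :
    badSum Bad t N Q + κ * goodPart Bad σ N Q ≤ V Q := by
  induction N generalizing Q with
  | zero =>
    simp only [badSum, goodPart]; split_ifs
    · simpa using hV0 Q
    · simpa using hσ Q
  | succ N ih =>
    simp only [badSum, goodPart]; split_ifs with h
    · simpa using (ht _ hN Q).trans (hΦ Q)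
    · rw [hV Q, Finset.mul_sum, ← Finset.sum_add_distrib]
      exact Finset.sum_le_sum fun s _ => ih (by omega) _

end DyadicGrid

end

/-! ### The tree estimate, by stopping times and a Bellman function. -/

section

namespace DyadicGrid

variable {n : ℕ} [NeZero n] {D : DyadicGrid n}

/-- The Bellman function of the tree estimate. -/
def bellman (f φ σ : D.cubes → ℝ) (Q : D.cubes) : ℝ := 4 * φ Q - 2 * f Q ^ 2 / σ Q

theorem bellman_nonneg {f φ σ : D.cubes → ℝ} (hσ0 : ∀ Q, 0 < σ Q)
    (hfφ : ∀ Q, f Q ^ 2 ≤ φ Q * σ Q) (Q : D.cubes) : 0 ≤ bellman f φ σ Q := by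
  have h1 : f Q ^ 2 / σ Q ≤ φ Q := (div_le_iff₀ (hσ0 Q)).2 (hfφ Q)
  have h2 : 0 ≤ f Q ^ 2 / σ Q := div_nonneg (sq_nonneg _) (hσ0 Q).le
  rw [bellman, mul_div_assoc]; linarith

/-- The affine majorant of the Bellman function with slope `y`. -/
def bellmanAt (y : ℝ) (f φ σ : D.cubes → ℝ) (Q : D.cubes) : ℝ :=
  4 * φ Q + (-4 * y) * f Q + 2 * y ^ 2 * σ Q

theorem isAdditive_bellmanAt (y : ℝ) {f φ σ : D.cubes → ℝ} (hf : IsAdditive f) (hφ : IsAdditive φ)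
    (hσ : IsAdditive σ) : IsAdditive (bellmanAt y f φ σ) :=
  ((hφ.const_mul 4).add (hf.const_mul (-4 * y))).add (hσ.const_mul (2 * y ^ 2))

/-- Concavity: the gap is `2 (f - y σ)² / σ`, which vanishes for `y = f / σ`, so `bellmanAt` is a
tangent plane. -/
theorem bellman_le_bellmanAt (y : ℝ) {f φ σ : D.cubes → ℝ} (hσ0 : ∀ Q, 0 < σ Q) (Q : D.cubes) :
    bellman f φ σ Q ≤ bellmanAt y f φ σ Q := by
  have h := hσ0 Q
  have : bellmanAt y f φ σ Q - bellman f φ σ Q = 2 * (f Q - y * σ Q) ^ 2 / σ Q := by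
    rw [bellman, bellmanAt]; field_simp; ring
  have h2 : 0 ≤ 2 * (f Q - y * σ Q) ^ 2 / σ Q := by positivity
  linarith

/-- The gain on the unstopped leaves: since `f² / σ ≤ φ`, what remains after removing `y² σ` is at
least the square `(2 f - y σ)² / σ`. The constants `4` and `2` of `bellman` are chosen for this. -/
theorem sq_mul_le_bellmanAt (y : ℝ) {f φ σ : D.cubes → ℝ} (hσ0 : ∀ Q, 0 < σ Q)
    (hfφ : ∀ Q, f Q ^ 2 ≤ φ Q * σ Q) (Q : D.cubes) : y ^ 2 * σ Q ≤ bellmanAt y f φ σ Q := by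
  have h := hσ0 Q
  have h1 : f Q ^ 2 / σ Q ≤ φ Q := (div_le_iff₀ h).2 (hfφ Q)
  have h2 : 4 * (f Q ^ 2 / σ Q) - 4 * y * f Q + y ^ 2 * σ Q = (2 * f Q - y * σ Q) ^ 2 / σ Q := by
    field_simp; ring
  have h3 : 0 ≤ (2 * f Q - y * σ Q) ^ 2 / σ Q := by positivity
  rw [bellmanAt]; linarith

theorem bellmanAt_self {f φ σ : D.cubes → ℝ} (R : D.cubes) (hσ0 : 0 < σ R) :
    bellmanAt (f R / σ R) f φ σ R = bellman f φ σ R := by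
  rw [bellman, bellmanAt]; field_simp; ring

/-- The terms of the tree estimate. -/
def treeTerm (f g b : D.cubes → ℝ) (Q : D.cubes) : ℝ :=
  f Q / vol Q * (√(sqDiff b Q) * √(sqDiff g Q))

/-- The degenerate roots, set aside because the stopping rule divides by the averages of `f` and
`g`. -/
theorem treeTerm_eq_zero {f g b : D.cubes → ℝ} {f' g' : D.cubes → ℝ} (hf : IsAdditive f)
    (hf0 : ∀ Q, 0 ≤ f Q) (hg : IsAdditive g) (hg0 : ∀ Q, 0 ≤ g Q) (hff : ∀ Q, |f' Q| ≤ f Q)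
    (hgg : ∀ Q, |g' Q| ≤ g Q) {R : D.cubes} (h : f R = 0 ∨ g R = 0) (N : ℕ) :
    ∑ P ∈ tree N R, treeTerm f' g' b P = 0 := by
  induction N generalizing R with
  | zero => simp [tree]
  | succ N ih =>
    rw [sum_tree_succ]
    have hc : ∀ s, f (child R s) = 0 ∨ g (child R s) = 0 := fun s => by
      rcases h with h | h
      · exact Or.inl (le_antisymm ((hf.child_le hf0 R s).trans_eq h) (hf0 _))
      · exact Or.inr (le_antisymm ((hg.child_le hg0 R s).trans_eq h) (hg0 _))
    rw [Finset.sum_eq_zero fun s _ => ih (hc s), add_zero, treeTerm]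
    rcases h with h | h
    · have : f' R = 0 := abs_nonpos_iff.1 ((hff R).trans_eq h)
      simp [this]
    · have h0 : ∀ P, g P = 0 → g' P = 0 := fun P hP => abs_nonpos_iff.1 ((hgg P).trans_eq hP)
      have h1 : sqDiff g' R = 0 := by
        rw [sqDiff, h0 R h, Finset.sum_eq_zero]
        · simp
        · intro s _
          rw [h0 _ (le_antisymm ((hg.child_le hg0 R s).trans_eq h) (hg0 _))]; simp
      simp [h1]

-- The functions `f`, `g` stand for the masses of `|f|`, `|g|`, and `g'` for that of the signed `g`;
-- `φ`, `γ` are the masses of the squares against `w`, and `β R` is the mass of the deviation of `b`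
-- from its average over `R`. One factor `A` comes from `w σ ≤ A |R|²` and one from comparing `σ(R)`
-- with its good part.
set_option maxHeartbeats 1000000 in
theorem sum_treeTerm_le {f φ g g' γ w σ b : D.cubes → ℝ} {β : D.cubes → D.cubes → ℝ} {A B : ℝ}
    (hf : IsAdditive f) (hf0 : ∀ Q, 0 ≤ f Q) (hφ : IsAdditive φ)
    (hfφ : ∀ Q, f Q ^ 2 ≤ φ Q * σ Q)
    (hg : IsAdditive g) (hg0 : ∀ Q, 0 ≤ g Q) (hγ : IsAdditive γ)
    (hgγ : ∀ Q, g Q ^ 2 ≤ γ Q * σ Q) (hg' : IsAdditive g') (hgg : ∀ Q, |g' Q| ≤ g Q)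
    (hw : IsAdditive w) (hw0 : ∀ Q, 0 < w Q) (hσ : IsAdditive σ) (hσ0 : ∀ Q, 0 < σ Q)
    (hwσ : ∀ Q, vol Q ^ 2 ≤ w Q * σ Q) (hA : ∀ Q, w Q * σ Q ≤ A * vol Q ^ 2)
    (hb : IsAdditive b) (hβ : ∀ R, IsAdditive (β R)) (hβ0 : ∀ R Q, 0 ≤ β R Q)
    (hbβ : ∀ R Q, |b Q - b R / vol R * vol Q| ≤ β R Q) (hB : 0 < B)
    (hβB : ∀ R, β R R ≤ B * w R) (N : ℕ) (R : D.cubes) :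
    ∑ Q ∈ tree N R, treeTerm f g' b Q ≤
      432 * (2 ^ n) ^ 2 * B * A ^ 2 * (bellman f φ σ R + bellman g γ σ R) := by
  have hA0 : 0 < A := by
    have h1 := mul_pos (hw0 R) (hσ0 R)
    have h2 := h1.trans_le (hA R)
    exact pos_of_mul_pos_left h2 (sq_nonneg _)
  set K : ℝ := 432 * (2 ^ n) ^ 2 * B * A ^ 2 with hK
  have hK0 : 0 < K := by positivity
  have hff : ∀ Q, |f Q| ≤ f Q := fun Q => (abs_of_nonneg (hf0 Q)).le
  -- The root is never bad, so the stopping cubes carry trees of smaller but varying depth.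
  induction N using Nat.strong_induction_on generalizing R with
  | _ N ih =>
  rcases N with _ | N
  · simp only [tree, Finset.sum_empty]
    exact mul_nonneg hK0.le
      (add_nonneg (bellman_nonneg hσ0 hfφ R) (bellman_nonneg hσ0 hgγ R))
  by_cases hz : f R = 0 ∨ g R = 0
  · rw [treeTerm_eq_zero hf hf0 hg hg0 hff hgg hz]
    exact mul_nonneg hK0.le
      (add_nonneg (bellman_nonneg hσ0 hfφ R) (bellman_nonneg hσ0 hgγ R))
  push Not at hz
  have hv := vol_pos R
  have hfR : 0 < f R := lt_of_le_of_ne (hf0 R) hz.1.symm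
  have hgR : 0 < g R := lt_of_le_of_ne (hg0 R) hz.2.symm
  have hwR := hw0 R
  have hσR := hσ0 R
  set F := f R / vol R with hF
  set G := g R / vol R with hG
  set p := B * w R / vol R with hp
  have hF0 : 0 < F := by positivity
  have hG0 : 0 < G := by positivity
  have hp0 : 0 < p := by positivity
  -- All three stopping rules in one additive function. Each summand is normalised to be at most
  -- `vol R` at the root, so `θ R ≤ 3 * vol R`.
  set θ : D.cubes → ℝ := fun Q => F⁻¹ * f Q + G⁻¹ * g Q + p⁻¹ * β R Q with hθ
  have hθadd : IsAdditive θ := ((hf.const_mul _).add (hg.const_mul _)).add ((hβ R).const_mul _)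
  have hθ1 : ∀ Q, 0 ≤ F⁻¹ * f Q := fun Q => mul_nonneg (by positivity) (hf0 Q)
  have hθ2 : ∀ Q, 0 ≤ G⁻¹ * g Q := fun Q => mul_nonneg (by positivity) (hg0 Q)
  have hθ3 : ∀ Q, 0 ≤ p⁻¹ * β R Q := fun Q => mul_nonneg (by positivity) (hβ0 R Q)
  have hθ0 : ∀ Q, 0 ≤ θ Q := fun Q => add_nonneg (add_nonneg (hθ1 Q) (hθ2 Q)) (hθ3 Q)
  have hθR : θ R ≤ 3 * vol R := by
    have h1 : F⁻¹ * f R = vol R := by rw [hF]; field_simp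
    have h2 : G⁻¹ * g R = vol R := by rw [hG]; field_simp
    have h3 : p⁻¹ * β R R ≤ vol R := by
      rw [inv_mul_le_iff₀ hp0]
      refine (hβB R).trans_eq ?_
      rw [hp]; field_simp
    simp only [hθ]; linarith
  -- The threshold is twice the bound `3` at the root, so bad cubes cover at most half of `R`.
  set Bad : D.cubes → Prop := fun Q => 6 * vol Q < θ Q with hBad
  have hRgood : ¬ Bad R := by simp only [hBad, not_lt]; linarith
  have hgoodf : ∀ Q, ¬ Bad Q → f Q ≤ 6 * F * vol Q := fun Q hQ => by
    simp only [hBad, not_lt, hθ] at hQ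
    have h1 := hθ2 Q
    have h2 := hθ3 Q
    have : F⁻¹ * f Q ≤ 6 * vol Q := by linarith
    rw [inv_mul_le_iff₀ hF0] at this; linarith
  have hgoodg : ∀ Q, ¬ Bad Q → g Q ≤ 6 * G * vol Q := fun Q hQ => by
    simp only [hBad, not_lt, hθ] at hQ
    have h1 := hθ1 Q
    have h2 := hθ3 Q
    have : G⁻¹ * g Q ≤ 6 * vol Q := by linarith
    rw [inv_mul_le_iff₀ hG0] at this; linarith
  have hgoodb : ∀ Q, ¬ Bad Q → β R Q ≤ 6 * p * vol Q := fun Q hQ => by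
    simp only [hBad, not_lt, hθ] at hQ
    have h1 := hθ1 Q
    have h2 := hθ2 Q
    have : p⁻¹ * β R Q ≤ 6 * vol Q := by linarith
    rw [inv_mul_le_iff₀ hp0] at this; linarith
  have h1n : (1 : ℝ) ≤ 2 ^ n := one_le_pow₀ (by norm_num)
  have hsqb : regionSum Bad (sqDiff b) (N + 1) R ≤ (2 ^ n * (6 * p)) ^ 2 * vol R := by
    have h := regionSum_sqDiff_le (c := b R / vol R) hb (hβ R) (hβ0 R) (hbβ R) hgoodb (N + 1) R
      ((hgoodb R hRgood).trans (by
        have : 0 ≤ 6 * p * vol R := by positivity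
        nlinarith))
    have h0 : 0 ≤ (b R - b R / vol R * vol R) ^ 2 / vol R := by positivity
    linarith
  have hsqg : regionSum Bad (sqDiff g') (N + 1) R ≤ (2 ^ n * (6 * G)) ^ 2 * vol R := by
    have h := regionSum_sqDiff_le (c := 0) hg' hg hg0 (fun Q => by simpa using hgg Q) hgoodg
      (N + 1) R ((hgoodg R hRgood).trans (by
        have : 0 ≤ 6 * G * vol R := by positivity
        nlinarith))
    have h0 : 0 ≤ (g' R - 0 * vol R) ^ 2 / vol R := by positivity
    linarith
  have hreg : regionSum Bad (treeTerm f g' b) (N + 1) R ≤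
      216 * (2 ^ n) ^ 2 * (F * G * p) * vol R := by
    calc regionSum Bad (treeTerm f g' b) (N + 1) R
        ≤ regionSum Bad (fun Q => 6 * F * (√(sqDiff b Q) * √(sqDiff g' Q))) (N + 1) R := by
          refine regionSum_mono (fun Q hQ => ?_) _ _
          refine mul_le_mul_of_nonneg_right ?_ (by positivity)
          rw [div_le_iff₀ (vol_pos Q)]
          exact hgoodf Q hQ
      _ = 6 * F * regionSum Bad (fun Q => √(sqDiff b Q) * √(sqDiff g' Q)) (N + 1) R :=
          regionSum_const_mul _ _ _ _
      _ ≤ 6 * F * (√((2 ^ n * (6 * p)) ^ 2 * vol R) * √((2 ^ n * (6 * G)) ^ 2 * vol R)) := by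
          refine mul_le_mul_of_nonneg_left ?_ (by positivity)
          refine (regionSum_sqrt_mul_sqrt_le (sqDiff_nonneg hb) (sqDiff_nonneg hg') _ _).trans ?_
          gcongr
      _ = 216 * (2 ^ n) ^ 2 * (F * G * p) * vol R := by
          rw [Real.sqrt_mul (sq_nonneg _), Real.sqrt_mul (sq_nonneg _),
            Real.sqrt_sq (by positivity), Real.sqrt_sq (by positivity)]
          linear_combination (6 * F * (2 ^ n * (6 * p)) * (2 ^ n * (6 * G))) *
            Real.mul_self_sqrt hv.le
  set lσ := goodPart Bad σ (N + 1) R with hlσ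
  -- The good part has at least half the volume, so `|R|² ≤ 4 w(R) lσ`; combined with `w(R) σ(R) ≤ A
  -- |R|²`, the factor `w(R)` cancels.
  have hgood : σ R ≤ 4 * A * lσ := by
    have h1 := vol_sub_goodPart_le hθadd hθ0 (N + 1) (fun Q h => h) R
    have h2 : vol R ≤ 2 * goodPart Bad vol (N + 1) R := by linarith
    have h3 := sq_goodPart_vol_le (Bad := Bad) (fun Q => (hw0 Q).le) (fun Q => (hσ0 Q).le) hwσ
      (N + 1) R
    have h4 := goodPart_le (Bad := Bad) hw (fun Q => (hw0 Q).le) (N + 1) R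
    have h5 := goodPart_nonneg (Bad := Bad) (fun Q => (hσ0 Q).le) (N + 1) R
    have h6 := hA R
    have h7 : vol R ^ 2 ≤ 4 * (w R * lσ) := by
      have := mul_le_mul_of_nonneg_right h4 h5
      nlinarith
    have h8 : w R * σ R ≤ w R * (4 * A * lσ) := by nlinarith
    exact le_of_mul_le_mul_left h8 hwR
  set y := f R / σ R with hy
  set u := g R / σ R with hu
  have hy0 : 0 < y := by positivity
  have hu0 : 0 < u := by positivity
  -- The constant is `216 · 4 = 864`, which is `2 · 432`; the factor `2` is used up by `2 y u ≤ y² +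
  -- u²`.
  have hreg2 : regionSum Bad (treeTerm f g' b) (N + 1) R ≤ K * (y ^ 2 + u ^ 2) * lσ := by
    have h1 : F * G * p * vol R ≤ B * A * (y * u) * σ R := by
      have e : F * G * p * vol R = B * (y * u) * σ R * (w R * σ R / vol R ^ 2) := by
        rw [hF, hG, hp, hy, hu]; field_simp
      have h2 : w R * σ R / vol R ^ 2 ≤ A := (div_le_iff₀ (by positivity)).2 (hA R)
      rw [e]
      calc B * (y * u) * σ R * (w R * σ R / vol R ^ 2) ≤ B * (y * u) * σ R * A := by gcongr
        _ = _ := by ring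
    have h3 : B * A * (y * u) * σ R ≤ B * A * (y * u) * (4 * A * lσ) := by gcongr
    have h5 : 0 ≤ lσ := goodPart_nonneg (Bad := Bad) (fun Q => (hσ0 Q).le) (N + 1) R
    have h4 : 2 * (y * u) ≤ y ^ 2 + u ^ 2 := by nlinarith [sq_nonneg (y - u)]
    calc _ ≤ 216 * (2 ^ n) ^ 2 * (F * G * p * vol R) := hreg.trans_eq (by ring)
      _ ≤ 216 * (2 ^ n) ^ 2 * (B * A * (y * u) * (4 * A * lσ)) := by
          exact mul_le_mul_of_nonneg_left (h1.trans h3) (by positivity)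
      _ = K * (2 * (y * u)) * lσ := by rw [hK]; ring
      _ ≤ _ := by gcongr
  -- The tangent planes at `R` are additive, dominate the inductive bound on bad cubes, pay for the
  -- region through the good leaves, and agree with the Bellman functions at `R` itself.
  have hV := (isAdditive_bellmanAt y hf hφ hσ).add (isAdditive_bellmanAt u hg hγ hσ)
  have hbad := badSum_add_le (Bad := Bad) (t := treeTerm f g' b) (σ := σ)
    (Φ := fun Q => K * (bellman f φ σ Q + bellman g γ σ Q)) (κ := K * (y ^ 2 + u ^ 2))
    (hV.const_mul K) (N₀ := N) (fun M hM Q => ih M (by omega) Q)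
    (fun Q => mul_le_mul_of_nonneg_left
      (add_le_add (bellman_le_bellmanAt y hσ0 Q) (bellman_le_bellmanAt u hσ0 Q)) hK0.le)
    (fun Q => by
      rw [mul_assoc, add_mul]
      exact mul_le_mul_of_nonneg_left
        (add_le_add (sq_mul_le_bellmanAt y hσ0 hfφ Q) (sq_mul_le_bellmanAt u hσ0 hgγ Q)) hK0.le)
    (fun Q => mul_nonneg hK0.le (add_nonneg
      ((mul_nonneg (sq_nonneg _) (hσ0 Q).le).trans (sq_mul_le_bellmanAt y hσ0 hfφ Q))
      ((mul_nonneg (sq_nonneg _) (hσ0 Q).le).trans (sq_mul_le_bellmanAt u hσ0 hgγ Q))))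
    N le_rfl
  have hsum := Finset.sum_le_sum fun s (_ : s ∈ Finset.univ) => hbad (child R s)
  rw [Finset.sum_add_distrib, ← Finset.mul_sum, ← (hV.const_mul K) R] at hsum
  have hl2 : lσ = ∑ s, goodPart Bad σ N (child R s) := by
    rw [hlσ]; simp only [goodPart]; rw [if_neg hRgood]
  have hb2 : badSum Bad (treeTerm f g' b) (N + 1) R =
      ∑ s, badSum Bad (treeTerm f g' b) N (child R s) := by
    simp only [badSum]; rw [if_neg hRgood]
  rw [← hl2, ← hb2] at hsum
  have e1 : bellmanAt y f φ σ R = bellman f φ σ R := bellmanAt_self R hσR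
  have e2 : bellmanAt u g γ σ R = bellman g γ σ R := bellmanAt_self R hσR
  beta_reduce at hsum
  rw [e1, e2] at hsum
  rw [← regionSum_add_badSum (Bad := Bad)]
  linarith

end DyadicGrid

end

section

variable {n : ℕ}

/-! ### Haar functions on a single cube -/

/-- The sign of a one-dimensional Haar function on a half of its interval. -/
def haarSign (e : Fin 2) (s : Bool) : ℝ := if e = 0 then (if s then 1 else -1) else 1

theorem haar1_of_mem {a l t : ℝ} (e : Fin 2) (h1 : a ≤ t) (h2 : t < a + l) :
    haar1 a l e t = (√l)⁻¹ * haarSign e (decide (a + l / 2 ≤ t)) := by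
  rw [haar1, haarSign]
  congr 1
  by_cases he : e = 0
  · by_cases ht : a + l / 2 ≤ t
    · simp [he, ht, h2, not_lt.2 ht]
    · simp [he, ht, h1, not_le.1 ht]
  · simp [he, h1, h2]

theorem haar1_of_notMem {a l t : ℝ} (e : Fin 2) (hl : 0 < l) (h : ¬ (a ≤ t ∧ t < a + l)) :
    haar1 a l e t = 0 := by
  have h1 : t ∉ Set.Ico (a + l / 2) (a + l) := fun ht => h ⟨by linarith [ht.1], ht.2⟩
  have h2 : t ∉ Set.Ico a (a + l / 2) := fun ht => h ⟨ht.1, by linarith [ht.2]⟩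
  have h3 : t ∉ Set.Ico a (a + l) := h
  rw [haar1, Set.indicator_of_notMem h1, Set.indicator_of_notMem h2, Set.indicator_of_notMem h3]
  simp

/-- The value of a Haar function on a child of its cube. -/
def haarVal (Q : DyadicCube n) (e : Fin n → Fin 2) (s : Fin n → Bool) : ℝ :=
  ∏ k, (√Q.side)⁻¹ * haarSign (e k) (s k)

theorem haar_of_mem (Q : DyadicCube n) (e : Signature n) {x : Fin n → ℝ} (hx : x ∈ Q.toSet) :
    haar Q e x = haarVal Q e.1 (Q.childIdx x) :=
  Finset.prod_congr rfl fun k _ => haar1_of_mem _ (hx k).1 (hx k).2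

theorem haar_of_mem_child (Q : DyadicCube n) (e : Signature n) {s : Fin n → Bool} {x : Fin n → ℝ}
    (hx : x ∈ (Q.child s).toSet) : haar Q e x = haarVal Q e.1 s := by
  obtain ⟨h1, h2⟩ := (Q.mem_child_iff s x).1 hx
  rw [haar_of_mem Q e h1, h2]

theorem haar_of_notMem (Q : DyadicCube n) (e : Signature n) {x : Fin n → ℝ} (hx : x ∉ Q.toSet) :
    haar Q e x = 0 := by
  simp only [DyadicCube.toSet, cube, Set.mem_ofPred_eq, not_forall] at hx
  obtain ⟨k, hk⟩ := hx
  exact Finset.prod_eq_zero (Finset.mem_univ k) (haar1_of_notMem _ Q.side_pos hk)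

theorem haar_eq_sum (Q : DyadicCube n) (e : Signature n) :
    haar Q e = fun x => ∑ s, (Q.child s).toSet.indicator (fun _ => haarVal Q e.1 s) x := by
  ext x
  by_cases hx : x ∈ Q.toSet
  · have h : x ∈ (Q.child (Q.childIdx x)).toSet := (Q.mem_child_iff _ x).2 ⟨hx, rfl⟩
    rw [Finset.sum_eq_single (Q.childIdx x), Set.indicator_of_mem h, haar_of_mem Q e hx]
    · intro s _ hs
      rw [Set.indicator_of_notMem]
      exact fun h' => hs ((Q.mem_child_iff _ x).1 h').2.symm
    · simp
  · rw [haar_of_notMem Q e hx, Finset.sum_eq_zero]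
    intro s _
    rw [Set.indicator_of_notMem fun h => hx (Q.child_subset s h)]

theorem measurable_haar (Q : DyadicCube n) (e : Signature n) : Measurable (haar Q e) := by
  rw [haar_eq_sum]
  exact Finset.measurable_fun_sum _ fun s _ => measurable_const.indicator (Q.child s).measurableSet

theorem haarSign_sq (e : Fin 2) (s : Bool) : haarSign e s ^ 2 = 1 := by
  rw [haarSign]; split_ifs <;> norm_num

theorem haarVal_sq (Q : DyadicCube n) (e : Fin n → Fin 2) (s : Fin n → Bool) :
    haarVal Q e s ^ 2 = Q.vol⁻¹ := by
  rw [haarVal, ← Finset.prod_pow]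
  simp only [mul_pow, haarSign_sq, mul_one, inv_pow, Real.sq_sqrt Q.side_pos.le,
    Finset.prod_const, Finset.card_univ, Fintype.card_fin, DyadicCube.vol]

theorem haar_sq (Q : DyadicCube n) (e : Signature n) (x : Fin n → ℝ) :
    haar Q e x ^ 2 = Q.toSet.indicator (fun _ => Q.vol⁻¹) x := by
  by_cases hx : x ∈ Q.toSet
  · rw [haar_of_mem Q e hx, haarVal_sq, Set.indicator_of_mem hx]
  · rw [haar_of_notMem Q e hx, Set.indicator_of_notMem hx]; simp

theorem abs_haar_le (Q : DyadicCube n) (e : Signature n) (x : Fin n → ℝ) :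
    |haar Q e x| ≤ √(Q.vol⁻¹) := by
  apply Real.abs_le_sqrt
  rw [haar_sq]
  exact Set.indicator_le_self' (fun _ _ => inv_nonneg.2 Q.vol_pos.le) x

theorem sum_haarVal (Q : DyadicCube n) (e : Signature n) : ∑ s, haarVal Q e.1 s = 0 := by
  obtain ⟨k, hk⟩ : ∃ k, e.1 k = 0 := by
    by_contra! h
    exact e.2 (funext fun k => by have := h k; omega)
  have := Finset.prod_univ_sum (fun _ : Fin n => (Finset.univ : Finset Bool))
    fun k s => (√Q.side)⁻¹ * haarSign (e.1 k) s
  simp only [Fintype.piFinset_univ] at this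
  simp only [haarVal]
  rw [← this]
  refine Finset.prod_eq_zero (Finset.mem_univ k) ?_
  -- In a coordinate with signature `0` the two signs cancel.
  simp [haarSign, hk]

/-- The full family of `2 ^ n` signatures is an orthogonal basis of the functions constant on
children; leaving out `ε ≡ 1` removes the projection onto constants, the term `1 / Q.vol`. -/
theorem sum_haarVal_mul_haarVal (Q : DyadicCube n) (s t : Fin n → Bool) :
    ∑ e : Signature n, haarVal Q e.1 s * haarVal Q e.1 t =
      (if s = t then 2 ^ n / Q.vol else 0) - 1 / Q.vol := by
  have hs : (√Q.side)⁻¹ * (√Q.side)⁻¹ = Q.side⁻¹ := by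
    rw [← mul_inv, Real.mul_self_sqrt Q.side_pos.le]
  have hall : ∑ e : Fin n → Fin 2, haarVal Q e s * haarVal Q e t =
      if s = t then 2 ^ n / Q.vol else 0 := by
    have := Finset.prod_univ_sum (fun _ : Fin n => (Finset.univ : Finset (Fin 2)))
      fun k e => ((√Q.side)⁻¹ * haarSign e (s k)) * ((√Q.side)⁻¹ * haarSign e (t k))
    simp only [Fintype.piFinset_univ, Finset.prod_mul_distrib (s := Finset.univ)
      (f := fun k => _ * haarSign _ (s k))] at this
    simp only [haarVal, ← Finset.prod_mul_distrib] at this ⊢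
    rw [← this]
    have h2 : ∀ k, ∑ e : Fin 2, (√Q.side)⁻¹ * haarSign e (s k) *
        ((√Q.side)⁻¹ * haarSign e (t k)) = if s k = t k then 2 / Q.side else 0 := by
      intro k
      rw [Fin.sum_univ_two]
      cases s k <;> cases t k <;> simp [haarSign] <;> rw [hs] <;> ring
    simp only [h2]
    split_ifs with h
    · subst h; simp [DyadicCube.vol]
    · obtain ⟨k, hk⟩ := Function.ne_iff.1 h
      exact Finset.prod_eq_zero (Finset.mem_univ k) (if_neg hk)
  have hone : haarVal Q (fun _ => 1) s * haarVal Q (fun _ => 1) t = 1 / Q.vol := by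
    simp only [haarVal, ← Finset.prod_mul_distrib]
    simp [haarSign, hs, DyadicCube.vol]
  rw [← hall, ← hone, eq_sub_iff_add_eq]
  have := Fintype.sum_subtype_add_sum_subtype (fun e : Fin n → Fin 2 => e ≠ fun _ => 1)
    fun e => haarVal Q e s * haarVal Q e t
  rw [← this]
  congr 1
  let _ : Unique {e : Fin n → Fin 2 // ¬ e ≠ fun _ => 1} :=
    ⟨⟨⟨fun _ => 1, by simp⟩⟩, fun e => Subtype.ext (not_not.1 e.2)⟩
  rw [Fintype.sum_unique]
  rfl

theorem integrableOn_mul_haar {f : (Fin n → ℝ) → ℝ} {Q : DyadicCube n}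
    (hf : IntegrableOn f Q.toSet) (e : Signature n) : Integrable fun x => f x * haar Q e x := by
  have : (fun x => f x * haar Q e x) = Q.toSet.indicator fun x => f x * haar Q e x := by
    ext x
    by_cases hx : x ∈ Q.toSet
    · rw [Set.indicator_of_mem hx]
    · rw [Set.indicator_of_notMem hx, haar_of_notMem Q e hx, mul_zero]
  rw [this, integrable_indicator_iff Q.measurableSet]
  exact hf.mul_bdd (measurable_haar Q e).aestronglyMeasurable
    (ae_of_all _ fun x => abs_haar_le Q e x)

theorem haarCoeff_eq_sum {f : (Fin n → ℝ) → ℝ} {Q : DyadicCube n}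
    (hf : IntegrableOn f Q.toSet) (e : Signature n) :
    haarCoeff f Q e = ∑ s, (∫ x in (Q.child s).toSet, f x) * haarVal Q e.1 s := by
  rw [haarCoeff, ← setIntegral_eq_integral_of_forall_compl_eq_zero (s := Q.toSet)
    (fun x hx => by rw [haar_of_notMem Q e hx, mul_zero]),
    Q.setIntegral_eq_sum_child (integrableOn_mul_haar hf e).integrableOn]
  refine Finset.sum_congr rfl fun s _ => ?_
  rw [← integral_mul_const]
  exact setIntegral_congr_fun (Q.child s).measurableSet fun x hx => by
    simp only [haar_of_mem_child Q e hx]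

theorem sum_haarCoeff_mul_haarVal {f : (Fin n → ℝ) → ℝ} {Q : DyadicCube n}
    (hf : IntegrableOn f Q.toSet) (s : Fin n → Bool) :
    ∑ e : Signature n, haarCoeff f Q e * haarVal Q e.1 s =
      avg f (Q.child s).toSet - avg f Q.toSet := by
  simp only [haarCoeff_eq_sum hf, Finset.sum_mul, mul_assoc]
  rw [Finset.sum_comm]
  simp only [← Finset.mul_sum, sum_haarVal_mul_haarVal, mul_sub, Finset.sum_sub_distrib]
  simp only [mul_ite, mul_zero, Finset.sum_ite_eq', Finset.mem_univ, if_true]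
  rw [← Finset.sum_mul, ← Q.setIntegral_eq_sum_child hf, avg_eq, avg_eq, Q.vol_child]
  have := Q.vol_pos.ne'
  field_simp

theorem sum_haarCoeff_mul_haarCoeff {f u : (Fin n → ℝ) → ℝ} {Q : DyadicCube n}
    (hf : IntegrableOn f Q.toSet) (hu : IntegrableOn u Q.toSet) :
    ∑ e : Signature n, haarCoeff f Q e * haarCoeff u Q e =
      ∑ s, (∫ x in (Q.child s).toSet, u x) * (avg f (Q.child s).toSet - avg f Q.toSet) := by
  simp only [← sum_haarCoeff_mul_haarVal hf, haarCoeff_eq_sum hu, Finset.mul_sum]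
  rw [Finset.sum_comm]
  exact Finset.sum_congr rfl fun s _ => Finset.sum_congr rfl fun e _ => by ring

theorem haarCoeff_const (c : ℝ) (Q : DyadicCube n) (e : Signature n) :
    haarCoeff (fun _ => c) Q e = 0 := by
  have hf : IntegrableOn (fun _ : Fin n → ℝ => c) Q.toSet :=
    integrableOn_const (by rw [Q.volume_toSet]; exact ENNReal.ofReal_ne_top)
  rw [haarCoeff_eq_sum hf]
  simp only [setIntegral_const, DyadicCube.volume_real, DyadicCube.vol_child, smul_eq_mul]
  rw [← Finset.mul_sum, sum_haarVal, mul_zero]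

theorem integral_haar (Q : DyadicCube n) (e : Signature n) : ∫ x, haar Q e x = 0 := by
  simpa [haarCoeff] using haarCoeff_const 1 Q e

theorem haarCoeff_congr {f g : (Fin n → ℝ) → ℝ} {Q : DyadicCube n} (e : Signature n)
    (h : f =ᵐ[volume.restrict Q.toSet] g) : haarCoeff f Q e = haarCoeff g Q e := by
  have hz : ∀ f : (Fin n → ℝ) → ℝ, haarCoeff f Q e = ∫ x in Q.toSet, f x * haar Q e x := fun f =>
    (setIntegral_eq_integral_of_forall_compl_eq_zero
      fun x hx => by rw [haar_of_notMem Q e hx, mul_zero]).symm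
  rw [hz, hz]
  exact integral_congr_ae (h.mono fun x hx => by simp only [hx])

namespace DyadicGrid

variable [NeZero n] {D : DyadicGrid n}

/-- The integral of a function over a cube of the grid. -/
def mass (f : (Fin n → ℝ) → ℝ) (Q : D.cubes) : ℝ := ∫ x in Q.1.toSet, f x

theorem avg_eq_mass (f : (Fin n → ℝ) → ℝ) (Q : D.cubes) : avg f Q.1.toSet = mass f Q / vol Q :=
  avg_eq f Q.1

theorem isAdditive_mass {f : (Fin n → ℝ) → ℝ} (hf : ∀ Q : D.cubes, IntegrableOn f Q.1.toSet) :
    IsAdditive (mass (D := D) f) := fun Q => Q.1.setIntegral_eq_sum_child (hf Q)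

/-- Parseval on one cube; it lets the stopping argument work with masses only, without Haar
functions. -/
theorem sum_haarCoeff_sq {f : (Fin n → ℝ) → ℝ} (hf : ∀ Q : D.cubes, IntegrableOn f Q.1.toSet)
    (Q : D.cubes) : ∑ e, haarCoeff f Q.1 e ^ 2 = sqDiff (mass f) Q := by
  simp only [sq]
  rw [sum_haarCoeff_mul_haarCoeff (hf Q) (hf Q), sqDiff]
  simp only [avg_eq, mul_sub, Finset.sum_sub_distrib, ← Finset.sum_mul]
  rw [← Q.1.setIntegral_eq_sum_child (hf Q)]
  congr 1
  · refine Finset.sum_congr rfl fun s _ => ?_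
    rw [sq, mul_div_assoc]; rfl
  · rw [sq, mul_div_assoc]; rfl

theorem sum_abs_haarCoeff_mul_le {f g : (Fin n → ℝ) → ℝ}
    (hf : ∀ Q : D.cubes, IntegrableOn f Q.1.toSet) (hg : ∀ Q : D.cubes, IntegrableOn g Q.1.toSet)
    (Q : D.cubes) : ∑ e, |haarCoeff f Q.1 e| * |haarCoeff g Q.1 e| ≤
      √(sqDiff (mass f) Q) * √(sqDiff (mass g) Q) := by
  rw [← sum_haarCoeff_sq hf, ← sum_haarCoeff_sq hg]
  simpa using Real.sum_mul_le_sqrt_mul_sqrt Finset.univ (fun e => |haarCoeff f Q.1 e|)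
    fun e => |haarCoeff g Q.1 e|

/-- The Haar coefficient of a function which is constant on the cube, outside a proper subcube. -/
theorem haarCoeff_of_const_off {f : (Fin n → ℝ) → ℝ} {P Q : D.cubes}
    (hf : IntegrableOn f Q.1.toSet) (hPQ : P.1.toSet ⊆ Q.1.toSet) {s : Fin n → Bool}
    (hP : P.1.toSet ⊆ (child Q s).1.toSet) {c : ℝ} (hc : ∀ x ∈ Q.1.toSet \ P.1.toSet, f x = c)
    (e : Signature n) : haarCoeff f Q.1 e = (mass f P - c * vol P) * haarVal Q.1 e.1 s := by
  have hci : Integrable fun x => c * haar Q.1 e x :=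
    integrableOn_mul_haar (integrableOn_const
      (by rw [Q.1.volume_toSet]; exact ENNReal.ofReal_ne_top)) e
  have h0 : ∫ x, c * haar Q.1 e x = 0 := by rw [integral_const_mul, integral_haar, mul_zero]
  have h1 : haarCoeff f Q.1 e = ∫ x, (f x * haar Q.1 e x - c * haar Q.1 e x) := by
    rw [integral_sub (integrableOn_mul_haar hf e) hci, h0, sub_zero, haarCoeff]
  have hcP : IntegrableOn (fun _ : Fin n → ℝ => c) P.1.toSet :=
    integrableOn_const (by rw [P.1.volume_toSet]; exact ENNReal.ofReal_ne_top)
  rw [h1, ← setIntegral_eq_integral_of_forall_compl_eq_zero (s := P.1.toSet)]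
  · have : ∀ x ∈ P.1.toSet, f x * haar Q.1 e x - c * haar Q.1 e x =
        (f x - c) * haarVal Q.1 e.1 s := fun x hx => by
      rw [haar_of_mem_child Q.1 e (hP hx)]; ring
    rw [setIntegral_congr_fun P.1.measurableSet this, integral_mul_const,
      integral_sub (hf.mono_set hPQ) hcP, setIntegral_const, P.1.volume_real, smul_eq_mul,
      mul_comm P.1.vol]
    rfl
  · intro x hx
    by_cases hxQ : x ∈ Q.1.toSet
    · rw [hc x ⟨hxQ, hx⟩, sub_self]
    · rw [haar_of_notMem Q.1 e hxQ]; ring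

end DyadicGrid

end

section

variable {n : ℕ}

/-! ### Weighted `L²` spaces -/

theorem sq_integral_mul_le {α : Type*} [MeasurableSpace α] {μ : Measure α} {F G : α → ℝ}
    (hF : MemLp F 2 μ) (hG : MemLp G 2 μ) :
    (∫ x, F x * G x ∂μ) ^ 2 ≤ (∫ x, F x ^ 2 ∂μ) * ∫ x, G x ^ 2 ∂μ := by
  have h1 := hF.integrable_sq
  have h2 := hG.integrable_sq
  have h3 : Integrable (fun x => F x * G x) μ := hF.integrable_mul hG
  have := discrim_le_zero (a := ∫ x, G x ^ 2 ∂μ) (b := 2 * ∫ x, F x * G x ∂μ)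
    (c := ∫ x, F x ^ 2 ∂μ) fun c => by
    have h : 0 ≤ ∫ x, (F x + c * G x) ^ 2 ∂μ := integral_nonneg fun x => sq_nonneg _
    have e : (fun x => (F x + c * G x) ^ 2) =
        fun x => (c * c) * G x ^ 2 + (2 * c) * (F x * G x) + F x ^ 2 := by ext x; ring
    have h4 : Integrable (fun x => (c * c) * G x ^ 2 + (2 * c) * (F x * G x)) μ :=
      (h2.const_mul _).add (h3.const_mul _)
    rw [e, integral_add h4 h1,
      integral_add (h2.const_mul _) (h3.const_mul _), integral_const_mul, integral_const_mul] at h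
    linarith
  rw [discrim] at this
  linarith

theorem weightMeasure_apply (w : (Fin n → ℝ) → ℝ) {Q : Set (Fin n → ℝ)} (hQ : MeasurableSet Q) :
    weightMeasure w Q = ∫⁻ x in Q, ENNReal.ofReal (w x) := withDensity_apply _ hQ

theorem weightMeasure_ac (w : (Fin n → ℝ) → ℝ) : weightMeasure w ≪ volume :=
  withDensity_absolutelyContinuous _ _

theorem ac_weightMeasure {w : (Fin n → ℝ) → ℝ} (hm : AEMeasurable w) (hw : ∀ᵐ x, 0 < w x) :
    volume ≪ weightMeasure w :=
  withDensity_absolutelyContinuous' hm.ennreal_ofReal (hw.mono fun x hx => by simpa using hx)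

theorem eLpNorm_weightMeasure {w : (Fin n → ℝ) → ℝ} (hm : AEMeasurable w) (hw : ∀ᵐ x, 0 < w x)
    (f : (Fin n → ℝ) → ℝ) :
    eLpNorm f 2 (weightMeasure w) = eLpNorm (fun x => f x * √(w x)) 2 volume := by
  rw [eLpNorm_eq_lintegral_rpow_enorm_toReal (by norm_num) (by norm_num),
    eLpNorm_eq_lintegral_rpow_enorm_toReal (by norm_num) (by norm_num), weightMeasure,
    lintegral_withDensity_eq_lintegral_mul_non_measurable₀ _ hm.ennreal_ofReal
      (ae_of_all _ fun x => ENNReal.ofReal_lt_top)]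
  congr 1
  refine lintegral_congr_ae (hw.mono fun x hx => ?_)
  simp only [Pi.mul_apply, enorm_mul, ENNReal.toReal_ofNat, ENNReal.rpow_ofNat, mul_pow]
  rw [mul_comm]
  congr 1
  rw [Real.enorm_of_nonneg (Real.sqrt_nonneg _), ← ENNReal.ofReal_pow (Real.sqrt_nonneg _),
    Real.sq_sqrt hx.le]

theorem memLp_weightMeasure_iff {w : (Fin n → ℝ) → ℝ} (hm : AEMeasurable w)
    (hw : ∀ᵐ x, 0 < w x) {f : (Fin n → ℝ) → ℝ} :
    MemLp f 2 (weightMeasure w) ↔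
      AEStronglyMeasurable f volume ∧ MemLp (fun x => f x * √(w x)) 2 volume := by
  rw [MemLp, MemLp, eLpNorm_weightMeasure hm hw]
  have hs : AEStronglyMeasurable (fun x => √(w x)) volume :=
    hm.sqrt.aestronglyMeasurable
  constructor
  · rintro ⟨h1, h2⟩
    have h3 := h1.mono_ac (ac_weightMeasure hm hw)
    exact ⟨h3, h3.mul hs, h2⟩
  · rintro ⟨h1, -, h2⟩
    exact ⟨h1.mono_ac (weightMeasure_ac w), h2⟩

/-- The square of the norm of `L²(w)`. -/
def sqNorm (w f : (Fin n → ℝ) → ℝ) : ℝ := ∫ x, f x ^ 2 * w x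

theorem mul_sqrt_sq_ae {w : (Fin n → ℝ) → ℝ} (hw : ∀ᵐ x, 0 < w x) (f : (Fin n → ℝ) → ℝ) :
    (fun x => (f x * √(w x)) ^ 2) =ᵐ[volume] fun x => f x ^ 2 * w x :=
  hw.mono fun x hx => by simp only [mul_pow, Real.sq_sqrt hx.le]

theorem integrable_sq_mul {w : (Fin n → ℝ) → ℝ} (hm : AEMeasurable w) (hw : ∀ᵐ x, 0 < w x)
    {f : (Fin n → ℝ) → ℝ} (hf : MemLp f 2 (weightMeasure w)) :
    Integrable fun x => f x ^ 2 * w x :=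
  ((memLp_weightMeasure_iff hm hw).1 hf).2.integrable_sq.congr (mul_sqrt_sq_ae hw f)

theorem memLp_of_integrable_sq_mul {w : (Fin n → ℝ) → ℝ} (hm : AEMeasurable w)
    (hw : ∀ᵐ x, 0 < w x) {f : (Fin n → ℝ) → ℝ} (hf : AEStronglyMeasurable f volume)
    (h : Integrable fun x => f x ^ 2 * w x) : MemLp f 2 (weightMeasure w) := by
  have hs : AEStronglyMeasurable (fun x => √(w x)) volume :=
    hm.sqrt.aestronglyMeasurable
  exact (memLp_weightMeasure_iff hm hw).2
    ⟨hf, (memLp_two_iff_integrable_sq (hf.mul hs)).2 (h.congr (mul_sqrt_sq_ae hw f).symm)⟩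

theorem sqNorm_nonneg {w : (Fin n → ℝ) → ℝ} (hw : ∀ᵐ x, 0 < w x) (f : (Fin n → ℝ) → ℝ) :
    0 ≤ sqNorm w f :=
  integral_nonneg_of_ae (hw.mono fun _ hx => mul_nonneg (sq_nonneg _) hx.le)

theorem eLpNorm_sq_eq {w : (Fin n → ℝ) → ℝ} (hm : AEMeasurable w) (hw : ∀ᵐ x, 0 < w x)
    {f : (Fin n → ℝ) → ℝ} (hf : MemLp f 2 (weightMeasure w)) :
    eLpNorm f 2 (weightMeasure w) ^ 2 = ENNReal.ofReal (sqNorm w f) := by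
  rw [eLpNorm_weightMeasure hm hw, sqNorm, ← integral_congr_ae (mul_sqrt_sq_ae hw f),
    ofReal_integral_eq_lintegral_ofReal ((memLp_weightMeasure_iff hm hw).1 hf).2.integrable_sq
      (ae_of_all _ fun x => sq_nonneg _),
    eLpNorm_eq_lintegral_rpow_enorm_toReal (by norm_num) (by norm_num)]
  rw [← ENNReal.rpow_ofNat, ← ENNReal.rpow_mul]
  simp only [ENNReal.toReal_ofNat, one_div, ne_eq, OfNat.ofNat_ne_zero, not_false_eq_true,
    inv_mul_cancel₀, ENNReal.rpow_one, ENNReal.rpow_ofNat]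
  refine lintegral_congr fun x => ?_
  rw [← sq_abs, ENNReal.ofReal_pow (abs_nonneg _), Real.enorm_eq_ofReal_abs]

theorem eLpNorm_eq_ofReal {w : (Fin n → ℝ) → ℝ} (hm : AEMeasurable w) (hw : ∀ᵐ x, 0 < w x)
    {f : (Fin n → ℝ) → ℝ} (hf : MemLp f 2 (weightMeasure w)) :
    eLpNorm f 2 (weightMeasure w) = ENNReal.ofReal √(sqNorm w f) := by
  have h := eLpNorm_sq_eq hm hw hf
  rw [← Real.sq_sqrt (sqNorm_nonneg hw f), ENNReal.ofReal_pow (Real.sqrt_nonneg _)] at h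
  exact (ENNReal.pow_right_strictMono two_ne_zero).injective h

theorem aemeasurable_inv {w : (Fin n → ℝ) → ℝ} (hm : AEMeasurable w) :
    AEMeasurable (w⁻¹) volume := hm.inv

theorem inv_pos_ae {w : (Fin n → ℝ) → ℝ} (hw : ∀ᵐ x, 0 < w x) : ∀ᵐ x, 0 < (w⁻¹) x :=
  hw.mono fun _ hx => inv_pos.2 hx

theorem mul_sqrt_mul_ae {w : (Fin n → ℝ) → ℝ} (hw : ∀ᵐ x, 0 < w x) (f g : (Fin n → ℝ) → ℝ) :
    (fun x => (g x * √(w⁻¹ x)) * (f x * √(w x))) =ᵐ[volume] fun x => g x * f x := by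
  refine hw.mono fun x hx => ?_
  have h : √((w x)⁻¹) * √(w x) = 1 := by
    rw [← Real.sqrt_mul (inv_nonneg.2 hx.le), inv_mul_cancel₀ hx.ne', Real.sqrt_one]
  simp only [Pi.inv_apply]
  linear_combination (g x * f x) * h

theorem integrable_mul_of_memLp {w : (Fin n → ℝ) → ℝ} (hm : AEMeasurable w) (hw : ∀ᵐ x, 0 < w x)
    {f g : (Fin n → ℝ) → ℝ} (hg : MemLp g 2 (weightMeasure w⁻¹))
    (hf : MemLp f 2 (weightMeasure w)) : Integrable fun x => g x * f x := by
  have h1 := ((memLp_weightMeasure_iff hm hw).1 hf).2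
  have h2 := ((memLp_weightMeasure_iff (aemeasurable_inv hm) (inv_pos_ae hw)).1 hg).2
  have h3 : Integrable (fun x => (g x * √(w⁻¹ x)) * (f x * √(w x))) := h2.integrable_mul h1
  exact h3.congr (mul_sqrt_mul_ae hw f g)

/-- In the unweighted pairing, `L²(w⁻¹)` is dual to `L²(w)`: the factors `√(w⁻¹)` and `√w` cancel.
-/
theorem sq_integral_le_sqNorm {w : (Fin n → ℝ) → ℝ} (hm : AEMeasurable w) (hw : ∀ᵐ x, 0 < w x)
    {f g : (Fin n → ℝ) → ℝ} (hg : MemLp g 2 (weightMeasure w⁻¹))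
    (hf : MemLp f 2 (weightMeasure w)) :
    (∫ x, g x * f x) ^ 2 ≤ sqNorm w⁻¹ g * sqNorm w f := by
  have h1 := ((memLp_weightMeasure_iff hm hw).1 hf).2
  have h2 := ((memLp_weightMeasure_iff (aemeasurable_inv hm) (inv_pos_ae hw)).1 hg).2
  rw [← integral_congr_ae (mul_sqrt_mul_ae hw f g), sqNorm, sqNorm,
    ← integral_congr_ae (mul_sqrt_sq_ae hw f),
    ← integral_congr_ae (mul_sqrt_sq_ae (inv_pos_ae hw) g)]
  exact sq_integral_mul_le h2 h1

/-! ### `A₂` weights -/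

theorem IsWeight.aemeasurable {w : (Fin n → ℝ) → ℝ} (h : IsWeight w) : AEMeasurable w :=
  h.1.aestronglyMeasurable.aemeasurable

theorem cube_subset_closedBall (Q : DyadicCube n) :
    Q.toSet ⊆ Metric.closedBall Q.corner Q.side := by
  intro x hx
  rw [Metric.mem_closedBall, dist_pi_le_iff Q.side_pos.le]
  intro i
  have := hx i
  rw [Real.dist_eq, abs_le]; constructor <;> linarith [Q.side_pos]

theorem integrableOn_of_locallyIntegrable {f : (Fin n → ℝ) → ℝ}
    (hf : LocallyIntegrable f volume) (Q : DyadicCube n) : IntegrableOn f Q.toSet :=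
  (hf.integrableOn_isCompact (isCompact_closedBall Q.corner Q.side)).mono_set
    (cube_subset_closedBall Q)

theorem integrableOn_const_cube (c : ℝ) (Q : DyadicCube n) :
    IntegrableOn (fun _ : Fin n → ℝ => c) Q.toSet :=
  integrableOn_const (by rw [Q.volume_toSet]; exact ENNReal.ofReal_ne_top)

namespace DyadicGrid

variable [NeZero n] {D : DyadicGrid n}

theorem lintegral_eq_mass {f : (Fin n → ℝ) → ℝ} {Q : D.cubes} (hf : IntegrableOn f Q.1.toSet)
    (h0 : ∀ᵐ x, 0 ≤ f x) : ∫⁻ x in Q.1.toSet, ENNReal.ofReal (f x) = ENNReal.ofReal (mass f Q) :=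
  (ofReal_integral_eq_lintegral_ofReal hf (ae_restrict_of_ae h0)).symm

theorem weightMeasure_cube {w : (Fin n → ℝ) → ℝ} {Q : D.cubes} (hf : IntegrableOn w Q.1.toSet)
    (h0 : ∀ᵐ x, 0 < w x) : weightMeasure w Q.1.toSet = ENNReal.ofReal (mass w Q) := by
  rw [weightMeasure_apply _ Q.1.measurableSet, lintegral_eq_mass hf (h0.mono fun _ h => h.le)]

theorem mass_pos {f : (Fin n → ℝ) → ℝ} {Q : D.cubes} (hf : IntegrableOn f Q.1.toSet)
    (h0 : ∀ᵐ x, 0 < f x) : 0 < mass f Q := by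
  rw [mass, setIntegral_pos_iff_support_of_nonneg_ae
    (ae_restrict_of_ae (h0.mono fun x hx => hx.le)) hf]
  have : (Function.support f ∩ Q.1.toSet : Set _) =ᵐ[volume] Q.1.toSet := by
    filter_upwards [h0] with x hx
    exact propext ⟨fun h => h.2, fun h => ⟨hx.ne', h⟩⟩
  rw [measure_congr this, Q.1.volume_toSet]
  exact ENNReal.ofReal_pos.2 Q.1.vol_pos

theorem mass_nonneg {f : (Fin n → ℝ) → ℝ} (h0 : ∀ᵐ x, 0 ≤ f x) (Q : D.cubes) : 0 ≤ mass f Q :=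
  integral_nonneg_of_ae (ae_restrict_of_ae h0)

section A2

variable {w : (Fin n → ℝ) → ℝ}

theorem integrableOn_weight (h : MemA2 D w) (Q : D.cubes) : IntegrableOn w Q.1.toSet :=
  integrableOn_of_locallyIntegrable h.1.1 Q.1

theorem a2_term_le (D : DyadicGrid n) (w : (Fin n → ℝ) → ℝ) (Q : D.cubes) :
    ((∫⁻ x in Q.1.toSet, ENNReal.ofReal (w x)) / volume Q.1.toSet) *
      ((∫⁻ x in Q.1.toSet, ENNReal.ofReal ((w x)⁻¹)) / volume Q.1.toSet) ≤ a2Char D w :=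
  le_iSup₂ (f := fun (Q : Set (Fin n → ℝ)) (_ : Q ∈ D.sets) =>
    ((∫⁻ x in Q, ENNReal.ofReal (w x)) / volume Q) *
      ((∫⁻ x in Q, ENNReal.ofReal ((w x)⁻¹)) / volume Q)) Q.1.toSet ⟨Q.1, Q.2, rfl⟩

/-- The average of `w` is strictly positive, so an infinite average of `w⁻¹` would make the
characteristic infinite. -/
theorem integrableOn_inv (h : MemA2 D w) (Q : D.cubes) : IntegrableOn (w⁻¹) Q.1.toSet := by
  refine ⟨(aemeasurable_inv h.1.aemeasurable).aestronglyMeasurable.restrict, ?_⟩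
  rw [hasFiniteIntegral_iff_ofReal (ae_restrict_of_ae ((inv_pos_ae h.1.2).mono fun _ h => h.le))]
  have h1 := (a2_term_le D w Q).trans_lt h.2
  have hv : volume Q.1.toSet ≠ ⊤ := by rw [Q.1.volume_toSet]; exact ENNReal.ofReal_ne_top
  have h2 : (∫⁻ x in Q.1.toSet, ENNReal.ofReal (w x)) / volume Q.1.toSet ≠ 0 := by
    rw [lintegral_eq_mass (integrableOn_weight h Q) (h.1.2.mono fun _ h => h.le)]
    refine (ENNReal.div_pos ?_ hv).ne'
    simpa using mass_pos (integrableOn_weight h Q) h.1.2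
  by_contra hc
  rw [not_lt, top_le_iff] at hc
  simp only [Pi.inv_apply] at hc
  rw [hc, ENNReal.top_div_of_ne_top hv, ENNReal.mul_top h2] at h1
  exact lt_irrefl _ h1

theorem a2_term_eq (h1 : ∀ Q : D.cubes, IntegrableOn w Q.1.toSet)
    (h2 : ∀ Q : D.cubes, IntegrableOn (w⁻¹) Q.1.toSet) (h0 : ∀ᵐ x, 0 < w x) (Q : D.cubes) :
    ((∫⁻ x in Q.1.toSet, ENNReal.ofReal (w x)) / volume Q.1.toSet) *
      ((∫⁻ x in Q.1.toSet, ENNReal.ofReal ((w x)⁻¹)) / volume Q.1.toSet) =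
    ENNReal.ofReal (mass w Q * mass w⁻¹ Q / vol Q ^ 2) := by
  have e := lintegral_eq_mass (h2 Q) ((inv_pos_ae h0).mono fun _ h => h.le)
  simp only [Pi.inv_apply] at e
  rw [e, lintegral_eq_mass (h1 Q) (h0.mono fun _ h => h.le), Q.1.volume_toSet,
    ← ENNReal.ofReal_div_of_pos Q.1.vol_pos, ← ENNReal.ofReal_div_of_pos Q.1.vol_pos,
    ← ENNReal.ofReal_mul (div_nonneg (mass_nonneg (h0.mono fun _ h => h.le) _) Q.1.vol_pos.le)]
  congr 1
  rw [div_mul_div_comm, sq]; rfl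

theorem mass_mul_mass_le (h : MemA2 D w) (Q : D.cubes) :
    mass w Q * mass w⁻¹ Q ≤ (a2Char D w).toReal * vol Q ^ 2 := by
  have h1 := a2_term_le D w Q
  rw [a2_term_eq (integrableOn_weight h) (integrableOn_inv h) h.1.2,
    ENNReal.ofReal_le_iff_le_toReal h.2.ne, div_le_iff₀ (pow_pos (vol_pos Q) 2)] at h1
  exact h1

theorem memLp_indicator_cube {v : (Fin n → ℝ) → ℝ} (hm : AEMeasurable v) (hv : ∀ᵐ x, 0 < v x)
    {Q : D.cubes} (hQ : IntegrableOn v Q.1.toSet) {f : (Fin n → ℝ) → ℝ} (hf : Measurable f) {C : ℝ}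
    (hC : ∀ x, |f x| ≤ C) (hs : ∀ x ∉ Q.1.toSet, f x = 0) : MemLp f 2 (weightMeasure v) := by
  refine memLp_of_integrable_sq_mul hm hv hf.aestronglyMeasurable ?_
  have e : (fun x => f x ^ 2 * v x) = Q.1.toSet.indicator fun x => f x ^ 2 * v x := by
    ext x
    by_cases hx : x ∈ Q.1.toSet
    · rw [Set.indicator_of_mem hx]
    · rw [Set.indicator_of_notMem hx, hs x hx]; ring
  rw [e, integrable_indicator_iff Q.1.measurableSet]
  refine Integrable.bdd_mul (c := C ^ 2) hQ (hf.pow_const 2).aestronglyMeasurable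
    (ae_of_all _ fun x => ?_)
  rw [Real.norm_eq_abs, abs_pow]
  exact pow_le_pow_left₀ (abs_nonneg _) (hC x) 2

theorem memLp_one_cube {v : (Fin n → ℝ) → ℝ} (hm : AEMeasurable v) (hv : ∀ᵐ x, 0 < v x)
    {Q : D.cubes} (hQ : IntegrableOn v Q.1.toSet) :
    MemLp (Q.1.toSet.indicator fun _ => (1 : ℝ)) 2 (weightMeasure v) := by
  refine memLp_indicator_cube hm hv hQ (measurable_const.indicator Q.1.measurableSet) (C := 1)
    (fun x => ?_) fun x hx => Set.indicator_of_notMem hx _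
  by_cases hx : x ∈ Q.1.toSet <;> simp [hx]

theorem memLp_haar {v : (Fin n → ℝ) → ℝ} (hm : AEMeasurable v) (hv : ∀ᵐ x, 0 < v x)
    {Q : D.cubes} (hQ : IntegrableOn v Q.1.toSet) (e : Signature n) :
    MemLp (haar Q.1 e) 2 (weightMeasure v) :=
  memLp_indicator_cube hm hv hQ (measurable_haar Q.1 e) (abs_haar_le Q.1 e)
    fun _ hx => haar_of_notMem Q.1 e hx

theorem sqNorm_one_cube (v : (Fin n → ℝ) → ℝ) (Q : D.cubes) :
    sqNorm v (Q.1.toSet.indicator fun _ => (1 : ℝ)) = mass v Q := by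
  rw [sqNorm, mass, ← integral_indicator Q.1.measurableSet]
  congr 1; ext x
  by_cases hx : x ∈ Q.1.toSet <;> simp [hx]

theorem memLp_indicator {v f : (Fin n → ℝ) → ℝ} (Q : D.cubes)
    (hf : MemLp f 2 (weightMeasure v)) : MemLp (Q.1.toSet.indicator f) 2 (weightMeasure v) :=
  hf.indicator Q.1.measurableSet

theorem sqNorm_indicator (v f : (Fin n → ℝ) → ℝ) (Q : D.cubes) :
    sqNorm v (Q.1.toSet.indicator f) = mass (fun x => f x ^ 2 * v x) Q := by
  rw [sqNorm, mass, ← integral_indicator Q.1.measurableSet]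
  congr 1; ext x
  by_cases hx : x ∈ Q.1.toSet <;> simp [hx]

/-- A function of `L²(w)` is integrable on the cubes on which `w⁻¹` is. -/
theorem integrableOn_of_memLp {f : (Fin n → ℝ) → ℝ} (hm : AEMeasurable w) (hw : ∀ᵐ x, 0 < w x)
    (hf : MemLp f 2 (weightMeasure w)) {Q : D.cubes} (hQ : IntegrableOn (w⁻¹) Q.1.toSet) :
    IntegrableOn f Q.1.toSet := by
  have h := integrable_mul_of_memLp hm hw
    (memLp_one_cube (aemeasurable_inv hm) (inv_pos_ae hw) hQ) hf
  rw [← integrable_indicator_iff Q.1.measurableSet]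
  refine h.congr (ae_of_all _ fun x => ?_)
  by_cases hx : x ∈ Q.1.toSet <;> simp [hx]

theorem sq_mass_le {f : (Fin n → ℝ) → ℝ} (hm : AEMeasurable w) (hw : ∀ᵐ x, 0 < w x)
    (hf : MemLp f 2 (weightMeasure w)) {Q : D.cubes} (hQ : IntegrableOn (w⁻¹) Q.1.toSet) :
    mass f Q ^ 2 ≤ mass (fun x => f x ^ 2 * w x) Q * mass w⁻¹ Q := by
  have h := sq_integral_le_sqNorm hm hw
    (memLp_one_cube (aemeasurable_inv hm) (inv_pos_ae hw) hQ) (memLp_indicator Q hf)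
  rw [sqNorm_one_cube, sqNorm_indicator] at h
  have e : mass f Q = ∫ x, Q.1.toSet.indicator (fun _ => (1 : ℝ)) x * Q.1.toSet.indicator f x := by
    rw [mass, ← integral_indicator Q.1.measurableSet]
    congr 1; ext x
    by_cases hx : x ∈ Q.1.toSet <;> simp [hx]
  rw [e]; linarith

theorem sq_vol_le (hm : AEMeasurable w) (hw : ∀ᵐ x, 0 < w x) {Q : D.cubes}
    (h1 : IntegrableOn w Q.1.toSet) (h2 : IntegrableOn (w⁻¹) Q.1.toSet) :
    vol Q ^ 2 ≤ mass w Q * mass w⁻¹ Q := by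
  have h := sq_mass_le hm hw (memLp_one_cube hm hw h1) h2
  have e1 : mass (Q.1.toSet.indicator fun _ => (1 : ℝ)) Q = vol Q := by
    rw [mass, setIntegral_indicator Q.1.measurableSet, Set.inter_self, setIntegral_const,
      Q.1.volume_real, smul_eq_mul, mul_one]; rfl
  have e2 : mass (fun x => (Q.1.toSet.indicator (fun _ => (1 : ℝ)) x) ^ 2 * w x) Q = mass w Q :=
    setIntegral_congr_fun Q.1.measurableSet fun x hx => by simp [hx]
  rwa [e1, e2] at h

theorem one_le_a2Char (h : MemA2 D w) : 1 ≤ (a2Char D w).toReal := by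
  obtain ⟨Q⟩ : Nonempty D.cubes := inferInstance
  have h1 := (sq_vol_le h.1.aemeasurable h.1.2 (integrableOn_weight h Q)
    (integrableOn_inv h Q)).trans (mass_mul_mass_le h Q)
  have := pow_pos (vol_pos Q) 2
  by_contra! hc
  nlinarith

end A2

end DyadicGrid

end

section

variable {n : ℕ}

/-! ### The quadratic upper bound -/

/-- A series in a Hilbert space whose signed partial sums are bounded is summable. -/
theorem summable_of_signed_bound {ι E : Type*} [NormedAddCommGroup E] [InnerProductSpace ℝ E]
    [CompleteSpace E] {x : ι → E} {C : ℝ}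
    (h : ∀ (F : Finset ι) (s : ι → ℝ), (∀ i, |s i| = 1) → ‖∑ i ∈ F, s i • x i‖ ≤ C) :
    Summable x := by
  classical
  rw [summable_iff_vanishing_norm]
  intro ε hε
  -- Take a signed sum over `F₀` whose squared norm is within `ε²` of the supremum. Adding a
  -- disjoint block with the sign making the inner product nonnegative raises the squared norm by at
  -- least that of the block, which is therefore below `ε²`.
  set S : Set ℝ := {r | ∃ (F : Finset ι) (s : ι → ℝ), (∀ i, |s i| = 1) ∧
    r = ‖∑ i ∈ F, s i • x i‖ ^ 2} with hS
  have hbdd : BddAbove S := ⟨C ^ 2, by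
    rintro r ⟨F, s, hs, rfl⟩
    exact pow_le_pow_left₀ (norm_nonneg _) (h F s hs) 2⟩
  have hne : S.Nonempty := ⟨_, ∅, fun _ => 1, by simp, rfl⟩
  obtain ⟨r, ⟨F₀, s₀, hs₀, rfl⟩, hr⟩ := exists_lt_of_lt_csSup hne
    (show sSup S - ε ^ 2 < sSup S by linarith [pow_pos hε 2])
  refine ⟨F₀, fun t ht => ?_⟩
  set y₀ := ∑ i ∈ F₀, s₀ i • x i with hy₀
  set y := ∑ i ∈ t, x i with hy
  obtain ⟨τ, hτ, hτi⟩ : ∃ τ : ℝ, |τ| = 1 ∧ 0 ≤ τ * inner ℝ y₀ y := by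
    rcases le_total 0 (inner ℝ y₀ y) with h0 | h0
    · exact ⟨1, by simp, by simpa using h0⟩
    · exact ⟨-1, by simp, by simpa using h0⟩
  have hmem : ‖y₀ + τ • y‖ ^ 2 ∈ S := by
    refine ⟨F₀ ∪ t, fun i => if i ∈ F₀ then s₀ i else τ, fun i => ?_, ?_⟩
    · beta_reduce
      split_ifs
      exacts [hs₀ i, hτ]
    · rw [Finset.sum_union ht.symm, hy₀, hy, Finset.smul_sum]
      congr 3
      · exact Finset.sum_congr rfl fun i hi => by beta_reduce; rw [if_pos hi]
      · exact Finset.sum_congr rfl fun i hi => by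
          beta_reduce; rw [if_neg (Finset.disjoint_left.1 ht hi)]
  have h1 := le_csSup hbdd hmem
  rw [norm_add_sq_real, inner_smul_right, norm_smul, Real.norm_eq_abs, hτ, one_mul] at h1
  exact lt_of_pow_lt_pow_left₀ 2 hε.le (by linarith)

namespace DyadicGrid

variable [NeZero n] {D : DyadicGrid n}

theorem sum_mass_le {f : (Fin n → ℝ) → ℝ} (hf : Integrable f) (h0 : ∀ᵐ x, 0 ≤ f x) {k : ℤ}
    {T : Finset D.cubes} (hT : ∀ R ∈ T, R.1.gen = k) : ∑ R ∈ T, mass f R ≤ ∫ x, f x := by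
  simp only [mass]
  rw [← integral_biUnion_finset T (fun R _ => R.1.measurableSet)
    (fun R hR R' hR' hne => disjoint_of_gen_eq ((hT R hR).trans (hT R' hR').symm) hne)
    fun R _ => hf.integrableOn]
  exact setIntegral_le_integral hf h0

theorem abs_mass_le (f : (Fin n → ℝ) → ℝ) (Q : D.cubes) : |mass f Q| ≤ mass (fun x => |f x|) Q :=
  abs_integral_le_integral_abs

theorem sum_subset_trees {t : D.cubes → ℝ} (h0 : ∀ Q, 0 ≤ t Q) {F : Finset D.cubes} {N : ℕ}
    {k : ℤ} {T : Finset D.cubes} (hT : ∀ R ∈ T, R.1.gen = k) (hF : ∀ P ∈ F, ∃ R ∈ T, P ∈ tree N R) :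
    ∑ P ∈ F, t P ≤ ∑ R ∈ T, ∑ P ∈ tree N R, t P := by
  classical
  rw [← Finset.sum_biUnion (pairwiseDisjoint_tree hT N)]
  exact Finset.sum_le_sum_of_subset_of_nonneg (fun P hP => Finset.mem_biUnion.2 (hF P hP))
    fun P _ _ => h0 P

variable {w : (Fin n → ℝ) → ℝ}

/-- The bilinear estimate behind the quadratic upper bound. -/
theorem sum_abs_le {b f g : (Fin n → ℝ) → ℝ} (h : MemA2 D w) (hb : LocallyIntegrable b volume)
    {B : ℝ} (hB : 0 < B)
    (hbB : ∀ R : D.cubes, mass (fun x => |b x - avg b R.1.toSet|) R ≤ B * mass w R)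
    (hf : MemLp f 2 (weightMeasure w)) (hg : MemLp g 2 (weightMeasure w))
    (F : Finset (HaarIndex D)) :
    ∑ i ∈ F, |haarCoeff b i.1 i.2| * |avg f (i.1 : DyadicCube n).toSet| * |haarCoeff g i.1 i.2| ≤
      4 * (432 * (2 ^ n) ^ 2 * B * (a2Char D w).toReal ^ 2) * (sqNorm w f + sqNorm w g) := by
  classical
  have hm := h.1.aemeasurable
  have hw := h.1.2
  have hσi := integrableOn_inv h
  have hσ := inv_pos_ae hw
  set A := (a2Char D w).toReal
  set K := 432 * (2 ^ n) ^ 2 * B * A ^ 2 with hK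
  have hK0 : 0 ≤ K := by positivity
  have hbi : ∀ Q : D.cubes, IntegrableOn b Q.1.toSet :=
    fun Q => integrableOn_of_locallyIntegrable hb Q.1
  have hdev : ∀ R Q : D.cubes, IntegrableOn (fun x => b x - avg b R.1.toSet) Q.1.toSet :=
    fun R Q => (hbi Q).sub (integrableOn_const_cube _ _)
  have hfi : ∀ Q : D.cubes, IntegrableOn f Q.1.toSet :=
    fun Q => integrableOn_of_memLp hm hw hf (hσi Q)
  have hgi : ∀ Q : D.cubes, IntegrableOn g Q.1.toSet :=
    fun Q => integrableOn_of_memLp hm hw hg (hσi Q)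
  have hf2 := integrable_sq_mul hm hw hf
  have hg2 := integrable_sq_mul hm hw hg
  have hsq : ∀ {u : (Fin n → ℝ) → ℝ}, MemLp u 2 (weightMeasure w) → ∀ Q : D.cubes,
      mass (fun x => |u x|) Q ^ 2 ≤ mass (fun x => u x ^ 2 * w x) Q * mass w⁻¹ Q :=
    fun hu Q => by
      have := sq_mass_le hm hw hu.abs (hσi Q)
      simp only [Pi.abs_apply, sq_abs] at this
      exact this
  have hpos : ∀ u : (Fin n → ℝ) → ℝ, ∀ Q : D.cubes, 0 ≤ mass (fun x => |u x|) Q :=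
    fun u Q => mass_nonneg (ae_of_all _ fun x => abs_nonneg _) Q
  have hbell : ∀ {u : (Fin n → ℝ) → ℝ} (R : D.cubes),
      bellman (mass fun x => |u x|) (mass fun x => u x ^ 2 * w x) (mass w⁻¹) R ≤
        4 * mass (fun x => u x ^ 2 * w x) R := fun {u} R => by
    have : 0 ≤ 2 * mass (fun x => |u x|) R ^ 2 / mass w⁻¹ R :=
      div_nonneg (by positivity) (mass_pos (hσi R) hσ).le
    rw [bellman]; linarith
  set t := treeTerm (D := D) (mass fun x => |f x|) (mass g) (mass b) with ht
  have ht0 : ∀ Q, 0 ≤ t Q := fun Q =>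
    mul_nonneg (div_nonneg (hpos f Q) (vol_pos Q).le) (by positivity)
  have hterm : ∀ Q : D.cubes, ∑ e : Signature n,
      |haarCoeff b Q.1 e| * |avg f Q.1.toSet| * |haarCoeff g Q.1 e| ≤ t Q := fun Q => by
    have e : ∀ e : Signature n, |haarCoeff b Q.1 e| * |avg f Q.1.toSet| * |haarCoeff g Q.1 e| =
        |avg f Q.1.toSet| * (|haarCoeff b Q.1 e| * |haarCoeff g Q.1 e|) := fun e => by ring
    simp only [e, ← Finset.mul_sum]
    refine mul_le_mul ?_ (sum_abs_haarCoeff_mul_le hbi hgi Q)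
      (Finset.sum_nonneg fun _ _ => by positivity) (div_nonneg (hpos f Q) (vol_pos Q).le)
    rw [avg_eq_mass, abs_div, abs_of_pos (vol_pos Q)]
    exact div_le_div_of_nonneg_right (abs_mass_le f Q) (vol_pos Q).le
  -- The roots have equal generation, hence are disjoint, so that their masses add up to at most the
  -- whole integral.
  obtain ⟨k, N, T, hT, hcov⟩ := exists_cover (F.image Prod.fst)
  calc ∑ i ∈ F, |haarCoeff b i.1 i.2| * |avg f (i.1 : DyadicCube n).toSet| *
        |haarCoeff g i.1 i.2|
      ≤ ∑ i ∈ (F.image Prod.fst) ×ˢ (Finset.univ : Finset (Signature n)),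
          |haarCoeff b i.1 i.2| * |avg f (i.1 : DyadicCube n).toSet| * |haarCoeff g i.1 i.2| := by
        refine Finset.sum_le_sum_of_subset_of_nonneg (fun i hi => ?_) fun _ _ _ => by positivity
        exact Finset.mem_product.2 ⟨Finset.mem_image_of_mem _ hi, Finset.mem_univ _⟩
    _ = ∑ Q ∈ F.image Prod.fst, ∑ e : Signature n,
          |haarCoeff b Q.1 e| * |avg f Q.1.toSet| * |haarCoeff g Q.1 e| := Finset.sum_product ..
    _ ≤ ∑ Q ∈ F.image Prod.fst, t Q := Finset.sum_le_sum fun Q _ => hterm Q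
    _ ≤ ∑ R ∈ T, ∑ P ∈ tree N R, t P := sum_subset_trees ht0 hT hcov
    _ ≤ ∑ R ∈ T, K * (4 * mass (fun x => f x ^ 2 * w x) R +
          4 * mass (fun x => g x ^ 2 * w x) R) := by
        refine Finset.sum_le_sum fun R _ => (sum_treeTerm_le
          (β := fun R => mass fun x => |b x - avg b R.1.toSet|)
          (isAdditive_mass fun Q => (hfi Q).abs) (hpos f)
          (isAdditive_mass fun Q => hf2.integrableOn) (hsq hf)
          (isAdditive_mass fun Q => (hgi Q).abs) (hpos g)
          (isAdditive_mass fun Q => hg2.integrableOn) (hsq hg)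
          (isAdditive_mass hgi) (abs_mass_le g)
          (isAdditive_mass (integrableOn_weight h)) (fun Q => mass_pos (integrableOn_weight h Q) hw)
          (isAdditive_mass hσi) (fun Q => mass_pos (hσi Q) hσ)
          (fun Q => sq_vol_le hm hw (integrableOn_weight h Q) (hσi Q)) (mass_mul_mass_le h)
          (isAdditive_mass hbi) (fun R => isAdditive_mass fun Q => (hdev R Q).abs)
          (fun R => hpos _) (fun R Q => ?_) hB hbB N R).trans ?_
        · refine le_trans (le_of_eq ?_) (abs_mass_le _ Q)
          congr 1
          simp only [mass]
          rw [integral_sub (hbi Q) (integrableOn_const_cube _ _), setIntegral_const,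
            Q.1.volume_real, smul_eq_mul, mul_comm, avg_eq_mass]; rfl
        · exact mul_le_mul_of_nonneg_left (add_le_add (hbell R) (hbell R)) hK0
    _ = 4 * K * (∑ R ∈ T, mass (fun x => f x ^ 2 * w x) R +
          ∑ R ∈ T, mass (fun x => g x ^ 2 * w x) R) := by
        rw [← Finset.sum_add_distrib, Finset.mul_sum]
        exact Finset.sum_congr rfl fun R _ => by ring
    _ ≤ 4 * K * (sqNorm w f + sqNorm w g) := by
        refine mul_le_mul_of_nonneg_left (add_le_add ?_ ?_) (by positivity)
        · exact sum_mass_le hf2 (hw.mono fun x hx => mul_nonneg (sq_nonneg _) hx.le) hT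
        · exact sum_mass_le hg2 (hw.mono fun x hx => mul_nonneg (sq_nonneg _) hx.le) hT

theorem memLp_paraTerm {v : (Fin n → ℝ) → ℝ} (hm : AEMeasurable v) (hv : ∀ᵐ x, 0 < v x)
    (hvi : ∀ Q : D.cubes, IntegrableOn v Q.1.toSet) (b f : (Fin n → ℝ) → ℝ) (i : HaarIndex D) :
    MemLp (paraTerm D b f i) 2 (weightMeasure v) :=
  (memLp_haar hm hv (hvi i.1) i.2).const_mul _

theorem integral_paraTerm_mul (b f u : (Fin n → ℝ) → ℝ) (i : HaarIndex D) :
    ∫ x, paraTerm D b f i x * u x =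
      haarCoeff b i.1 i.2 * avg f (i.1 : DyadicCube n).toSet * haarCoeff u i.1 i.2 := by
  simp only [paraTerm, haarCoeff]
  rw [← integral_const_mul]
  congr 1; ext x; ring

/-- Duality: a signed partial sum `P` is paired with multiples of `P w⁻¹`, the extremal test
function in `L²(w)`. The signs disappear because the bilinear estimate has absolute values inside
the sum. -/
theorem sqrt_sqNorm_signed_le {b f : (Fin n → ℝ) → ℝ} (h : MemA2 D w)
    (hb : LocallyIntegrable b volume) {B : ℝ} (hB : 0 < B)
    (hbB : ∀ R : D.cubes, mass (fun x => |b x - avg b R.1.toSet|) R ≤ B * mass w R)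
    (hf : MemLp f 2 (weightMeasure w)) (F : Finset (HaarIndex D)) (s : HaarIndex D → ℝ)
    (hs : ∀ i, |s i| = 1) :
    √(sqNorm w⁻¹ fun x => ∑ i ∈ F, s i * paraTerm D b f i x) ≤
      8 * (432 * (2 ^ n) ^ 2 * B * (a2Char D w).toReal ^ 2) * √(sqNorm w f) := by
  have hm := h.1.aemeasurable
  have hw := h.1.2
  have hm' := aemeasurable_inv hm
  have hw' := inv_pos_ae hw
  set K := 432 * (2 ^ n) ^ 2 * B * (a2Char D w).toReal ^ 2 with hK
  have hK0 : 0 ≤ K := by positivity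
  set P : (Fin n → ℝ) → ℝ := fun x => ∑ i ∈ F, s i * paraTerm D b f i x with hP
  have hPmem : MemLp P 2 (weightMeasure w⁻¹) :=
    memLp_finsetSum F fun i _ =>
      (memLp_paraTerm hm' hw' (integrableOn_inv h) b f i).const_mul (s i)
  have hP2 := integrable_sq_mul hm' hw' hPmem
  have hae : ∀ c : ℝ, (fun x => (c * (P x * w⁻¹ x)) ^ 2 * w x) =ᵐ[volume]
      fun x => c ^ 2 * (P x ^ 2 * w⁻¹ x) := fun c => hw.mono fun x hx => by
    simp only [Pi.inv_apply]; field_simp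
  have hu : ∀ c : ℝ, MemLp (fun x => c * (P x * w⁻¹ x)) 2 (weightMeasure w) := fun c => by
    refine memLp_of_integrable_sq_mul hm hw ?_ ((hP2.const_mul (c ^ 2)).congr (hae c).symm)
    exact (((memLp_weightMeasure_iff hm' hw').1 hPmem).1.mul hm'.aestronglyMeasurable).const_mul c
  have hun : ∀ c : ℝ, sqNorm w (fun x => c * (P x * w⁻¹ x)) = c ^ 2 * sqNorm w⁻¹ P := fun c => by
    rw [sqNorm, integral_congr_ae (hae c), integral_const_mul, sqNorm]
  have hX := sqNorm_nonneg hw f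
  have hY := sqNorm_nonneg hw' P
  set X := sqNorm w f
  set Y := sqNorm w⁻¹ P
  have key : ∀ c : ℝ, c * Y ≤ 4 * K * (X + c ^ 2 * Y) := fun c => by
    set u := fun x => c * (P x * w⁻¹ x) with hu'
    have e1 : c * Y = ∫ x, P x * u x := by
      simp only [Y, sqNorm]
      rw [← integral_const_mul]
      congr 1; ext x; simp only [hu']; ring
    have e2 : ∫ x, P x * u x = ∑ i ∈ F, s i *
        (haarCoeff b i.1 i.2 * avg f (i.1 : DyadicCube n).toSet * haarCoeff u i.1 i.2) := by
      simp only [← integral_paraTerm_mul, ← integral_const_mul]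
      rw [← integral_finsetSum]
      · congr 1; ext x; simp only [hP, Finset.sum_mul]
        exact Finset.sum_congr rfl fun i _ => by ring
      · intro i _
        exact (integrable_mul_of_memLp hm hw
          (memLp_paraTerm hm' hw' (integrableOn_inv h) b f i) (hu c)).const_mul _
    rw [e1, e2]
    refine le_trans (Finset.sum_le_sum fun i _ => ?_)
      ((sum_abs_le h hb hB hbB hf (hu c) F).trans_eq (by rw [hun c]))
    refine (le_abs_self _).trans_eq ?_
    rw [abs_mul, hs i, one_mul, abs_mul, abs_mul]
  -- The bilinear bound is a sum of two squares rather than a product of norms; optimising over the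
  -- scale `c` restores homogeneity.
  have hd := discrim_le_zero (a := 4 * K * Y) (b := -Y) (c := 4 * K * X) fun c => by
    have := key c; linarith
  rw [discrim] at hd
  have hYX : Y ≤ (8 * K) ^ 2 * X := by
    rcases hY.eq_or_lt with h0 | h0
    · rw [← h0]; positivity
    · refine le_of_mul_le_mul_left ?_ h0
      nlinarith
  calc √Y ≤ √((8 * K) ^ 2 * X) := Real.sqrt_le_sqrt hYX
    _ = 8 * K * √X := by rw [Real.sqrt_mul (sq_nonneg _), Real.sqrt_sq (by positivity)]

theorem exists_isParaproduct {b f : (Fin n → ℝ) → ℝ} (h : MemA2 D w)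
    (hb : LocallyIntegrable b volume) {B : ℝ} (hB : 0 < B)
    (hbB : ∀ R : D.cubes, mass (fun x => |b x - avg b R.1.toSet|) R ≤ B * mass w R)
    (hf : MemLp f 2 (weightMeasure w)) :
    ∃ g, IsParaproduct D w⁻¹ b f g ∧ eLpNorm g 2 (weightMeasure w⁻¹) ≤
      ENNReal.ofReal (8 * (432 * (2 ^ n) ^ 2 * B * (a2Char D w).toReal ^ 2)) *
        eLpNorm f 2 (weightMeasure w) := by
  classical
  have hm := h.1.aemeasurable
  have hw := h.1.2
  have hm' := aemeasurable_inv hm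
  have hw' := inv_pos_ae hw
  set K := 8 * (432 * (2 ^ n) ^ 2 * B * (a2Char D w).toReal ^ 2) with hK
  have hK0 : 0 ≤ K := by positivity
  set y : HaarIndex D → Lp ℝ 2 (weightMeasure w⁻¹) := fun i =>
    (memLp_paraTerm hm' hw' (integrableOn_inv h) b f i).toLp _ with hy
  have hcoe : ∀ (s : HaarIndex D → ℝ) (F : Finset (HaarIndex D)),
      ((∑ i ∈ F, s i • y i : Lp ℝ 2 (weightMeasure w⁻¹)) : (Fin n → ℝ) → ℝ)
        =ᵐ[weightMeasure w⁻¹] fun x => ∑ i ∈ F, s i * paraTerm D b f i x := fun s F => by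
    induction F using Finset.induction_on with
    | empty => exact Lp.coeFn_zero ℝ 2 (weightMeasure w⁻¹)
    | insert i F hi ih =>
      rw [Finset.sum_insert hi]
      filter_upwards [Lp.coeFn_add (s i • y i) (∑ i ∈ F, s i • y i), ih,
        Lp.coeFn_smul (s i) (y i),
        (memLp_paraTerm hm' hw' (integrableOn_inv h) b f i).coeFn_toLp] with x h1 h2 h3 h4
      rw [h1, Pi.add_apply, h2, h3, Pi.smul_apply, h4, Finset.sum_insert hi, smul_eq_mul]
  have hbound : ∀ (F : Finset (HaarIndex D)) (s : HaarIndex D → ℝ), (∀ i, |s i| = 1) →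
      ‖∑ i ∈ F, s i • y i‖ ≤ K * √(sqNorm w f) := fun F s hs => by
    have hPmem : MemLp (fun x => ∑ i ∈ F, s i * paraTerm D b f i x) 2 (weightMeasure w⁻¹) :=
      memLp_finsetSum F fun i _ =>
        (memLp_paraTerm hm' hw' (integrableOn_inv h) b f i).const_mul (s i)
    rw [Lp.norm_def, eLpNorm_congr_ae (hcoe s F), eLpNorm_eq_ofReal hm' hw' hPmem,
      ENNReal.toReal_ofReal (Real.sqrt_nonneg _)]
    exact sqrt_sqNorm_signed_le h hb hB hbB hf F s hs
  have hsum : Summable y := summable_of_signed_bound hbound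
  have hlim : Tendsto (fun F : Finset (HaarIndex D) => ∑ i ∈ F, y i) atTop (𝓝 (∑' i, y i)) :=
    hsum.hasSum
  refine ⟨((∑' i, y i : Lp ℝ 2 (weightMeasure w⁻¹)) : (Fin n → ℝ) → ℝ), ⟨Lp.memLp _, ?_⟩, ?_⟩
  · have h1 := (tendsto_iff_edist_tendsto_0 (f := fun F : Finset (HaarIndex D) => ∑ i ∈ F, y i)).1
      hlim
    refine h1.congr fun F => ?_
    rw [Lp.edist_def]
    refine eLpNorm_congr_ae ?_
    filter_upwards [hcoe (fun _ => 1) F] with x hx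
    simp only [one_smul, one_mul] at hx
    rw [Pi.sub_apply, hx]
  · have h2 : ‖∑' i, y i‖ ≤ K * √(sqNorm w f) :=
      le_of_tendsto hlim.norm (Eventually.of_forall fun F => by
        simpa using hbound F (fun _ => 1) (by simp))
    rw [eLpNorm_eq_ofReal hm hw hf, ← ENNReal.ofReal_mul hK0,
      ← ENNReal.ofReal_toReal (Lp.memLp (∑' i, y i)).2.ne, ← Lp.norm_def]
    exact ENNReal.ofReal_le_ofReal h2

theorem mass_dev_le {b : (Fin n → ℝ) → ℝ} (h : MemA2 D w) (hb : MemBMO D w b) (R : D.cubes) :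
    mass (fun x => |b x - avg b R.1.toSet|) R ≤ (bmoNorm D.sets w b).toReal * mass w R := by
  have hw := mass_pos (integrableOn_weight h R) h.1.2
  have h1 : (∫⁻ x in R.1.toSet, ENNReal.ofReal |b x - avg b R.1.toSet|) /
      weightMeasure w R.1.toSet ≤ bmoNorm D.sets w b :=
    le_iSup₂ (f := fun (Q : Set (Fin n → ℝ)) (_ : Q ∈ D.sets) =>
      (∫⁻ x in Q, ENNReal.ofReal |b x - avg b Q|) / weightMeasure w Q) R.1.toSet ⟨R.1, R.2, rfl⟩
  have hi : IntegrableOn (fun x => |b x - avg b R.1.toSet|) R.1.toSet :=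
    ((integrableOn_of_locallyIntegrable hb.1 R.1).sub (integrableOn_const_cube _ _)).abs
  rw [lintegral_eq_mass hi (ae_of_all _ fun x => abs_nonneg _),
    weightMeasure_cube (integrableOn_weight h R) h.1.2, ← ENNReal.ofReal_div_of_pos hw,
    ENNReal.ofReal_le_iff_le_toReal hb.2.ne, div_le_iff₀ hw] at h1
  exact h1

theorem paraNorm_le {b : (Fin n → ℝ) → ℝ} (h : MemA2 D w) (hb : MemBMO D w b) :
    paraNorm D b w w⁻¹ ≤ ENNReal.ofReal (3456 * (2 ^ n) ^ 2) * bmoNorm D.sets w b *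
      a2Char D w ^ 2 := by
  set β := (bmoNorm D.sets w b).toReal
  set A := (a2Char D w).toReal
  have hA := one_le_a2Char h
  have hβ : 0 ≤ β := ENNReal.toReal_nonneg
  rw [← ENNReal.ofReal_toReal hb.2.ne, ← ENNReal.ofReal_toReal h.2.ne,
    ← ENNReal.ofReal_pow (by positivity), ← ENNReal.ofReal_mul (by positivity),
    ← ENNReal.ofReal_mul (by positivity)]
  -- The estimate needs `B > 0` while the `BMO` norm may vanish, so `B` decreases to the norm.
  have hlim : Tendsto (fun B : ℝ => ENNReal.ofReal (8 * (432 * (2 ^ n) ^ 2 * B * A ^ 2)))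
      (𝓝[>] β) (𝓝 (ENNReal.ofReal (3456 * (2 ^ n) ^ 2 * β * A ^ 2))) := by
    have : Continuous fun B : ℝ => ENNReal.ofReal (8 * (432 * (2 ^ n) ^ 2 * B * A ^ 2)) :=
      ENNReal.continuous_ofReal.comp (by fun_prop)
    have h2 := (this.tendsto β).mono_left (nhdsWithin_le_nhds (s := Set.Ioi β))
    convert h2 using 3
    ring
  refine ge_of_tendsto hlim (eventually_mem_nhdsWithin.mono fun B hB => ?_)
  refine sInf_le fun f hf => ?_
  refine exists_isParaproduct h hb.1 (hβ.trans_lt hB) (fun R => ?_) hf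
  refine (mass_dev_le h hb R).trans (mul_le_mul_of_nonneg_right (le_of_lt hB) ?_)
  exact mass_nonneg (h.1.2.mono fun x hx => hx.le) R

end DyadicGrid

end

section

variable {n : ℕ}

/-! ### Elementary properties of the weighted `BMO` norm -/

/-- `|w - ⟨w⟩| ≤ w + ⟨w⟩`, and both terms have integral `w(Q)` over `Q`. -/
theorem bmoNorm_self_le {w : (Fin n → ℝ) → ℝ} (hw : IsWeight w) :
    bmoNorm (allCubes n) w w ≤ 2 := by
  refine iSup₂_le fun Q hQ => ?_
  obtain ⟨a, l, hl, rfl⟩ := hQ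
  have hms := measurableSet_cube a l
  have hvol : volume.real (cube a l) = l ^ n := by
    rw [Measure.real, volume_cube, ENNReal.toReal_pow, ENNReal.toReal_ofReal hl.le]
  have hfin : volume (cube a l) ≠ ⊤ := by
    rw [volume_cube]; exact ENNReal.pow_ne_top ENNReal.ofReal_ne_top
  have hsub : cube a l ⊆ Metric.closedBall a l := by
    intro x hx
    rw [Metric.mem_closedBall, dist_pi_le_iff hl.le]
    intro i
    have := hx i
    rw [Real.dist_eq, abs_le]; constructor <;> linarith
  have hi : IntegrableOn w (cube a l) :=
    (hw.1.integrableOn_isCompact (isCompact_closedBall a l)).mono_set hsub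
  have h0 : 0 ≤ ∫ x in cube a l, w x :=
    integral_nonneg_of_ae (ae_restrict_of_ae (hw.2.mono fun _ h => h.le))
  have havg : 0 ≤ avg w (cube a l) := by
    rw [avg, setAverage_eq, smul_eq_mul]; positivity
  refine ENNReal.div_le_of_le_mul ?_
  rw [weightMeasure_apply _ hms]
  calc ∫⁻ x in cube a l, ENNReal.ofReal |w x - avg w (cube a l)|
      ≤ ∫⁻ x in cube a l, (ENNReal.ofReal (w x) + ENNReal.ofReal (avg w (cube a l))) := by
        refine lintegral_mono_ae (ae_restrict_of_ae (hw.2.mono fun x hx => ?_))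
        rw [← ENNReal.ofReal_add hx.le havg]
        refine ENNReal.ofReal_le_ofReal (abs_le.2 ⟨by linarith, by linarith⟩)
    _ = (∫⁻ x in cube a l, ENNReal.ofReal (w x)) + ENNReal.ofReal (avg w (cube a l)) *
          volume (cube a l) := by
        rw [lintegral_add_right _ measurable_const, setLIntegral_const]
    _ = 2 * ∫⁻ x in cube a l, ENNReal.ofReal (w x) := by
        rw [← ofReal_integral_eq_lintegral_ofReal hi
            (ae_restrict_of_ae (hw.2.mono fun _ h => h.le)),
          ← ENNReal.ofReal_toReal hfin, ← ENNReal.ofReal_mul havg, two_mul]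
        congr 2
        rw [avg, setAverage_eq, smul_eq_mul, ← Measure.real, hvol]
        have := (pow_pos hl n).ne'
        field_simp

theorem DyadicGrid.sets_subset_allCubes (D : DyadicGrid n) : D.sets ⊆ allCubes n := by
  rintro _ ⟨Q, -, rfl⟩
  exact ⟨Q.corner, Q.side, Q.side_pos, rfl⟩

theorem bmoNorm_mono {F G : Set (Set (Fin n → ℝ))} (h : F ⊆ G) (w b : (Fin n → ℝ) → ℝ) :
    bmoNorm F w b ≤ bmoNorm G w b := iSup_le_iSup_of_subset h

theorem bmoNorm_grid_self_le (D : DyadicGrid n) {w : (Fin n → ℝ) → ℝ} (hw : IsWeight w) :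
    bmoNorm D.sets w w ≤ 2 := (bmoNorm_mono D.sets_subset_allCubes w w).trans (bmoNorm_self_le hw)

theorem memBMO_self (D : DyadicGrid n) {w : (Fin n → ℝ) → ℝ} (hw : IsWeight w) : MemBMO D w w :=
  ⟨hw.1, (bmoNorm_grid_self_le D hw).trans_lt (by norm_num)⟩

/-! ### Lebesgue differentiation along the grid -/

theorem cube_ae_eq_closedBall (Q : DyadicCube n) :
    Q.toSet =ᵐ[volume] Metric.closedBall (fun i => Q.corner i + Q.side / 2) (Q.side / 2) := by
  have hl := Q.side_pos
  rw [closedBall_pi _ (by linarith), DyadicCube.toSet, cube_eq_pi]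
  refine (Measure.univ_pi_Ico_ae_eq_Icc (μ := fun _ => (volume : Measure ℝ))).trans ?_
  rw [← Set.pi_univ_Icc]
  refine Filter.EventuallyEq.of_eq ?_
  congr 1; ext i x
  simp only [Real.closedBall_eq_Icc, Set.mem_Icc]
  constructor <;> rintro ⟨h1, h2⟩ <;> constructor <;> linarith

namespace DyadicGrid

variable [NeZero n] {D : DyadicGrid n}

theorem cubeAt_subset {R : D.cubes} {x : Fin n → ℝ} (hx : x ∈ R.1.toSet) {k : ℤ}
    (hk : k ≤ R.1.gen) : (cubeAt D k x).1.toSet ⊆ R.1.toSet :=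
  D.subset_of_mem (cubeAt D k x).2 R.2 (by rwa [gen_cubeAt]) (mem_cubeAt k x) hx

/-- Up to null sets dyadic cubes are closed balls of the supremum norm, not centred at `x` but
containing it, so the differentiation theorem for doubling measures applies. -/
theorem ae_tendsto_avg {f : (Fin n → ℝ) → ℝ} (R : D.cubes) (hf : IntegrableOn f R.1.toSet) :
    ∀ᵐ x, x ∈ R.1.toSet →
      Tendsto (fun k : ℕ => avg f (cubeAt D (R.1.gen - k) x).1.toSet) atTop (𝓝 (f x)) := by
  have hF : LocallyIntegrable (R.1.toSet.indicator f) volume :=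
    ((integrable_indicator_iff R.1.measurableSet).2 hf).locallyIntegrable
  filter_upwards [IsUnifLocDoublingMeasure.ae_tendsto_average volume hF 1] with x hx hxR
  have hside : ∀ k : ℕ, (cubeAt D (R.1.gen - k) x).1.side = R.1.side * (1 / 2) ^ k := fun k => by
    rw [DyadicCube.side, gen_cubeAt, zpow_sub₀ (by norm_num), DyadicCube.side]
    simp [div_eq_mul_inv]
  have hc : ∀ k : ℕ, x ∈ Metric.closedBall
      (fun i => (cubeAt D (R.1.gen - k) x).1.corner i + (cubeAt D (R.1.gen - k) x).1.side / 2)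
      ((cubeAt D (R.1.gen - k) x).1.side / 2) := fun k => by
    have hl := (cubeAt D (R.1.gen - k) x).1.side_pos
    rw [Metric.mem_closedBall, dist_pi_le_iff (by linarith)]
    intro i
    have := mem_cubeAt (D := D) (R.1.gen - k) x i
    rw [Real.dist_eq, abs_le]
    constructor <;> linarith
  have h := hx (ι := ℕ) (l := atTop)
    (fun k i => (cubeAt D (R.1.gen - k) x).1.corner i + (cubeAt D (R.1.gen - k) x).1.side / 2)
    (fun k => (cubeAt D (R.1.gen - k) x).1.side / 2) ?_ ?_
  · rw [Set.indicator_of_mem hxR] at h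
    refine h.congr fun k => ?_
    rw [← setAverage_congr (cube_ae_eq_closedBall _), avg]
    refine setAverage_congr_fun (cubeAt D (R.1.gen - k) x).1.measurableSet
      (ae_of_all _ fun y hy => ?_)
    exact Set.indicator_of_mem (cubeAt_subset hxR (by omega) hy) _
  · refine tendsto_nhdsWithin_iff.2 ⟨?_, Eventually.of_forall fun k => ?_⟩
    · simp only [hside]
      have := (tendsto_pow_atTop_nhds_zero_of_lt_one (r := (1 / 2 : ℝ)) (by norm_num)
        (by norm_num)).const_mul (R.1.side)
      simpa using this.div_const 2
    · exact half_pos (cubeAt D (R.1.gen - k) x).1.side_pos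
  · exact Eventually.of_forall fun k => by simpa using hc k

theorem avg_cubeAt_eq {f : (Fin n → ℝ) → ℝ} (N : ℕ) (R : D.cubes)
    (h : ∀ Q : D.cubes, Q.1.toSet ⊆ R.1.toSet → ∀ s,
      avg f (child Q s).1.toSet = avg f Q.1.toSet) {x : Fin n → ℝ} (hx : x ∈ R.1.toSet) :
    avg f (cubeAt D (R.1.gen - N) x).1.toSet = avg f R.1.toSet := by
  induction N generalizing R with
  | zero => rw [cubeAt_eq (Q := R) (by simp) hx]
  | succ N ih =>
    have hxs : x ∈ (child R (R.1.childIdx x)).1.toSet := (R.1.mem_child_iff _ x).2 ⟨hx, rfl⟩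
    have hg : (child R (R.1.childIdx x)).1.gen = R.1.gen - 1 := rfl
    have := ih (child R (R.1.childIdx x))
      (fun Q hQ => h Q (hQ.trans (R.1.child_subset _))) hxs
    rw [h R subset_rfl, hg] at this
    rw [← this]
    congr 4
    push_cast; ring

/-- A function all of whose martingale differences in a cube vanish is constant on the cube. -/
theorem ae_eq_const {f : (Fin n → ℝ) → ℝ} (R : D.cubes) (hf : IntegrableOn f R.1.toSet)
    (h : ∀ Q : D.cubes, Q.1.toSet ⊆ R.1.toSet → ∀ s,
      avg f (child Q s).1.toSet = avg f Q.1.toSet) :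
    ∀ᵐ x, x ∈ R.1.toSet → f x = avg f R.1.toSet := by
  filter_upwards [ae_tendsto_avg R hf] with x hx hxR
  refine tendsto_nhds_unique (hx hxR) ?_
  simp only [avg_cubeAt_eq _ R h hxR]
  exact tendsto_const_nhds

/-! ### Testing a paraproduct -/

variable {w : (Fin n → ℝ) → ℝ}

/-- Pairing with `u ∈ L²(w)` is continuous on `L²(w⁻¹)`, so the unconditional convergence of the
series passes to the scalar series. -/
theorem hasSum_pairing (h : MemA2 D w) {b f g u : (Fin n → ℝ) → ℝ}
    (hg : IsParaproduct D w⁻¹ b f g) (hu : MemLp u 2 (weightMeasure w)) :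
    HasSum (fun i : HaarIndex D => haarCoeff b i.1 i.2 * avg f (i.1 : DyadicCube n).toSet *
      haarCoeff u i.1 i.2) (∫ x, g x * u x) := by
  have hm := h.1.aemeasurable
  have hw := h.1.2
  have hm' := aemeasurable_inv hm
  have hw' := inv_pos_ae hw
  have hP : ∀ F : Finset (HaarIndex D),
      MemLp (fun x => ∑ i ∈ F, paraTerm D b f i x) 2 (weightMeasure w⁻¹) := fun F =>
    memLp_finsetSum F fun i _ => memLp_paraTerm hm' hw' (integrableOn_inv h) b f i
  have hPg : ∀ F : Finset (HaarIndex D),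
      MemLp (fun x => (∑ i ∈ F, paraTerm D b f i x) - g x) 2 (weightMeasure w⁻¹) :=
    fun F => (hP F).sub hg.1
  have hlim := hg.2
  rw [← ENNReal.ofReal_zero] at hlim
  have hlim2 : Tendsto (fun F : Finset (HaarIndex D) =>
      (eLpNorm (fun x => (∑ i ∈ F, paraTerm D b f i x) - g x) 2 (weightMeasure w⁻¹)).toReal *
        √(sqNorm w u)) atTop (𝓝 0) := by
    have := (ENNReal.tendsto_toReal (by simp)).comp hlim
    simpa using this.mul_const √(sqNorm w u)
  rw [HasSum, SummationFilter.unconditional_filter, tendsto_iff_norm_sub_tendsto_zero]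
  refine squeeze_zero (fun _ => norm_nonneg _) (fun F => ?_) hlim2
  have e : ∑ i ∈ F, haarCoeff b i.1 i.2 * avg f (i.1 : DyadicCube n).toSet *
      haarCoeff u i.1 i.2 - ∫ x, g x * u x =
      ∫ x, ((∑ i ∈ F, paraTerm D b f i x) - g x) * u x := by
    simp only [← integral_paraTerm_mul, sub_mul]
    rw [integral_sub, ← integral_finsetSum]
    · simp only [Finset.sum_mul]
    · intro i _
      exact integrable_mul_of_memLp hm hw
        (memLp_paraTerm hm' hw' (integrableOn_inv h) b f i) hu
    · exact integrable_mul_of_memLp hm hw (hP F) hu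
    · exact integrable_mul_of_memLp hm hw hg.1 hu
  rw [e, eLpNorm_eq_ofReal hm' hw' (hPg F), ENNReal.toReal_ofReal (Real.sqrt_nonneg _),
    Real.norm_eq_abs, ← Real.sqrt_mul (sqNorm_nonneg hw' _)]
  exact Real.abs_le_sqrt (sq_integral_le_sqNorm hm hw (hPg F) hu)

/-- The difference of the averages over a child and over its parent. -/
def diffTest (Q : D.cubes) (s : Fin n → Bool) (x : Fin n → ℝ) : ℝ :=
  (child Q s).1.toSet.indicator (fun _ => (vol (child Q s))⁻¹) x -
    Q.1.toSet.indicator (fun _ => (vol Q)⁻¹) x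

theorem integral_mul_diffTest {f : (Fin n → ℝ) → ℝ} {Q : D.cubes} (hf : IntegrableOn f Q.1.toSet)
    (s : Fin n → Bool) :
    ∫ x, f x * diffTest Q s x = avg f (child Q s).1.toSet - avg f Q.1.toSet := by
  have key : ∀ P : D.cubes, IntegrableOn f P.1.toSet →
      Integrable (fun x => f x * P.1.toSet.indicator (fun _ => (vol P)⁻¹) x) ∧
      ∫ x, f x * P.1.toSet.indicator (fun _ => (vol P)⁻¹) x = avg f P.1.toSet := by
    intro P hP
    have e : (fun x => f x * P.1.toSet.indicator (fun _ => (vol P)⁻¹) x) =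
        P.1.toSet.indicator fun x => f x * (vol P)⁻¹ := by
      ext x; by_cases hx : x ∈ P.1.toSet <;> simp [hx]
    rw [e]
    refine ⟨(integrable_indicator_iff P.1.measurableSet).2 (hP.mul_const _), ?_⟩
    rw [integral_indicator P.1.measurableSet, integral_mul_const, avg_eq_mass, mass,
      div_eq_mul_inv]
  have h1 := key (child Q s) (hf.mono_set (Q.1.child_subset s))
  have h2 := key Q hf
  simp only [diffTest, mul_sub]
  rw [integral_sub h1.1 h2.1, h1.2, h2.2]

theorem integrableOn_haar (P : D.cubes) (e : Signature n) (Q : D.cubes) :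
    IntegrableOn (haar P.1 e) Q.1.toSet := by
  have := integrableOn_mul_haar (integrableOn_const_cube 1 P.1) e
  simp only [one_mul] at this
  exact this.integrableOn

theorem setIntegral_haar_eq_zero {P Q : D.cubes} (e : Signature n)
    (h : P.1.toSet ⊆ Q.1.toSet ∨ Disjoint P.1.toSet Q.1.toSet) :
    ∫ x in Q.1.toSet, haar P.1 e x = 0 := by
  rcases h with h | h
  · rw [setIntegral_eq_integral_of_forall_compl_eq_zero
      fun x hx => haar_of_notMem P.1 e fun hP => hx (h hP), integral_haar]
  · exact setIntegral_eq_zero_of_forall_eq_zero fun x hx =>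
      haar_of_notMem P.1 e fun hP => Set.disjoint_left.1 h hP hx

theorem subset_or_disjoint {P Q : D.cubes} (hg : P.1.gen ≤ Q.1.gen) :
    P.1.toSet ⊆ Q.1.toSet ∨ Disjoint P.1.toSet Q.1.toSet := by
  by_cases h : Disjoint P.1.toSet Q.1.toSet
  · exact Or.inr h
  · obtain ⟨x, hx, hx'⟩ := Set.not_disjoint_iff.1 h
    exact Or.inl (D.subset_of_mem P.2 Q.2 hg hx hx')

theorem avg_const_on {f : (Fin n → ℝ) → ℝ} {Q : D.cubes} {c : ℝ} (h : ∀ x ∈ Q.1.toSet, f x = c) :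
    avg f Q.1.toSet = c := by
  rw [avg_eq, setIntegral_congr_fun Q.1.measurableSet h, setIntegral_const, Q.1.volume_real,
    smul_eq_mul, mul_div_cancel_left₀ _ Q.1.vol_pos.ne']

-- Testing against `diffTest` isolates one cube: the Haar function of `P` has mean zero on `Q` and
-- on its child if `P` is smaller or disjoint, and is constant on `Q` if `P` strictly contains `Q`.
open Classical in
theorem haarCoeff_diffTest (P Q : D.cubes) (s : Fin n → Bool) (e : Signature n) :
    haarCoeff (diffTest Q s) P.1 e = if P = Q then haarVal Q.1 e.1 s else 0 := by
  have h1 : haarCoeff (diffTest Q s) P.1 e =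
      avg (haar P.1 e) (child Q s).1.toSet - avg (haar P.1 e) Q.1.toSet := by
    rw [← integral_mul_diffTest (integrableOn_haar P e Q), haarCoeff]
    congr 1; ext x; ring
  rw [h1]
  have hgs : (child Q s).1.gen = Q.1.gen - 1 := rfl
  split_ifs with hPQ
  · subst hPQ
    rw [avg_const_on fun x hx => haar_of_mem_child P.1 e hx, avg_eq,
      setIntegral_haar_eq_zero e (Or.inl subset_rfl)]
    simp
  · by_cases hg : P.1.gen ≤ Q.1.gen
    · have hz : ∫ x in (child Q s).1.toSet, haar P.1 e x = 0 := by
        refine setIntegral_haar_eq_zero e ?_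
        rcases hg.eq_or_lt with h | h
        · exact Or.inr ((disjoint_of_gen_eq h hPQ).mono_right (Q.1.child_subset s))
        · exact subset_or_disjoint (by omega)
      rw [avg_eq, avg_eq, hz, setIntegral_haar_eq_zero e (subset_or_disjoint hg)]
      simp
    · rcases subset_or_disjoint (D := D) (P := Q) (Q := P) (by omega) with h | h
      · obtain ⟨s', hs'⟩ := subset_child h (fun h => hPQ h.symm)
        rw [avg_const_on fun x hx => haar_of_mem_child P.1 e (hs' hx),
          avg_const_on fun x hx => haar_of_mem_child P.1 e (hs' (Q.1.child_subset s hx)), sub_self]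
      · have hz : ∀ x ∈ Q.1.toSet, haar P.1 e x = 0 := fun x hx =>
          haar_of_notMem P.1 e (Set.disjoint_left.1 h hx)
        rw [avg_const_on hz, avg_const_on fun x hx => hz x (Q.1.child_subset s hx), sub_self]

theorem memLp_diffTest {v : (Fin n → ℝ) → ℝ} (hm : AEMeasurable v) (hv : ∀ᵐ x, 0 < v x)
    (hvi : ∀ Q : D.cubes, IntegrableOn v Q.1.toSet) (Q : D.cubes) (s : Fin n → Bool) :
    MemLp (diffTest Q s) 2 (weightMeasure v) := by
  have key : ∀ P : D.cubes,
      MemLp (fun x => P.1.toSet.indicator (fun _ => (vol P)⁻¹) x) 2 (weightMeasure v) := fun P => by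
    have := (memLp_one_cube hm hv (hvi P)).const_mul (vol P)⁻¹
    refine this.ae_eq (ae_of_all _ fun x => ?_)
    by_cases hx : x ∈ P.1.toSet <;> simp [hx]
  exact (key (child Q s)).sub (key Q)

/-- The martingale differences of a paraproduct. -/
theorem avg_child_sub_avg (h : MemA2 D w) {b f g : (Fin n → ℝ) → ℝ}
    (hb : LocallyIntegrable b volume) (hg : IsParaproduct D w⁻¹ b f g) (Q : D.cubes)
    (s : Fin n → Bool) :
    avg g (child Q s).1.toSet - avg g Q.1.toSet =
      avg f Q.1.toSet * (avg b (child Q s).1.toSet - avg b Q.1.toSet) := by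
  have hm := h.1.aemeasurable
  have hw := h.1.2
  have hgi : IntegrableOn g Q.1.toSet :=
    integrableOn_of_memLp (aemeasurable_inv hm) (inv_pos_ae hw) hg.1
      (by rw [inv_inv]; exact integrableOn_weight h Q)
  have h1 := hasSum_pairing h hg (memLp_diffTest hm hw (integrableOn_weight h) Q s)
  rw [integral_mul_diffTest hgi] at h1
  have h2 : HasSum (fun i : HaarIndex D => haarCoeff b i.1 i.2 * avg f (i.1 : DyadicCube n).toSet *
      haarCoeff (diffTest Q s) i.1 i.2)
      (∑ i ∈ ({Q} : Finset D.cubes) ×ˢ (Finset.univ : Finset (Signature n)),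
        haarCoeff b i.1 i.2 * avg f (i.1 : DyadicCube n).toSet *
          haarCoeff (diffTest Q s) i.1 i.2) := by
    refine hasSum_sum_of_ne_finset_zero fun i hi => ?_
    have : i.1 ≠ Q := fun hi' =>
      hi (Finset.mem_product.2 ⟨Finset.mem_singleton.2 hi', Finset.mem_univ _⟩)
    rw [haarCoeff_diffTest, if_neg this, mul_zero]
  rw [h1.unique h2, Finset.sum_product, Finset.sum_singleton]
  simp only [haarCoeff_diffTest, if_true]
  rw [coe_child, ← sum_haarCoeff_mul_haarVal (integrableOn_of_locallyIntegrable hb Q.1),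
    Finset.mul_sum]
  exact Finset.sum_congr rfl fun e _ => by ring

/-- The averages of `1_R` equal `1` on all subcubes of `R`, so `b - g` has no martingale differences
there and the oscillations of `b` and `g` on `R` agree. That of `g` is at most twice its `L¹` norm,
which Cauchy–Schwarz bounds by `k w(R)`. -/
theorem mass_dev_le_of_paraproduct (h : MemA2 D w) {b g : (Fin n → ℝ) → ℝ}
    (hb : LocallyIntegrable b volume) (R : D.cubes) {k : ℝ} (hk : 0 ≤ k)
    (hg : IsParaproduct D w⁻¹ b (R.1.toSet.indicator fun _ => (1 : ℝ)) g)
    (hgk : sqNorm w⁻¹ g ≤ k ^ 2 * mass w R) :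
    mass (fun x => |b x - avg b R.1.toSet|) R ≤ 2 * k * mass w R := by
  have hm := h.1.aemeasurable
  have hw := h.1.2
  have hwi : ∀ Q : D.cubes, IntegrableOn (w⁻¹⁻¹) Q.1.toSet := fun Q => by
    rw [inv_inv]; exact integrableOn_weight h Q
  have hgi : ∀ Q : D.cubes, IntegrableOn g Q.1.toSet := fun Q =>
    integrableOn_of_memLp (aemeasurable_inv hm) (inv_pos_ae hw) hg.1 (hwi Q)
  have hbi : ∀ Q : D.cubes, IntegrableOn b Q.1.toSet :=
    fun Q => integrableOn_of_locallyIntegrable hb Q.1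
  have havg : ∀ Q : D.cubes, avg (fun x => b x - g x) Q.1.toSet =
      avg b Q.1.toSet - avg g Q.1.toSet := fun Q => by
    rw [avg_eq, avg_eq, avg_eq, integral_sub (hbi Q) (hgi Q), sub_div]
  have hconst := ae_eq_const (f := fun x => b x - g x) R ((hbi R).sub (hgi R)) fun Q hQ s => by
    have h1 := avg_child_sub_avg h hb hg Q s
    have h2 : avg (R.1.toSet.indicator fun _ => (1 : ℝ)) Q.1.toSet = 1 :=
      avg_const_on fun x hx => Set.indicator_of_mem (hQ hx) _
    rw [h2] at h1
    rw [havg, havg]; linarith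
  have e : mass (fun x => |b x - avg b R.1.toSet|) R =
      mass (fun x => |g x - avg g R.1.toSet|) R := by
    refine setIntegral_congr_ae R.1.measurableSet (hconst.mono fun x hx hxR => ?_)
    have := hx hxR
    rw [havg] at this
    congr 1; linarith
  have hdev : mass (fun x => |g x - avg g R.1.toSet|) R ≤ 2 * mass (fun x => |g x|) R := by
    have hav : |avg g R.1.toSet| * vol R ≤ mass (fun x => |g x|) R := by
      rw [avg_eq_mass, abs_div, abs_of_pos (vol_pos R), div_mul_cancel₀ _ (vol_pos R).ne']
      exact abs_mass_le g R
    have : mass (fun x => |g x - avg g R.1.toSet|) R ≤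
        mass (fun x => |g x| + |avg g R.1.toSet|) R :=
      integral_mono ((hgi R).sub (integrableOn_const_cube _ _)).abs
        ((hgi R).abs.add (integrableOn_const_cube _ _)) fun x => abs_sub _ _
    refine this.trans ?_
    rw [mass, integral_add (hgi R).abs (integrableOn_const_cube _ _), setIntegral_const,
      R.1.volume_real, smul_eq_mul]
    have e2 : R.1.vol = vol R := rfl
    rw [e2, mul_comm (vol R)]
    have e3 : ∫ x in R.1.toSet, |g x| = mass (fun x => |g x|) R := rfl
    linarith
  have hsq : mass (fun x => |g x|) R ≤ k * mass w R := by
    have h1 := sq_mass_le (aemeasurable_inv hm) (inv_pos_ae hw) hg.1.abs (hwi R)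
    rw [inv_inv] at h1
    have hw0 := mass_pos (integrableOn_weight h R) hw
    have h2 : mass (fun x => (|g| x) ^ 2 * w⁻¹ x) R ≤ sqNorm w⁻¹ g := by
      simp only [Pi.abs_apply, sq_abs]
      exact setIntegral_le_integral (integrable_sq_mul (aemeasurable_inv hm) (inv_pos_ae hw) hg.1)
        ((inv_pos_ae hw).mono fun x hx => mul_nonneg (sq_nonneg _) hx.le)
    have h3 : mass |g| R ^ 2 ≤ (k * mass w R) ^ 2 := by
      refine h1.trans ((mul_le_mul_of_nonneg_right (h2.trans hgk) hw0.le).trans_eq (by ring))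
    exact (le_abs_self _).trans (abs_le_of_sq_le_sq h3 (by positivity))
  rw [e]; linarith

theorem bmoNorm_le (h : MemA2 D w) {b : (Fin n → ℝ) → ℝ} (hb : LocallyIntegrable b volume) :
    bmoNorm D.sets w b ≤ 2 * paraNorm D b w w⁻¹ := by
  have hm := h.1.aemeasurable
  have hw := h.1.2
  rw [mul_comm, ← ENNReal.div_le_iff (by norm_num) (by norm_num)]
  refine le_sInf fun K hK => ?_
  rw [ENNReal.div_le_iff (by norm_num) (by norm_num), mul_comm]
  by_cases hKt : K = ⊤
  · rw [hKt, ENNReal.mul_top (by norm_num)]; exact le_top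
  refine iSup₂_le fun Q hQ => ?_
  obtain ⟨Q, hQD, rfl⟩ := hQ
  set R : D.cubes := ⟨Q, hQD⟩ with hR
  have h1 := memLp_one_cube hm hw (integrableOn_weight h R)
  obtain ⟨g, hg, hgK⟩ := hK _ h1
  have hw0 := mass_pos (integrableOn_weight h R) hw
  rw [eLpNorm_eq_ofReal hm hw h1, eLpNorm_eq_ofReal (aemeasurable_inv hm) (inv_pos_ae hw) hg.1,
    sqNorm_one_cube, ← ENNReal.ofReal_toReal hKt, ← ENNReal.ofReal_mul ENNReal.toReal_nonneg,
    ENNReal.ofReal_le_ofReal_iff (by positivity)] at hgK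
  have hgk : sqNorm w⁻¹ g ≤ K.toReal ^ 2 * mass w R := by
    have := pow_le_pow_left₀ (Real.sqrt_nonneg _) hgK 2
    rwa [mul_pow, Real.sq_sqrt (sqNorm_nonneg (inv_pos_ae hw) _), Real.sq_sqrt hw0.le] at this
  have h2 := mass_dev_le_of_paraproduct h hb R ENNReal.toReal_nonneg hg hgk
  have hi : IntegrableOn (fun x => |b x - avg b R.1.toSet|) R.1.toSet :=
    ((integrableOn_of_locallyIntegrable hb R.1).sub (integrableOn_const_cube _ _)).abs
  show (∫⁻ x in R.1.toSet, ENNReal.ofReal |b x - avg b R.1.toSet|) / weightMeasure w R.1.toSet ≤ _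
  rw [lintegral_eq_mass hi (ae_of_all _ fun x => abs_nonneg _),
    weightMeasure_cube (integrableOn_weight h R) hw]
  refine ENNReal.div_le_of_le_mul ?_
  rw [← ENNReal.ofReal_toReal hKt, ← ENNReal.ofReal_ofNat 2, ← ENNReal.ofReal_mul (by norm_num),
    ← ENNReal.ofReal_mul (by positivity)]
  exact ENNReal.ofReal_le_ofReal h2

end DyadicGrid

end

section

variable {n : ℕ}

/-! ### The square function -/

namespace DyadicGrid

section General

variable [NeZero n] {D : DyadicGrid n} {w : (Fin n → ℝ) → ℝ}

theorem eLpNorm_squareFunction_sq (hw : ∀ᵐ x, 0 < w x)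
    (hwi : ∀ Q : D.cubes, IntegrableOn w Q.1.toSet) (f : (Fin n → ℝ) → ℝ) :
    eLpNorm (squareFunction D f) 2 (weightMeasure w) ^ 2 =
      ∑' i : HaarIndex D, ENNReal.ofReal (haarCoeff f i.1 i.2 ^ 2 * (mass w i.1 / vol i.1)) := by
  rw [eLpNorm_eq_lintegral_rpow_enorm_toReal (by norm_num) (by norm_num),
    ← ENNReal.rpow_ofNat, ← ENNReal.rpow_mul]
  simp only [ENNReal.toReal_ofNat, one_div, ne_eq, OfNat.ofNat_ne_zero, not_false_eq_true,
    inv_mul_cancel₀, ENNReal.rpow_one, enorm_eq_self, squareFunction, ← ENNReal.rpow_mul]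
  rw [lintegral_tsum]
  · congr 1; ext i
    rw [lintegral_indicator i.1.1.measurableSet, setLIntegral_const,
      weightMeasure_cube (hwi i.1) hw, i.1.1.volume_toSet,
      ← ENNReal.ofReal_div_of_pos i.1.1.vol_pos,
      ← ENNReal.ofReal_mul (div_nonneg (sq_nonneg _) i.1.1.vol_pos.le)]
    congr 1
    rw [div_mul_eq_mul_div, mul_div_assoc]; rfl
  · exact fun i => (measurable_const.indicator i.1.1.measurableSet).aemeasurable

theorem haarCoeff_haar_self (Q : D.cubes) (e : Signature n) : haarCoeff (haar Q.1 e) Q.1 e = 1 := by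
  simp only [haarCoeff, ← sq, haar_sq]
  rw [integral_indicator Q.1.measurableSet, setIntegral_const, Q.1.volume_real, smul_eq_mul,
    mul_inv_cancel₀ Q.1.vol_pos.ne']

theorem sqNorm_haar (v : (Fin n → ℝ) → ℝ) (Q : D.cubes) (e : Signature n) :
    sqNorm v (haar Q.1 e) = mass v Q / vol Q := by
  simp only [sqNorm, haar_sq]
  rw [mass, div_eq_mul_inv, ← integral_mul_const, ← integral_indicator Q.1.measurableSet]
  congr 1; ext x
  by_cases hx : x ∈ Q.1.toSet <;> simp [hx, mul_comm]
  left; rfl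

theorem le_squareNorm (h : MemA2 D w) {f : (Fin n → ℝ) → ℝ} (hf : MemLp f 2 (weightMeasure w))
    (hf0 : 0 < sqNorm w f) {c : ℝ}
    (hcf : ENNReal.ofReal (c ^ 2 * sqNorm w f) ≤
      ∑' i : HaarIndex D, ENNReal.ofReal (haarCoeff f i.1 i.2 ^ 2 * (mass w i.1 / vol i.1))) :
    ENNReal.ofReal c ≤ squareNorm D w := by
  have hm := h.1.aemeasurable
  have hw := h.1.2
  refine le_sInf fun K hK => ?_
  by_cases hKt : K = ⊤
  · rw [hKt]; exact le_top
  have h1 := pow_le_pow_left' (hK f hf) 2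
  rw [eLpNorm_squareFunction_sq hw (integrableOn_weight h), mul_pow,
    eLpNorm_sq_eq hm hw hf] at h1
  have h2 := hcf.trans h1
  rw [← ENNReal.ofReal_toReal hKt, ← ENNReal.ofReal_pow ENNReal.toReal_nonneg,
    ← ENNReal.ofReal_mul (by positivity), ENNReal.ofReal_le_ofReal_iff (by positivity)] at h2
  rw [ENNReal.ofReal_le_iff_le_toReal hKt]
  exact le_of_sq_le_sq (le_of_mul_le_mul_right h2 hf0) ENNReal.toReal_nonneg

theorem one_le_squareNorm (h : MemA2 D w) : 1 ≤ squareNorm D w := by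
  obtain ⟨Q⟩ : Nonempty D.cubes := inferInstance
  let e : Signature n := ⟨fun _ => 0, fun h => by
    have := congrFun h ⟨0, Nat.pos_of_ne_zero (NeZero.ne n)⟩
    simp at this⟩
  have hw := mass_pos (integrableOn_weight h Q) h.1.2
  rw [← ENNReal.ofReal_one]
  refine le_squareNorm h (f := haar Q.1 e)
    (memLp_haar h.1.aemeasurable h.1.2 (integrableOn_weight h Q) e)
    (by rw [sqNorm_haar]; exact div_pos hw (vol_pos Q)) ?_
  refine le_trans (le_of_eq ?_) (ENNReal.le_tsum (Q, e))
  rw [haarCoeff_haar_self, sqNorm_haar]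

/-! ### A test function of bounded mean oscillation -/

/-- A symbol with nonzero norm. It oscillates only on cubes containing `I`, and there `w(Q) ≥ w(I)`.
-/
theorem memBMO_haar (h : MemA2 D w) (I : D.cubes) (e : Signature n) :
    MemBMO D w (haar I.1 e) ∧ bmoNorm D.sets w (haar I.1 e) ≠ 0 := by
  have hint : Integrable (haar I.1 e) := by
    simpa using integrableOn_mul_haar (integrableOn_const_cube 1 I.1) e
  have hwI := mass_pos (integrableOn_weight h I) h.1.2
  have hmem : MemBMO D w (haar I.1 e) := by
    refine ⟨hint.locallyIntegrable, lt_of_le_of_lt ?_ (ENNReal.ofReal_lt_top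
      (r := (∫ x, |haar I.1 e x|) / mass w I))⟩
    refine iSup₂_le fun Q hQ => ?_
    obtain ⟨Q, hQD, rfl⟩ := hQ
    lift Q to D.cubes using hQD
    have hconst : ∀ c, (∀ x ∈ Q.1.toSet, haar I.1 e x = c) →
        (∫⁻ x in Q.1.toSet, ENNReal.ofReal |haar I.1 e x - avg (haar I.1 e) Q.1.toSet|) /
          weightMeasure w Q.1.toSet ≤ ENNReal.ofReal ((∫ x, |haar I.1 e x|) / mass w I) := by
      intro c hc
      have : ∫⁻ x in Q.1.toSet, ENNReal.ofReal |haar I.1 e x - avg (haar I.1 e) Q.1.toSet| = 0 := by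
        rw [setLIntegral_congr_fun (g := fun _ => 0) Q.1.measurableSet fun x hx => by
          rw [avg_const_on hc, hc x hx]; simp]
        simp
      rw [this]; simp
    rcases le_or_gt I.1.gen Q.1.gen with hg | hg
    · rcases subset_or_disjoint hg with hs | hs
      · have hz : avg (haar I.1 e) Q.1.toSet = 0 := by
          rw [avg_eq, setIntegral_haar_eq_zero e (Or.inl hs), zero_div]
        have hwQ := mass_pos (integrableOn_weight h Q) h.1.2
        rw [hz]
        simp only [sub_zero]
        rw [lintegral_eq_mass (integrableOn_haar I e Q).abs (ae_of_all _ fun x => abs_nonneg _),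
          weightMeasure_cube (integrableOn_weight h Q) h.1.2, ← ENNReal.ofReal_div_of_pos hwQ]
        refine ENNReal.ofReal_le_ofReal (div_le_div₀ (integral_nonneg fun x => abs_nonneg _) ?_
          hwI ?_)
        · exact setIntegral_le_integral hint.abs (ae_of_all _ fun x => abs_nonneg _)
        · exact setIntegral_mono_set (integrableOn_weight h Q)
            (ae_restrict_of_ae (h.1.2.mono fun x hx => hx.le)) (LE.le.eventuallyLE hs)
      · exact hconst 0 fun x hx => haar_of_notMem I.1 e (Set.disjoint_right.1 hs hx)
    · rcases subset_or_disjoint hg.le with hs | hs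
      · obtain ⟨s, hs'⟩ := subset_child hs (fun h => by rw [h] at hg; exact lt_irrefl _ hg)
        exact hconst _ fun x hx => haar_of_mem_child I.1 e (hs' hx)
      · exact hconst 0 fun x hx => haar_of_notMem I.1 e (Set.disjoint_left.1 hs hx)
  refine ⟨hmem, fun h0 => ?_⟩
  have h1 := mass_dev_le h hmem I
  rw [h0, avg_eq, setIntegral_haar_eq_zero e (Or.inl subset_rfl), zero_div] at h1
  simp only [sub_zero, ENNReal.toReal_zero, zero_mul] at h1
  have h2 : ∀ x ∈ I.1.toSet, |haar I.1 e x| = √(I.1.vol⁻¹) := fun x hx => by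
    rw [← Real.sqrt_sq_eq_abs, haar_sq, Set.indicator_of_mem hx]
  rw [mass, setIntegral_congr_fun I.1.measurableSet h2, setIntegral_const, I.1.volume_real,
    smul_eq_mul] at h1
  have := I.1.vol_pos
  have h3 : 0 < I.1.vol * √(I.1.vol⁻¹) := by positivity
  linarith

/-- Shows that the supremum of `‖Π_b‖ / ‖b‖` is at least `1 / 2` for every weight. -/
theorem exists_bmo_test (h : MemA2 D w) : ∃ b, MemBMO D w b ∧ bmoNorm D.sets w b ≠ 0 ∧
    bmoNorm D.sets w b ≤ 2 * paraNorm D b w w⁻¹ := by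
  obtain ⟨Q⟩ : Nonempty D.cubes := inferInstance
  let e : Signature n := ⟨fun _ => 0, fun h => by
    have := congrFun h ⟨0, Nat.pos_of_ne_zero (NeZero.ne n)⟩
    simp at this⟩
  obtain ⟨h1, h2⟩ := memBMO_haar h Q e
  exact ⟨_, h1, h2, bmoNorm_le h h1.1⟩

theorem paraNorm_self_ne_top (h : MemA2 D w) : paraNorm D w w w⁻¹ ≠ ⊤ := by
  refine ((paraNorm_le h (memBMO_self D h.1)).trans_lt ?_).ne
  exact ENNReal.mul_lt_top (ENNReal.mul_lt_top ENNReal.ofReal_lt_top (memBMO_self D h.1).2)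
    (ENNReal.pow_lt_top h.2)

theorem exists_of_paraNorm_lt {b f u v : (Fin n → ℝ) → ℝ} {K : ℝ≥0∞} (hK : paraNorm D b u v < K)
    (hf : MemLp f 2 (weightMeasure u)) : ∃ g, IsParaproduct D v b f g ∧
      eLpNorm g 2 (weightMeasure v) ≤ K * eLpNorm f 2 (weightMeasure u) := by
  obtain ⟨K', hK', hlt⟩ := sInf_lt_iff.1 hK
  obtain ⟨g, hg, hgK⟩ := hK' f hf
  exact ⟨g, hg, hgK.trans (mul_le_mul_left hlt.le _)⟩

theorem abs_integral_le_of_paraproduct (h : MemA2 D w) {f g : (Fin n → ℝ) → ℝ}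
    (hf : MemLp f 2 (weightMeasure w)) (hg : MemLp g 2 (weightMeasure w⁻¹)) {k : ℝ} (hk : 0 ≤ k)
    (hgk : eLpNorm g 2 (weightMeasure w⁻¹) ≤ ENNReal.ofReal k * eLpNorm f 2 (weightMeasure w)) :
    |∫ x, g x * f x| ≤ k * sqNorm w f := by
  have hm := h.1.aemeasurable
  have hw := h.1.2
  have hX := sqNorm_nonneg hw f
  rw [eLpNorm_eq_ofReal hm hw hf, eLpNorm_eq_ofReal (aemeasurable_inv hm) (inv_pos_ae hw) hg,
    ← ENNReal.ofReal_mul hk, ENNReal.ofReal_le_ofReal_iff (by positivity)] at hgk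
  refine (Real.abs_le_sqrt (sq_integral_le_sqNorm hm hw hg hf)).trans ?_
  rw [Real.sqrt_mul (sqNorm_nonneg (inv_pos_ae hw) g)]
  calc √(sqNorm w⁻¹ g) * √(sqNorm w f) ≤ k * √(sqNorm w f) * √(sqNorm w f) := by gcongr
    _ = k * sqNorm w f := by rw [mul_assoc, Real.mul_self_sqrt hX]

/-! ### Martingale approximation of weighted integrals -/

/-- The integral of the square of the average, against the weight. -/
def energy (f w : (Fin n → ℝ) → ℝ) (Q : D.cubes) : ℝ := avg f Q.1.toSet ^ 2 * mass w Q

/-- The sum of the energies of the descendants of a given generation. -/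
def leafEnergy (f w : (Fin n → ℝ) → ℝ) : ℕ → D.cubes → ℝ
  | 0, Q => energy f w Q
  | N + 1, Q => ∑ s, leafEnergy f w N (child Q s)

theorem leafEnergy_eq {f : (Fin n → ℝ) → ℝ} (hwi : ∀ Q : D.cubes, IntegrableOn w Q.1.toSet)
    (N : ℕ) (Q : D.cubes) :
    IntegrableOn (fun x => avg f (cubeAt D (Q.1.gen - N) x).1.toSet ^ 2 * w x) Q.1.toSet ∧
    ∫ x in Q.1.toSet, avg f (cubeAt D (Q.1.gen - N) x).1.toSet ^ 2 * w x = leafEnergy f w N Q := by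
  induction N generalizing Q with
  | zero =>
    have h : ∀ x ∈ Q.1.toSet, avg f Q.1.toSet ^ 2 * w x =
        avg f (cubeAt D (Q.1.gen - (0 : ℕ)) x).1.toSet ^ 2 * w x := fun x hx => by
      rw [cubeAt_eq (Q := Q) (by simp) hx]
    refine ⟨IntegrableOn.congr_fun ((hwi Q).const_mul _) h Q.1.measurableSet, ?_⟩
    rw [← setIntegral_congr_fun Q.1.measurableSet h, integral_const_mul]; rfl
  | succ N ih =>
    have hg : ∀ s, (child Q s).1.gen - (N : ℤ) = Q.1.gen - (N + 1 : ℕ) := fun s => by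
      have : (child Q s).1.gen = Q.1.gen - 1 := rfl
      rw [this]; push_cast; ring
    have hi : IntegrableOn (fun x => avg f (cubeAt D (Q.1.gen - (N + 1 : ℕ)) x).1.toSet ^ 2 * w x)
        Q.1.toSet := by
      rw [← Q.1.iUnion_child, integrableOn_finite_iUnion]
      intro s
      have := (ih (child Q s)).1
      rwa [hg] at this
    refine ⟨hi, ?_⟩
    rw [Q.1.setIntegral_eq_sum_child hi, leafEnergy]
    refine Finset.sum_congr rfl fun s _ => ?_
    rw [← (ih (child Q s)).2, hg]
    rfl

theorem abs_avg_le {f : (Fin n → ℝ) → ℝ} {C : ℝ} (hC : ∀ x, |f x| ≤ C) (Q : D.cubes) :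
    |avg f Q.1.toSet| ≤ C := by
  rw [avg_eq, abs_div, abs_of_pos Q.1.vol_pos, div_le_iff₀ Q.1.vol_pos]
  have := norm_setIntegral_le_of_norm_le_const (μ := volume) (s := Q.1.toSet) (f := f) (C := C)
    (by rw [Q.1.volume_toSet]; exact ENNReal.ofReal_lt_top) fun x _ => hC x
  rwa [Q.1.volume_real] at this

theorem tendsto_leafEnergy {f : (Fin n → ℝ) → ℝ}
    (hwi : ∀ Q : D.cubes, IntegrableOn w Q.1.toSet) {C : ℝ} (hC : ∀ x, |f x| ≤ C)
    (Q : D.cubes) (hf : IntegrableOn f Q.1.toSet) :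
    Tendsto (fun N => leafEnergy f w N Q) atTop (𝓝 (mass (fun x => f x ^ 2 * w x) Q)) := by
  simp only [← (leafEnergy_eq (f := f) hwi _ Q).2]
  refine tendsto_integral_of_dominated_convergence (fun x => C ^ 2 * |w x|)
    (fun N => (leafEnergy_eq (f := f) hwi N Q).1.aestronglyMeasurable)
    ((hwi Q).abs.const_mul _) (fun N => ae_of_all _ fun x => ?_) ?_
  · rw [Real.norm_eq_abs, abs_mul, abs_pow]
    exact mul_le_mul_of_nonneg_right
      (pow_le_pow_left₀ (abs_nonneg _) (abs_avg_le hC _) 2) (abs_nonneg _)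
  · rw [ae_restrict_iff' Q.1.measurableSet]
    filter_upwards [ae_tendsto_avg Q hf] with x hx hxQ
    exact ((hx hxQ).pow 2).mul_const _

end General

/-! ### Square functions on the line. -/

section Line

variable {D : DyadicGrid 1} {w : (Fin 1 → ℝ) → ℝ}

theorem sum_line (F : (Fin 1 → Bool) → ℝ) : ∑ s, F s = F (fun _ => false) + F fun _ => true := by
  rw [← Fintype.sum_equiv (Equiv.funUnique (Fin 1) Bool).symm
    (fun b => F fun _ => b) F (fun b => by congr 1), Fintype.sum_bool, add_comm]

/-- On each child the average of `f` is `⟨f⟩_Q` plus the martingale difference. Expanding the square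
against `w` leaves only these terms because `h²` is constant on `Q`; in higher dimensions products
of different Haar functions would remain. -/
theorem sum_energy_child {f : (Fin 1 → ℝ) → ℝ}
    (hf : ∀ Q : D.cubes, IntegrableOn f Q.1.toSet)
    (hwi : ∀ Q : D.cubes, IntegrableOn w Q.1.toSet) (Q : D.cubes) :
    ∑ s, energy f w (child Q s) = energy f w Q +
      (∑ e, haarCoeff f Q.1 e ^ 2 * (mass w Q / vol Q) +
        2 * ∑ e, haarCoeff w Q.1 e * avg f Q.1.toSet * haarCoeff f Q.1 e) := by
  have e1 : ∀ e, haarCoeff w Q.1 e * avg f Q.1.toSet * haarCoeff f Q.1 e =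
      avg f Q.1.toSet * (haarCoeff w Q.1 e * haarCoeff f Q.1 e) := fun e => by ring
  simp only [e1]
  rw [← Finset.sum_mul, ← Finset.mul_sum, sum_haarCoeff_sq hf,
    sum_haarCoeff_mul_haarCoeff (hwi Q) (hf Q)]
  simp only [← coe_child, energy, sqDiff, avg_eq_mass]
  have hint : ∀ s, ∫ x in (child Q s).1.toSet, f x = mass f (child Q s) := fun s => rfl
  simp only [hint]
  rw [isAdditive_mass hf Q, isAdditive_mass hwi Q]
  simp only [sum_line, vol_child]
  have := (vol_pos Q).ne'
  field_simp
  ring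

theorem sum_tree_line {f : (Fin 1 → ℝ) → ℝ} (hf : ∀ Q : D.cubes, IntegrableOn f Q.1.toSet)
    (hwi : ∀ Q : D.cubes, IntegrableOn w Q.1.toSet) (N : ℕ) (R : D.cubes) :
    ∑ Q ∈ tree N R, (∑ e, haarCoeff f Q.1 e ^ 2 * (mass w Q / vol Q) +
        2 * ∑ e, haarCoeff w Q.1 e * avg f Q.1.toSet * haarCoeff f Q.1 e) =
      leafEnergy f w N R - energy f w R := by
  induction N generalizing R with
  | zero => simp [tree, leafEnergy]
  | succ N ih =>
    rw [sum_tree_succ]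
    simp only [ih, Finset.sum_sub_distrib]
    rw [sum_energy_child hf hwi, leafEnergy]
    ring

/-- The energy identity telescopes over trees. The cross terms converge to `2 ∫ g f`, and
boundedness of `f` lets the leaf energies converge to `∫ f² w` by dominated convergence. -/
theorem sum_sq_le_of_bounded (h : MemA2 D w) {f g : (Fin 1 → ℝ) → ℝ}
    (hf : MemLp f 2 (weightMeasure w)) {C : ℝ} (hC : ∀ x, |f x| ≤ C)
    (hg : IsParaproduct D w⁻¹ w f g) {k : ℝ} (hk : 0 ≤ k)
    (hgk : eLpNorm g 2 (weightMeasure w⁻¹) ≤ ENNReal.ofReal k * eLpNorm f 2 (weightMeasure w))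
    (F : Finset D.cubes) :
    ∑ Q ∈ F, ∑ e, haarCoeff f Q.1 e ^ 2 * (mass w Q / vol Q) ≤ (1 + 2 * k) * sqNorm w f := by
  classical
  have hm := h.1.aemeasurable
  have hw := h.1.2
  have hwi := integrableOn_weight h
  have hfi : ∀ Q : D.cubes, IntegrableOn f Q.1.toSet :=
    fun Q => integrableOn_of_memLp hm hw hf (integrableOn_inv h Q)
  have hf2 := integrable_sq_mul hm hw hf
  have hsum := hasSum_pairing h hg hf
  have hL := abs_integral_le_of_paraproduct h hf hg.1 hk hgk
  set L := ∫ x, g x * f x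
  refine le_of_forall_pos_le_add fun ε hε => ?_
  rw [HasSum, SummationFilter.unconditional_filter, Metric.tendsto_atTop] at hsum
  obtain ⟨F₀, hF₀⟩ := hsum (ε / 2) (by positivity)
  -- The trees must contain `F₀` so that their cross terms are within `ε / 2` of the limit, and `F`
  -- so that the squares are counted.
  obtain ⟨k₀, N, T, hT, hcov⟩ := exists_cover (F ∪ F₀.image Prod.fst)
  set q : D.cubes → ℝ := fun Q => ∑ e, haarCoeff f Q.1 e ^ 2 * (mass w Q / vol Q) with hq
  set a : D.cubes → ℝ := fun Q => ∑ e, haarCoeff w Q.1 e * avg f Q.1.toSet * haarCoeff f Q.1 e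
    with ha
  have hq0 : ∀ Q, 0 ≤ q Q := fun Q => Finset.sum_nonneg fun e _ =>
    mul_nonneg (sq_nonneg _) (div_nonneg (mass_pos (hwi Q) hw).le (vol_pos Q).le)
  have hbound : ∀ M ≥ N, ∑ Q ∈ F, q Q ≤ ∑ R ∈ T, leafEnergy f w M R - 2 * L + ε := by
    intro M hM
    have hcov' : ∀ P ∈ F ∪ F₀.image Prod.fst, ∃ R ∈ T, P ∈ tree M R := fun P hP => by
      obtain ⟨R, hR, hPR⟩ := hcov P hP
      have := mem_tree.1 hPR
      exact ⟨R, hR, mem_tree.2 ⟨this.1, by omega⟩⟩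
    have h1 : ∑ Q ∈ F, q Q ≤ ∑ R ∈ T, ∑ P ∈ tree M R, q P :=
      sum_subset_trees hq0 hT fun P hP => hcov' P (Finset.mem_union_left _ hP)
    have h2 : L - ε / 2 ≤ ∑ R ∈ T, ∑ P ∈ tree M R, a P := by
      rw [← Finset.sum_biUnion (pairwiseDisjoint_tree hT M)]
      have := hF₀ ((T.biUnion fun R => tree M R) ×ˢ Finset.univ) fun i hi => by
        refine Finset.mem_product.2 ⟨Finset.mem_biUnion.2 (hcov' i.1 ?_), Finset.mem_univ _⟩
        exact Finset.mem_union_right _ (Finset.mem_image_of_mem _ hi)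
      rw [Finset.sum_product, Real.dist_eq] at this
      linarith [(abs_lt.1 this).1]
    have h3 : ∑ R ∈ T, ∑ P ∈ tree M R, q P + 2 * ∑ R ∈ T, ∑ P ∈ tree M R, a P =
        ∑ R ∈ T, (leafEnergy f w M R - energy f w R) := by
      rw [Finset.mul_sum, ← Finset.sum_add_distrib]
      refine Finset.sum_congr rfl fun R _ => ?_
      rw [← sum_tree_line hfi hwi, Finset.mul_sum, ← Finset.sum_add_distrib]
    have h4 : ∑ R ∈ T, (leafEnergy f w M R - energy f w R) ≤ ∑ R ∈ T, leafEnergy f w M R :=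
      Finset.sum_le_sum fun R _ => sub_le_self _
        (mul_nonneg (sq_nonneg _) (mass_pos (hwi R) hw).le)
    linarith
  have hlim : Tendsto (fun M => ∑ R ∈ T, leafEnergy f w M R - 2 * L + ε) atTop
      (𝓝 (∑ R ∈ T, mass (fun x => f x ^ 2 * w x) R - 2 * L + ε)) :=
    ((tendsto_finsetSum T fun R _ => tendsto_leafEnergy hwi hC R (hfi R)).sub_const _).add_const _
  have h5 := ge_of_tendsto hlim ((eventually_ge_atTop N).mono hbound)
  have h6 := sum_mass_le hf2 (hw.mono fun x hx => mul_nonneg (sq_nonneg _) hx.le) hT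
  have h7 := (abs_le.1 hL).1
  have h8 : sqNorm w f = ∫ x, f x ^ 2 * w x := rfl
  linarith

theorem sum_sq_le (h : MemA2 D w) {f : (Fin 1 → ℝ) → ℝ} (hf : MemLp f 2 (weightMeasure w))
    (F : Finset D.cubes) :
    ∑ Q ∈ F, ∑ e, haarCoeff f Q.1 e ^ 2 * (mass w Q / vol Q) ≤
      (1 + 2 * (paraNorm D w w w⁻¹).toReal) * sqNorm w f := by
  have hm := h.1.aemeasurable
  have hw := h.1.2
  have hwi := integrableOn_weight h
  have hf2 := integrable_sq_mul hm hw hf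
  have hX := sqNorm_nonneg hw f
  set p := (paraNorm D w w w⁻¹).toReal with hp
  have hp0 : 0 ≤ p := ENNReal.toReal_nonneg
  have hfi : ∀ {u : (Fin 1 → ℝ) → ℝ}, MemLp u 2 (weightMeasure w) →
      ∀ Q : D.cubes, IntegrableOn u Q.1.toSet :=
    fun hu Q => integrableOn_of_memLp hm hw hu (integrableOn_inv h Q)
  have hlimk : Tendsto (fun k : ℝ => (1 + 2 * k) * sqNorm w f) (𝓝[>] p)
      (𝓝 ((1 + 2 * p) * sqNorm w f)) := by
    have : Continuous fun k : ℝ => (1 + 2 * k) * sqNorm w f := by fun_prop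
    exact (this.tendsto p).mono_left nhdsWithin_le_nhds
  refine ge_of_tendsto hlimk (eventually_mem_nhdsWithin.mono fun k hk => ?_)
  have hk0 : 0 ≤ k := hp0.trans (le_of_lt hk)
  have hklt : paraNorm D w w w⁻¹ < ENNReal.ofReal k := by
    rw [← ENNReal.ofReal_toReal (paraNorm_self_ne_top h)]
    exact (ENNReal.ofReal_lt_ofReal_iff (hp0.trans_lt hk)).2 hk
  -- Truncation reduces to bounded functions: norms do not grow, and the finitely many coefficients
  -- involved converge.
  set fj : ℕ → (Fin 1 → ℝ) → ℝ := fun j x => max (min (f x) j) (-j) with hfj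
  have hle : ∀ j x, |fj j x| ≤ |f x| := fun j x => by
    have hj : (0 : ℝ) ≤ j := Nat.cast_nonneg j
    simp only [hfj]
    rcases max_cases (min (f x) (j : ℝ)) (-j) with h1 | h1 <;>
      rcases min_cases (f x) (j : ℝ) with h2 | h2 <;> rcases abs_cases (f x) with h3 | h3 <;>
      rw [abs_le] <;> constructor <;> linarith [h1.1, h1.2, h2.1, h2.2, h3.1, h3.2]
  have hlej : ∀ j x, |fj j x| ≤ j := fun j x => by
    have hj : (0 : ℝ) ≤ j := Nat.cast_nonneg j
    rw [abs_le]
    exact ⟨le_max_right _ _, max_le (min_le_right _ _) (by linarith)⟩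
  have hmem : ∀ j, MemLp (fj j) 2 (weightMeasure w) := fun j =>
    hf.mono ((hf.1.inf aestronglyMeasurable_const).sup aestronglyMeasurable_const)
      (ae_of_all _ fun x => hle j x)
  have hsq : ∀ j, sqNorm w (fj j) ≤ sqNorm w f := fun j =>
    integral_mono_ae (integrable_sq_mul hm hw (hmem j)) hf2 (hw.mono fun x hx =>
      mul_le_mul_of_nonneg_right (sq_le_sq.2 (hle j x)) hx.le)
  have hlim : ∀ Q : D.cubes, Tendsto (fun j => mass (fj j) Q) atTop (𝓝 (mass f Q)) := fun Q => by
    refine tendsto_integral_of_dominated_convergence (fun x => |f x|)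
      (fun j => (hfi (hmem j) Q).aestronglyMeasurable) (hfi hf Q).abs
      (fun j => ae_of_all _ fun x => hle j x) (ae_of_all _ fun x => ?_)
    obtain ⟨m, hm⟩ := exists_nat_ge |f x|
    refine tendsto_const_nhds.congr' ((eventually_ge_atTop m).mono fun j hj => ?_)
    have h1 : |f x| ≤ j := hm.trans (Nat.cast_le.2 hj)
    simp only [hfj]
    rw [min_eq_left (abs_le.1 h1).2, max_eq_left (abs_le.1 h1).1]
  have hexp : ∀ {u : (Fin 1 → ℝ) → ℝ}, MemLp u 2 (weightMeasure w) → ∀ Q : D.cubes,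
      ∑ e, haarCoeff u Q.1 e ^ 2 * (mass w Q / vol Q) = sqDiff (mass u) Q * (mass w Q / vol Q) :=
    fun hu Q => by rw [← Finset.sum_mul, sum_haarCoeff_sq (hfi hu)]
  simp only [hexp hf]
  have hlimF : Tendsto (fun j => ∑ Q ∈ F, sqDiff (mass (fj j)) Q * (mass w Q / vol Q)) atTop
      (𝓝 (∑ Q ∈ F, sqDiff (mass f) Q * (mass w Q / vol Q))) := by
    refine tendsto_finsetSum F fun Q _ => Tendsto.mul_const _ ?_
    exact (tendsto_finsetSum _ fun s _ => ((hlim _).pow 2).div_const _).sub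
      (((hlim Q).pow 2).div_const _)
  refine le_of_tendsto hlimF (Eventually.of_forall fun j => ?_)
  obtain ⟨g, hg, hgk⟩ := exists_of_paraNorm_lt hklt (hmem j)
  have := sum_sq_le_of_bounded h (hmem j) (hlej j) hg hk0 hgk F
  simp only [hexp (hmem j)] at this
  refine this.trans ?_
  have := hsq j
  gcongr

theorem eLpNorm_squareFunction_sq_le (h : MemA2 D w) {f : (Fin 1 → ℝ) → ℝ}
    (hf : MemLp f 2 (weightMeasure w)) :
    eLpNorm (squareFunction D f) 2 (weightMeasure w) ^ 2 ≤
      (1 + 2 * paraNorm D w w w⁻¹) * eLpNorm f 2 (weightMeasure w) ^ 2 := by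
  classical
  have hm := h.1.aemeasurable
  have hw := h.1.2
  have hwi := integrableOn_weight h
  have hP : 1 + 2 * paraNorm D w w w⁻¹ =
      ENNReal.ofReal (1 + 2 * (paraNorm D w w w⁻¹).toReal) := by
    rw [ENNReal.ofReal_add zero_le_one (by positivity), ENNReal.ofReal_mul (by norm_num),
      ENNReal.ofReal_toReal (paraNorm_self_ne_top h)]
    simp
  rw [eLpNorm_squareFunction_sq hw hwi, eLpNorm_sq_eq hm hw hf, hP,
    ← ENNReal.ofReal_mul (by positivity), ENNReal.tsum_eq_iSup_sum]
  have hpos : ∀ i : HaarIndex D, 0 ≤ haarCoeff f i.1 i.2 ^ 2 * (mass w i.1 / vol i.1) := fun i =>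
    mul_nonneg (sq_nonneg _) (div_nonneg (mass_pos (hwi i.1) hw).le (vol_pos i.1).le)
  refine iSup_le fun F => ?_
  rw [← ENNReal.ofReal_sum_of_nonneg fun i _ => hpos i]
  refine ENNReal.ofReal_le_ofReal (le_trans ?_ (sum_sq_le h hf (F.image Prod.fst)))
  rw [← Finset.sum_product (s := F.image Prod.fst) (t := Finset.univ)
    (f := fun i => haarCoeff f i.1.1 i.2 ^ 2 * (mass w i.1 / vol i.1))]
  exact Finset.sum_le_sum_of_subset_of_nonneg (fun i hi =>
    Finset.mem_product.2 ⟨Finset.mem_image_of_mem _ hi, Finset.mem_univ _⟩) fun i _ _ => hpos i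

theorem squareNorm_sq_le (h : MemA2 D w) :
    squareNorm D w ^ 2 ≤ 1 + 2 * paraNorm D w w w⁻¹ := by
  set K : ℝ≥0∞ := (1 + 2 * paraNorm D w w w⁻¹) ^ (1 / 2 : ℝ) with hK
  have hK2 : K ^ 2 = 1 + 2 * paraNorm D w w w⁻¹ := by
    rw [hK, ← ENNReal.rpow_ofNat, ← ENNReal.rpow_mul]; norm_num
  rw [← hK2]
  refine pow_le_pow_left' (sInf_le fun f hf => ?_) 2
  have := eLpNorm_squareFunction_sq_le h hf
  rw [← hK2, ← mul_pow] at this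
  exact (ENNReal.pow_right_strictMono two_ne_zero).le_iff_le.1 this

theorem squareNorm_sq_le_iSup (h : MemA2 D w) :
    squareNorm D w ^ 2 ≤ 6 * ⨆ (b : (Fin 1 → ℝ) → ℝ)
      (_ : MemBMO D w b ∧ bmoNorm D.sets w b ≠ 0), paraNorm D b w w⁻¹ / bmoNorm D.sets w b := by
  set M := ⨆ (b : (Fin 1 → ℝ) → ℝ) (_ : MemBMO D w b ∧ bmoNorm D.sets w b ≠ 0),
    paraNorm D b w w⁻¹ / bmoNorm D.sets w b with hM
  have hle : ∀ b, MemBMO D w b → bmoNorm D.sets w b ≠ 0 →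
      paraNorm D b w w⁻¹ / bmoNorm D.sets w b ≤ M := fun b h1 h2 =>
    le_iSup₂ (f := fun (b : (Fin 1 → ℝ) → ℝ) (_ : MemBMO D w b ∧ bmoNorm D.sets w b ≠ 0) =>
      paraNorm D b w w⁻¹ / bmoNorm D.sets w b) b ⟨h1, h2⟩
  have h1 : 1 ≤ 2 * M := by
    obtain ⟨b, hb, hb0, hb2⟩ := exists_bmo_test h
    refine le_trans ?_ (mul_le_mul_right (hle b hb hb0) 2)
    rw [← mul_div_assoc, ENNReal.le_div_iff_mul_le (Or.inl hb0) (Or.inl hb.2.ne), one_mul]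
    exact hb2
  have h2 : paraNorm D w w w⁻¹ ≤ 2 * M := by
    have hmem := memBMO_self D h.1
    -- In this case `w` does not take part in the supremum, but the upper bound already gives `‖Π_w‖
    -- = 0`.
    by_cases h0 : bmoNorm D.sets w w = 0
    · have := paraNorm_le h hmem
      rw [h0, mul_zero, zero_mul] at this
      exact this.trans zero_le
    · have h3 := hle w hmem h0
      rw [ENNReal.div_le_iff h0 hmem.2.ne] at h3
      refine h3.trans ?_
      rw [mul_comm]
      exact mul_le_mul_left (bmoNorm_grid_self_le D h.1) M
  calc squareNorm D w ^ 2 ≤ 1 + 2 * paraNorm D w w w⁻¹ := squareNorm_sq_le h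
    _ ≤ 2 * M + 2 * (2 * M) := by gcongr
    _ = 6 * M := by ring

theorem squareNorm_le (h : MemA2 D w) :
    squareNorm D w ≤ ENNReal.ofReal 240 * a2Char D w := by
  set A := (a2Char D w).toReal with hA
  have hA1 := one_le_a2Char h
  have h1 : squareNorm D w ^ 2 ≤ (ENNReal.ofReal 240 * a2Char D w) ^ 2 := by
    have h2 : paraNorm D w w w⁻¹ ≤ ENNReal.ofReal (27648 * A ^ 2) := by
      refine (paraNorm_le h (memBMO_self D h.1)).trans ?_
      calc ENNReal.ofReal (3456 * (2 ^ 1) ^ 2) * bmoNorm D.sets w w * a2Char D w ^ 2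
          ≤ ENNReal.ofReal (3456 * (2 ^ 1) ^ 2) * ENNReal.ofReal 2 * ENNReal.ofReal A ^ 2 := by
            have h3 : bmoNorm D.sets w w ≤ ENNReal.ofReal 2 := by
              simpa using bmoNorm_grid_self_le D h.1
            rw [hA, ENNReal.ofReal_toReal h.2.ne]
            gcongr
        _ = ENNReal.ofReal (27648 * A ^ 2) := by
            rw [← ENNReal.ofReal_pow (by positivity), ← ENNReal.ofReal_mul (by positivity),
              ← ENNReal.ofReal_mul (by positivity)]
            congr 1; ring
    refine (squareNorm_sq_le h).trans ?_
    calc 1 + 2 * paraNorm D w w w⁻¹ ≤ ENNReal.ofReal 1 + ENNReal.ofReal 2 *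
          ENNReal.ofReal (27648 * A ^ 2) := by
          rw [ENNReal.ofReal_one, ENNReal.ofReal_ofNat]; gcongr
      _ = ENNReal.ofReal (1 + 2 * (27648 * A ^ 2)) := by
          rw [← ENNReal.ofReal_mul (by norm_num), ← ENNReal.ofReal_add (by norm_num)
            (by positivity)]
      -- `240² = 57600` exceeds `1 + 2 · 27648 = 55297`, and `A ≥ 1` absorbs the constant term.
      _ ≤ ENNReal.ofReal ((240 * A) ^ 2) := ENNReal.ofReal_le_ofReal (by nlinarith)
      _ = _ := by
          rw [← ENNReal.ofReal_toReal h.2.ne, ← ENNReal.ofReal_mul (by norm_num),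
            ENNReal.ofReal_pow (by positivity)]
  exact (ENNReal.pow_right_strictMono two_ne_zero).le_iff_le.1 h1

end Line

end DyadicGrid

end

section

variable {n : ℕ}

/-! ### Weights which are powers along a chain of cubes -/

/-- The ratio of the volumes of a child and of its parent. -/
def childRatio (n : ℕ) : ℝ := ((2 : ℝ) ^ n)⁻¹

theorem childRatio_pos (n : ℕ) : 0 < childRatio n := by unfold childRatio; positivity

theorem childRatio_lt_one (n : ℕ) [NeZero n] : childRatio n < 1 :=
  inv_lt_one_of_one_lt₀ (one_lt_pow₀ (by norm_num) (NeZero.ne n))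

/-- The average of a function with values `s ^ k` on the layers of a chain. -/
def layerMean (n : ℕ) (s : ℝ) : ℝ := (1 - childRatio n) / (1 - s * childRatio n)

namespace DyadicGrid

variable [NeZero n] {D : DyadicGrid n}

/-- The chain of lower corner descendants of a cube. -/
def chain (Q₀ : D.cubes) : ℕ → D.cubes
  | 0 => Q₀
  | k + 1 => child (chain Q₀ k) fun _ => false

variable {Q₀ : D.cubes}

theorem vol_chain (k : ℕ) : vol (chain Q₀ k) = childRatio n ^ k * vol Q₀ := by
  induction k with
  | zero => simp [chain]
  | succ k ih => rw [chain, vol_child, ih, pow_succ, childRatio, div_eq_mul_inv]; ring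

theorem gen_chain (k : ℕ) : (chain Q₀ k).1.gen = Q₀.1.gen - k := by
  induction k with
  | zero => simp [chain]
  | succ k ih =>
    have : (chain Q₀ (k + 1)).1.gen = (chain Q₀ k).1.gen - 1 := rfl
    rw [this, ih]; push_cast; ring

theorem chain_injective : Function.Injective (chain Q₀) := fun j k h => by
  have h1 := gen_chain (Q₀ := Q₀) j
  rw [h, gen_chain] at h1
  omega

theorem corner_chain (k : ℕ) : (chain Q₀ k).1.corner = Q₀.1.corner := by
  induction k with
  | zero => rfl
  | succ k ih =>
    rw [← ih]; ext i
    simp [chain, coe_child, DyadicCube.child]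

theorem chain_antitone : Antitone fun k => (chain Q₀ k).1.toSet :=
  antitone_nat_of_succ_le fun k => (chain Q₀ k).1.child_subset _

/-- The part of a cube of the chain outside the next cube. -/
def layer (Q₀ : D.cubes) (k : ℕ) : Set (Fin n → ℝ) :=
  (chain Q₀ k).1.toSet \ (chain Q₀ (k + 1)).1.toSet

theorem measurableSet_layer (k : ℕ) : MeasurableSet (layer Q₀ k) :=
  (chain Q₀ k).1.measurableSet.diff (chain Q₀ (k + 1)).1.measurableSet

theorem pairwise_disjoint_layer : Pairwise (Function.onFun Disjoint (layer Q₀)) := by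
  have key : ∀ j k, j < k → Disjoint (layer Q₀ j) (layer Q₀ k) := fun j k hjk =>
    Set.disjoint_left.2 fun x hj hk => hj.2 (chain_antitone (Nat.succ_le_of_lt hjk) hk.1)
  intro j k hjk
  rcases lt_or_gt_of_ne hjk with h | h
  · exact key j k h
  · exact (key k j h).symm

theorem volume_real_layer (k : ℕ) :
    volume.real (layer Q₀ k) = childRatio n ^ k * (1 - childRatio n) * vol Q₀ := by
  have hfin : volume (chain Q₀ k).1.toSet ≠ ⊤ := by
    rw [(chain Q₀ k).1.volume_toSet]; exact ENNReal.ofReal_ne_top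
  rw [layer, measureReal_sdiff (chain_antitone (Nat.le_succ k))
    (chain Q₀ (k + 1)).1.measurableSet hfin, DyadicCube.volume_real, DyadicCube.volume_real]
  have h1 := vol_chain (Q₀ := Q₀) k
  have h2 := vol_chain (Q₀ := Q₀) (k + 1)
  rw [vol] at h1 h2
  rw [h1, h2, pow_succ]; ring

/-- Only the common corner, to which the chain shrinks, lies in no layer. -/
theorem iUnion_layer (k : ℕ) : ⋃ j, layer Q₀ (k + j) =ᵐ[volume] (chain Q₀ k).1.toSet := by
  have h0 : ∀ᵐ x, x ≠ Q₀.1.corner := by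
    rw [ae_iff]; simp [measure_singleton]
  filter_upwards [h0] with x hx
  refine propext ⟨fun h => ?_, fun h => ?_⟩
  · obtain ⟨j, hj⟩ := Set.mem_iUnion.1 h
    exact chain_antitone (Nat.le_add_right k j) hj.1
  · by_contra hc
    have hall : ∀ j, x ∈ (chain Q₀ (k + j)).1.toSet := fun j => by
      induction j with
      | zero => exact h
      | succ j ih =>
        by_contra hj
        exact hc (Set.mem_iUnion.2 ⟨j, ih, hj⟩)
    refine hx (funext fun i => le_antisymm (le_of_forall_pos_lt_add fun ε hε => ?_) ?_)
    · obtain ⟨j, hj⟩ := exists_pow_lt_of_lt_one (div_pos hε Q₀.1.side_pos)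
        (show (1 / 2 : ℝ) < 1 by norm_num)
      have h1 := (hall j i).2
      rw [corner_chain] at h1
      have h2 : (chain Q₀ (k + j)).1.side ≤ Q₀.1.side * (1 / 2) ^ j := by
        rw [DyadicCube.side, gen_chain, zpow_sub₀ (by norm_num), DyadicCube.side, zpow_natCast,
          div_eq_mul_inv]
        refine mul_le_mul_of_nonneg_left ?_ (by positivity)
        rw [one_div, inv_pow]
        exact inv_anti₀ (by positivity) (pow_le_pow_right₀ (by norm_num) (by omega))
      rw [lt_div_iff₀ Q₀.1.side_pos] at hj
      linarith
    · have h1 := (hall 0 i).1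
      rwa [corner_chain] at h1

/-- Integrals of functions which are powers on the layers of a chain. -/
theorem integrableOn_chain {f : (Fin n → ℝ) → ℝ} {s : ℝ} (hs : 0 < s)
    (hs1 : s * childRatio n < 1) (hf : ∀ j, ∀ x ∈ layer Q₀ j, f x = s ^ j) (k : ℕ) :
    IntegrableOn f (chain Q₀ k).1.toSet ∧
    mass f (chain Q₀ k) = s ^ k * layerMean n s * vol (chain Q₀ k) := by
  have ha := childRatio_pos n
  have hfin : ∀ j, volume (layer Q₀ j) ≠ ⊤ := fun j => ne_top_of_le_ne_top
    (by rw [(chain Q₀ j).1.volume_toSet]; exact ENNReal.ofReal_ne_top)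
    (measure_mono (Set.sdiff_subset (s := (chain Q₀ j).1.toSet)))
  have hint : ∀ j, ∫ x in layer Q₀ j, f x =
      (s * childRatio n) ^ j * ((1 - childRatio n) * vol Q₀) := fun j => by
    rw [setIntegral_congr_fun (measurableSet_layer j) (hf j), setIntegral_const,
      volume_real_layer, smul_eq_mul, mul_pow]
    ring
  have hnorm : ∀ j, ∫ x in layer Q₀ j, ‖f x‖ = ∫ x in layer Q₀ j, f x := fun j =>
    setIntegral_congr_fun (measurableSet_layer j) fun x hx => by
      simp only [hf j x hx]; exact Real.norm_of_nonneg (by positivity)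
  have hfj : ∀ j, IntegrableOn f (layer Q₀ j) := fun j =>
    IntegrableOn.congr_fun (integrableOn_const (C := s ^ j) (hfin j))
      (fun x hx => (hf j x hx).symm) (measurableSet_layer j)
  have hgeo : HasSum (fun j => ∫ x in layer Q₀ (k + j), f x)
      (s ^ k * layerMean n s * vol (chain Q₀ k)) := by
    simp only [hint, pow_add]
    have h1 := (hasSum_geometric_of_lt_one (by positivity) hs1).mul_left
      ((s * childRatio n) ^ k * ((1 - childRatio n) * vol Q₀))
    have e : s ^ k * layerMean n s * vol (chain Q₀ k) = (s * childRatio n) ^ k *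
        ((1 - childRatio n) * vol Q₀) * (1 - s * childRatio n)⁻¹ := by
      rw [vol_chain, layerMean, mul_pow]; ring
    rw [e]
    exact h1.congr_fun fun j => by ring
  have hU : IntegrableOn f (⋃ j, layer Q₀ (k + j)) := by
    refine integrableOn_iUnion_of_summable_integral_norm (fun j => hfj _) ?_
    simp only [hnorm]
    exact hgeo.summable
  have hd : Pairwise (Function.onFun Disjoint fun j => layer Q₀ (k + j)) :=
    fun i j hij => pairwise_disjoint_layer (by simpa using hij)
  refine ⟨hU.congr_set_ae (iUnion_layer k).symm, ?_⟩
  rw [mass, ← setIntegral_congr_set (iUnion_layer k)]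
  exact (hasSum_integral_iUnion (fun j => measurableSet_layer _) hd hU).unique hgeo

/-- In the first and last cases a chain weight is constant on `Q`; in the other two its averages are
explicit. -/
theorem cube_cases (Q₀ Q : D.cubes) : Disjoint Q.1.toSet Q₀.1.toSet ∨
    (Q₀.1.toSet ⊆ Q.1.toSet ∧ Q₀ ≠ Q) ∨ (∃ k, Q = chain Q₀ k) ∨ ∃ k, Q.1.toSet ⊆ layer Q₀ k := by
  rcases lt_or_ge Q₀.1.gen Q.1.gen with hg | hg
  · rcases subset_or_disjoint hg.le with h | h
    · exact Or.inr (Or.inl ⟨h, fun h' => by rw [h'] at hg; exact lt_irrefl _ hg⟩)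
    · exact Or.inl h.symm
  · rcases subset_or_disjoint hg with h | h
    · refine Or.inr (Or.inr ?_)
      have key : ∀ j, Q.1.toSet ⊆ (chain Q₀ j).1.toSet ∨
          ((∃ k, Q = chain Q₀ k) ∨ ∃ k, Q.1.toSet ⊆ layer Q₀ k) := fun j => by
        induction j with
        | zero => exact Or.inl h
        | succ j ih =>
          rcases ih with ih | ih
          · by_cases hj : Q = chain Q₀ j
            · exact Or.inr (Or.inl ⟨j, hj⟩)
            · obtain ⟨s, hs⟩ := subset_child ih hj
              by_cases hs0 : s = fun _ => false
              · rw [hs0] at hs; exact Or.inl hs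
              · refine Or.inr (Or.inr ⟨j, fun x hx => ⟨ih hx, ?_⟩⟩)
                exact Set.disjoint_left.1 ((chain Q₀ j).1.disjoint_child hs0) (hs hx)
          · exact Or.inr ih
      rcases key ((Q₀.1.gen - Q.1.gen).toNat + 1) with h1 | h1
      · have := gen_le_of_subset h1
        rw [gen_chain] at this
        push_cast at this
        omega
      · exact h1
    · exact Or.inl h

open Classical in
/-- The function with values `s ^ k` on the layers of the chain of `Q₀` and `c` outside `Q₀`. -/
def profile (Q₀ : D.cubes) (s c : ℝ) (x : Fin n → ℝ) : ℝ :=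
  if x ∈ Q₀.1.toSet then s ^ sInf {k : ℕ | x ∉ (chain Q₀ (k + 1)).1.toSet} else c

theorem profile_of_mem_layer (s c : ℝ) {k : ℕ} {x : Fin n → ℝ} (hx : x ∈ layer Q₀ k) :
    profile Q₀ s c x = s ^ k := by
  have h0 : x ∈ Q₀.1.toSet := chain_antitone (Nat.zero_le k) hx.1
  rw [profile, if_pos h0]
  congr 1
  refine le_antisymm (Nat.sInf_le hx.2) (le_csInf ⟨k, hx.2⟩ fun j hj => ?_)
  by_contra! hlt
  exact hj (chain_antitone (Nat.succ_le_of_lt hlt) hx.1)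

theorem profile_of_notMem (s c : ℝ) {x : Fin n → ℝ} (hx : x ∉ Q₀.1.toSet) :
    profile Q₀ s c x = c := if_neg hx

/-- Valid at every point: at the corner the index set is empty and `sInf ∅ = 0` gives the value `1`.
-/
theorem profile_pos {s c : ℝ} (hs : 0 < s) (hc : 0 < c) (x : Fin n → ℝ) : 0 < profile Q₀ s c x := by
  rw [profile]; split_ifs <;> positivity

theorem profile_inv (s c : ℝ) : (profile Q₀ s c)⁻¹ = profile Q₀ s⁻¹ c⁻¹ := by
  ext x
  rw [Pi.inv_apply, profile, profile]
  split_ifs <;> simp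

section

variable {s c : ℝ}

theorem mass_profile_chain (hs : 0 < s) (hs1 : s * childRatio n < 1) (c : ℝ) (k : ℕ) :
    mass (profile Q₀ s c) (chain Q₀ k) = s ^ k * layerMean n s * vol (chain Q₀ k) :=
  (integrableOn_chain hs hs1 (fun _ _ hx => profile_of_mem_layer s c hx) k).2

theorem locallyIntegrable_profile (hs : 0 < s) (hs1 : s * childRatio n < 1) (c : ℝ) :
    LocallyIntegrable (profile Q₀ s c) volume := by
  have h1 : IntegrableOn (profile Q₀ s c) Q₀.1.toSet :=
    (integrableOn_chain hs hs1 (fun _ _ hx => profile_of_mem_layer s c hx) 0).1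
  have h2 := (integrable_indicator_iff Q₀.1.measurableSet).2
    (h1.sub (integrableOn_const_cube c Q₀.1))
  have e : profile Q₀ s c = fun x => Q₀.1.toSet.indicator
      (profile Q₀ s c - fun _ => c) x + c := by
    ext x
    by_cases hx : x ∈ Q₀.1.toSet
    · simp [hx]
    · simp [hx, profile_of_notMem]
  rw [e]
  exact h2.locallyIntegrable.add (locallyIntegrable_const c)

theorem integrableOn_profile (hs : 0 < s) (hs1 : s * childRatio n < 1) (c : ℝ) (Q : D.cubes) :
    IntegrableOn (profile Q₀ s c) Q.1.toSet :=
  integrableOn_of_locallyIntegrable (locallyIntegrable_profile hs hs1 c) Q.1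

theorem mass_const_on {f : (Fin n → ℝ) → ℝ} {Q : D.cubes} (h : ∀ x ∈ Q.1.toSet, f x = c) :
    mass f Q = c * vol Q := by
  rw [mass, setIntegral_congr_fun Q.1.measurableSet h, setIntegral_const, Q.1.volume_real,
    smul_eq_mul, mul_comm]; rfl

theorem mass_profile_superset (hs : 0 < s) (hs1 : s * childRatio n < 1) {Q : D.cubes}
    (hQ : Q₀.1.toSet ⊆ Q.1.toSet) :
    mass (profile Q₀ s c) Q = layerMean n s * vol Q₀ + c * (vol Q - vol Q₀) := by
  have hi := integrableOn_profile (Q₀ := Q₀) hs hs1 c Q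
  have h0 : ∫ x in Q₀.1.toSet, profile Q₀ s c x = layerMean n s * vol Q₀ := by
    have := mass_profile_chain (Q₀ := Q₀) hs hs1 c 0
    simpa [chain, mass] using this
  rw [mass, ← integral_inter_add_sdiff Q₀.1.measurableSet hi, Set.inter_eq_right.2 hQ, h0,
    setIntegral_congr_fun (Q.1.measurableSet.diff Q₀.1.measurableSet)
      fun x hx => profile_of_notMem s c hx.2, setIntegral_const,
    measureReal_sdiff hQ Q₀.1.measurableSet
      (by rw [Q.1.volume_toSet]; exact ENNReal.ofReal_ne_top), Q.1.volume_real, Q₀.1.volume_real,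
    smul_eq_mul, mul_comm c]
  rfl

theorem haarCoeff_const_on {f : (Fin n → ℝ) → ℝ} {Q : D.cubes} (h : ∀ x ∈ Q.1.toSet, f x = c)
    (e : Signature n) : haarCoeff f Q.1 e = 0 := by
  rw [haarCoeff_congr (g := fun _ => c) e
    ((ae_restrict_iff' Q.1.measurableSet).2 (ae_of_all _ h)), haarCoeff_const]

theorem haarCoeff_profile_chain (hs : 0 < s) (hs1 : s * childRatio n < 1) (c : ℝ) (k : ℕ)
    (e : Signature n) : haarCoeff (profile Q₀ s c) (chain Q₀ k).1 e =
      s ^ k * (s * layerMean n s - 1) * (childRatio n * vol (chain Q₀ k)) *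
        haarVal (chain Q₀ k).1 e.1 fun _ => false := by
  have hv : vol (chain Q₀ (k + 1)) = childRatio n * vol (chain Q₀ k) := by
    rw [vol_chain, vol_chain, pow_succ]; ring
  rw [haarCoeff_of_const_off (P := chain Q₀ (k + 1)) (integrableOn_profile hs hs1 c _)
    (chain_antitone (Nat.le_succ k)) (s := fun _ => false) subset_rfl
    (c := s ^ k) (fun x hx => profile_of_mem_layer s c hx), mass_profile_chain hs hs1, hv]
  ring

end

/-- The Haar coefficients of the extremal weight vanish off the chain. -/
theorem haarCoeff_profile_eq_zero {s : ℝ} (hs : 0 < s) (hs1 : s * childRatio n < 1) {Q : D.cubes}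
    (hQ : ∀ k, Q ≠ chain Q₀ k) (e : Signature n) :
    haarCoeff (profile Q₀ s (layerMean n s)) Q.1 e = 0 := by
  rcases cube_cases Q₀ Q with h | ⟨h, hne⟩ | ⟨k, hk⟩ | ⟨k, hk⟩
  · exact haarCoeff_const_on (fun x hx => profile_of_notMem _ _ (Set.disjoint_left.1 h hx)) e
  · obtain ⟨σ, hσ⟩ := subset_child h hne
    rw [haarCoeff_of_const_off (integrableOn_profile hs hs1 _ Q) h hσ
      (fun x hx => profile_of_notMem _ _ hx.2)]
    -- The outside value is the average over `Q₀`, which is why cubes strictly containing `Q₀`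
    -- contribute nothing.
    have := mass_profile_chain (Q₀ := Q₀) hs hs1 (layerMean n s) 0
    simp only [chain, pow_zero, one_mul] at this
    rw [this, sub_self, zero_mul]
  · exact absurd hk (hQ k)
  · exact haarCoeff_const_on (fun x hx => profile_of_mem_layer _ _ (hk hx)) e

end DyadicGrid

/-! ### The extremal weight and its test function. -/

/-- The parameters of an extremal weight of characteristic `t`. -/
structure ExtremalParam (n : ℕ) (t r : ℝ) : Prop where
  one_le : 1 ≤ t
  lt : childRatio n < r
  le_one : r ≤ 1
  eq : (1 - childRatio n) ^ 2 * r = t * ((1 - r * childRatio n) * (r - childRatio n))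

/-- The characteristic equals `1` at `r = 1` and blows up as `r` decreases to `childRatio n`, so
every `t ≥ 1` is attained. -/
theorem exists_extremalParam (n : ℕ) [NeZero n] {t : ℝ} (ht : 1 ≤ t) :
    ∃ r, ExtremalParam n t r := by
  have ha := childRatio_pos n
  have ha1 := childRatio_lt_one n
  set a := childRatio n with haeq
  set p : ℝ → ℝ := fun r => (1 - a) ^ 2 * r - t * ((1 - r * a) * (r - a)) with hp
  have hcont : ContinuousOn p (Set.Icc a 1) := by fun_prop
  have h0 : (0 : ℝ) ∈ Set.Icc (p 1) (p a) := by
    simp only [hp]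
    constructor
    · nlinarith [sq_nonneg (1 - a)]
    · have : 0 ≤ (1 - a) ^ 2 * a := by positivity
      nlinarith
  obtain ⟨r, hr, hr0⟩ := intermediate_value_Icc' ha1.le hcont h0
  simp only [hp] at hr0
  refine ⟨r, ht, lt_of_le_of_ne hr.1 ?_, hr.2, by linarith⟩
  rintro h
  rw [← h] at hr0
  have : 0 < (1 - a) ^ 2 * a := by
    have := sub_pos.2 ha1
    positivity
  nlinarith

namespace ExtremalParam

variable {t r : ℝ}

theorem pos (h : ExtremalParam n t r) : 0 < r := (childRatio_pos n).trans h.lt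

variable [NeZero n]

theorem mul_lt (h : ExtremalParam n t r) : r * childRatio n < 1 := by
  have h1 := childRatio_pos n
  have h2 := childRatio_lt_one n
  have h3 := h.le_one
  have h4 := h.pos
  nlinarith

theorem inv_mul_lt (h : ExtremalParam n t r) : r⁻¹ * childRatio n < 1 := by
  rw [inv_mul_lt_iff₀ h.pos, mul_one]; exact h.lt

theorem layerMean_pos (h : ExtremalParam n t r) : 0 < layerMean n r :=
  div_pos (sub_pos.2 (childRatio_lt_one n)) (sub_pos.2 h.mul_lt)

theorem layerMean_inv (h : ExtremalParam n t r) :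
    layerMean n r⁻¹ = (1 - childRatio n) * r / (r - childRatio n) := by
  have h1 := h.pos
  have h2 := sub_pos.2 h.lt
  have h3 := sub_pos.2 h.inv_mul_lt
  rw [layerMean, div_eq_div_iff h3.ne' h2.ne']
  field_simp

theorem layerMean_mul (h : ExtremalParam n t r) : layerMean n r * layerMean n r⁻¹ = t := by
  have h1 := h.pos
  have h2 := sub_pos.2 h.lt
  have h3 := sub_pos.2 h.mul_lt
  rw [h.layerMean_inv, layerMean, div_mul_div_comm, div_eq_iff (by positivity)]
  linear_combination h.eq

theorem sub_one_mul (h : ExtremalParam n t r) :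
    (t - 1) * ((1 - r * childRatio n) * (r - childRatio n)) = childRatio n * (1 - r) ^ 2 := by
  linear_combination -h.eq

/-- The right side is the sum of the geometric series along the chain; it supplies the second factor
`t` in the lower bounds. -/
theorem le_div (h : ExtremalParam n t r) : t ≤ r / (r - childRatio n) := by
  have h1 := h.pos
  have h2 := sub_pos.2 h.lt
  have h3 := sub_pos.2 h.mul_lt
  have h4 := childRatio_pos n
  have h5 := sub_pos.2 (childRatio_lt_one n)
  have h6 := h.le_one
  have h7 := h.eq
  rw [le_div_iff₀ h2]
  refine le_of_mul_le_mul_right ?_ h3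
  have h8 : (1 - childRatio n) ^ 2 ≤ 1 - r * childRatio n := by nlinarith
  nlinarith

end ExtremalParam

namespace DyadicGrid

variable [NeZero n] {D : DyadicGrid n} {t r : ℝ}

/-- The extremal weight. -/
def extremal (Q₀ : D.cubes) (r : ℝ) : (Fin n → ℝ) → ℝ := profile Q₀ r (layerMean n r)

theorem extremal_inv (Q₀ : D.cubes) (r : ℝ) :
    (extremal Q₀ r)⁻¹ = profile Q₀ r⁻¹ (layerMean n r)⁻¹ := profile_inv _ _

theorem isWeight_extremal (h : ExtremalParam n t r) (Q₀ : D.cubes) : IsWeight (extremal Q₀ r) :=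
  ⟨locallyIntegrable_profile h.pos h.mul_lt _,
    ae_of_all _ fun x => profile_pos h.pos h.layerMean_pos x⟩

/-- Self-similarity gives the same value `t` on every cube of the chain; where the weight is
constant the value is `1`. -/
theorem a2Char_extremal (h : ExtremalParam n t r) (Q₀ : D.cubes) :
    a2Char D (extremal Q₀ r) = ENNReal.ofReal t := by
  have hw := isWeight_extremal h Q₀
  have hr := h.pos
  have hA := h.layerMean_pos
  have hT := h.layerMean_mul
  have h1 : ∀ Q : D.cubes, IntegrableOn (extremal Q₀ r) Q.1.toSet :=
    integrableOn_profile h.pos h.mul_lt _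
  have h2 : ∀ Q : D.cubes, IntegrableOn ((extremal Q₀ r)⁻¹) Q.1.toSet := by
    rw [extremal_inv]
    exact integrableOn_profile (inv_pos.2 h.pos) h.inv_mul_lt _
  have hmw : ∀ k, mass (extremal Q₀ r) (chain Q₀ k) =
      r ^ k * layerMean n r * vol (chain Q₀ k) :=
    mass_profile_chain h.pos h.mul_lt _
  have hms : ∀ k, mass (extremal Q₀ r)⁻¹ (chain Q₀ k) =
      r⁻¹ ^ k * layerMean n r⁻¹ * vol (chain Q₀ k) := by
    rw [extremal_inv]
    exact mass_profile_chain (inv_pos.2 h.pos) h.inv_mul_lt _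
  have hchain : ∀ k, mass (extremal Q₀ r) (chain Q₀ k) * mass (extremal Q₀ r)⁻¹ (chain Q₀ k) /
      vol (chain Q₀ k) ^ 2 = t := fun k => by
    have hv := vol_pos (chain Q₀ k)
    rw [hmw, hms, ← hT, inv_pow]
    field_simp
  have hconst : ∀ (Q : D.cubes) (c : ℝ), 0 < c → (∀ x ∈ Q.1.toSet, extremal Q₀ r x = c) →
      mass (extremal Q₀ r) Q * mass (extremal Q₀ r)⁻¹ Q / vol Q ^ 2 ≤ t := fun Q c hc hQ => by
    have hv := vol_pos Q
    rw [mass_const_on hQ, mass_const_on (c := c⁻¹) fun x hx => by rw [Pi.inv_apply, hQ x hx]]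
    have : c * vol Q * (c⁻¹ * vol Q) / vol Q ^ 2 = 1 := by field_simp
    rw [this]; exact h.one_le
  refine le_antisymm (iSup₂_le fun Q hQ => ?_) ?_
  · obtain ⟨Q, hQD, rfl⟩ := hQ
    lift Q to D.cubes using hQD
    rw [a2_term_eq h1 h2 hw.2]
    refine ENNReal.ofReal_le_ofReal ?_
    rcases cube_cases Q₀ Q with hd | ⟨hs, -⟩ | ⟨k, rfl⟩ | ⟨k, hk⟩
    · exact hconst Q _ hA fun x hx => profile_of_notMem _ _ (Set.disjoint_left.1 hd hx)
    · have hv := vol_pos Q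
      have hv0 : vol Q₀ ≤ vol Q := by
        have := measureReal_mono hs (h₂ := by
          rw [Q.1.volume_toSet]; exact ENNReal.ofReal_ne_top) (μ := volume)
        rwa [Q.1.volume_real, Q₀.1.volume_real] at this
      have e1 : mass (extremal Q₀ r) Q = layerMean n r * vol Q := by
        rw [extremal, mass_profile_superset h.pos h.mul_lt hs]; ring
      have e2 : mass (extremal Q₀ r)⁻¹ Q =
          layerMean n r⁻¹ * vol Q₀ + (layerMean n r)⁻¹ * (vol Q - vol Q₀) := by
        rw [extremal_inv, mass_profile_superset (inv_pos.2 h.pos) h.inv_mul_lt hs]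
      rw [e1, e2, div_le_iff₀ (by positivity)]
      -- On an ancestor the value is a convex combination of `t` and `1`, with weight `vol Q₀ / vol
      -- Q` on `t`.
      have e3 : layerMean n r * vol Q *
          (layerMean n r⁻¹ * vol Q₀ + (layerMean n r)⁻¹ * (vol Q - vol Q₀)) =
          vol Q * (t * vol Q₀ + (vol Q - vol Q₀)) := by
        rw [← hT]; field_simp
      rw [e3, sq, mul_left_comm]
      refine mul_le_mul_of_nonneg_left ?_ hv.le
      nlinarith [h.one_le]
    · rw [hchain]
    · exact hconst Q _ (pow_pos hr k) fun x hx => profile_of_mem_layer _ _ (hk hx)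
  · refine le_trans (le_of_eq ?_) (a2_term_le D (extremal Q₀ r) (chain Q₀ 0))
    rw [a2_term_eq h1 h2 hw.2, hchain]

theorem memA2_extremal (h : ExtremalParam n t r) (Q₀ : D.cubes) : MemA2 D (extremal Q₀ r) :=
  ⟨isWeight_extremal h Q₀, by rw [a2Char_extremal h]; exact ENNReal.ofReal_lt_top⟩

/-- The extremal function: the inverse of the extremal weight on the top cube. -/
def extremizer (Q₀ : D.cubes) (r : ℝ) : (Fin n → ℝ) → ℝ := profile Q₀ r⁻¹ 0

theorem sq_extremizer_mul (Q₀ : D.cubes) (hr : 0 < r) :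
    (fun x => extremizer Q₀ r x ^ 2 * extremal Q₀ r x) = extremizer Q₀ r := by
  ext x
  simp only [extremizer, extremal, profile]
  split_ifs
  · rw [inv_pow]; field_simp
  · simp

theorem integrable_extremizer (h : ExtremalParam n t r) (Q₀ : D.cubes) :
    Integrable (extremizer Q₀ r) := by
  have e : extremizer Q₀ r = Q₀.1.toSet.indicator (extremizer Q₀ r) := by
    ext x
    by_cases hx : x ∈ Q₀.1.toSet
    · rw [Set.indicator_of_mem hx]
    · rw [Set.indicator_of_notMem hx, extremizer, profile_of_notMem _ _ hx]
  rw [e, integrable_indicator_iff Q₀.1.measurableSet]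
  exact integrableOn_profile (inv_pos.2 h.pos) h.inv_mul_lt _ _

theorem memLp_extremizer (h : ExtremalParam n t r) (Q₀ : D.cubes) :
    MemLp (extremizer Q₀ r) 2 (weightMeasure (extremal Q₀ r)) := by
  have hw := isWeight_extremal h Q₀
  refine memLp_of_integrable_sq_mul hw.aemeasurable hw.2
    (integrable_extremizer h Q₀).aestronglyMeasurable ?_
  rw [sq_extremizer_mul Q₀ h.pos]
  exact integrable_extremizer h Q₀

theorem sqNorm_extremizer (h : ExtremalParam n t r) (Q₀ : D.cubes) :
    sqNorm (extremal Q₀ r) (extremizer Q₀ r) = layerMean n r⁻¹ * vol Q₀ := by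
  rw [sqNorm, sq_extremizer_mul Q₀ h.pos, extremizer, ← setIntegral_eq_integral_of_forall_compl_eq_zero
    (s := Q₀.1.toSet) (fun x hx => profile_of_notMem _ _ hx)]
  have := mass_profile_chain (Q₀ := Q₀) (inv_pos.2 h.pos) h.inv_mul_lt 0 0
  simpa [chain, mass] using this

/-- The opposite signs are the point: the Haar coefficients of the weight and of the extremizer on
the chain are oppositely oriented, so no cancellation occurs in the pairing. -/
theorem extremal_slope (h : ExtremalParam n t r) :
    r * layerMean n r - 1 = -((1 - r) / (1 - r * childRatio n)) ∧
    r⁻¹ * layerMean n r⁻¹ - 1 = (1 - r) / (r - childRatio n) := by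
  have h1 := h.pos
  have h2 := sub_pos.2 h.lt
  have h3 := sub_pos.2 h.mul_lt
  constructor
  · rw [layerMean]; field_simp; ring
  · rw [h.layerMean_inv]; field_simp; ring

theorem hasSum_extremal_geometric (h : ExtremalParam n t r) :
    HasSum (fun k : ℕ => (r⁻¹ * childRatio n) ^ k) (r / (r - childRatio n)) := by
  have h1 := h.pos
  have h2 := sub_pos.2 h.lt
  have h3 := hasSum_geometric_of_lt_one
    (mul_pos (inv_pos.2 h.pos) (childRatio_pos n)).le h.inv_mul_lt
  convert h3 using 1
  field_simp

/-- The form `-∫ f Π_w f` is a geometric series along the chain. Its common factor contains `(1 -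
r)² / ((1 - r a)(r - a))`, which is `(t - 1) / a` with `a = childRatio n`. -/
theorem paraNorm_extremal_ge (h : ExtremalParam n t r) (Q₀ : D.cubes) :
    ENNReal.ofReal (childRatio n * ((t - 1) * t)) ≤
      paraNorm D (extremal Q₀ r) (extremal Q₀ r) (extremal Q₀ r)⁻¹ := by
  have hA2 := memA2_extremal h Q₀
  have hr := h.pos
  have h2 := sub_pos.2 h.lt
  have h3 := sub_pos.2 h.mul_lt
  have ha := childRatio_pos n
  have ha1 := sub_pos.2 (childRatio_lt_one n)
  have hf := memLp_extremizer h Q₀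
  have hv := vol_pos Q₀
  have hBpos : 0 < layerMean n r⁻¹ := by rw [h.layerMean_inv]; positivity
  set w := extremal Q₀ r with hw
  set f := extremizer Q₀ r with hfdef
  set a := childRatio n with haeq
  set B := layerMean n r⁻¹ with hB
  refine le_sInf fun K hK => ?_
  by_cases hKt : K = ⊤
  · rw [hKt]; exact le_top
  rw [ENNReal.ofReal_le_iff_le_toReal hKt]
  obtain ⟨g, hg, hgK⟩ := hK f hf
  rw [← ENNReal.ofReal_toReal hKt] at hgK
  have hL := abs_integral_le_of_paraproduct hA2 hf hg.1 ENNReal.toReal_nonneg hgK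
  have hsum := (hasSum_pairing hA2 hg hf).neg
  set c₀ := a ^ 2 * vol Q₀ * B * ((1 - r) / (1 - r * a)) * ((1 - r) / (r - a)) with hc₀
  have hterm : ∀ (k : ℕ) (e : Signature n), -(haarCoeff w (chain Q₀ k).1 e *
      avg f (chain Q₀ k).1.toSet * haarCoeff f (chain Q₀ k).1 e) = c₀ * (r⁻¹ * a) ^ k := by
    intro k e
    have hvk := vol_pos (chain Q₀ k)
    have e1 := haarCoeff_profile_chain (Q₀ := Q₀) h.pos h.mul_lt (layerMean n r) k e
    have e2 := haarCoeff_profile_chain (Q₀ := Q₀) (inv_pos.2 h.pos) h.inv_mul_lt 0 k e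
    have e3 := mass_profile_chain (Q₀ := Q₀) (inv_pos.2 h.pos) h.inv_mul_lt 0 k
    rw [(extremal_slope h).1] at e1
    rw [(extremal_slope h).2] at e2
    have e4 := haarVal_sq (chain Q₀ k).1 e.1 fun _ => false
    have e5 : (chain Q₀ k).1.vol = vol (chain Q₀ k) := rfl
    rw [e5] at e4
    rw [avg_eq_mass, hw, hfdef, extremal, extremizer, e1, e2, e3]
    set H := haarVal (chain Q₀ k).1 e.1 fun _ => false with hH
    calc _ = (r ^ k * r⁻¹ ^ k) * (r⁻¹ ^ k) * a ^ 2 * B * ((1 - r) / (1 - r * a)) *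
          ((1 - r) / (r - a)) * (vol (chain Q₀ k) ^ 2 * H ^ 2) := by
          rw [mul_div_assoc, div_self hvk.ne']; ring
      _ = _ := by
          rw [e4, ← mul_pow, mul_inv_cancel₀ hr.ne', one_pow, sq (vol (chain Q₀ k)),
            mul_assoc (vol (chain Q₀ k)), mul_inv_cancel₀ hvk.ne', vol_chain, hc₀, mul_pow]
          ring
  have hc₀0 : 0 ≤ c₀ := by
    have := sub_nonneg.2 h.le_one
    positivity
  have hnn : ∀ i : HaarIndex D, 0 ≤ -(haarCoeff w i.1 i.2 * avg f (i.1 : DyadicCube n).toSet *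
      haarCoeff f i.1 i.2) := by
    rintro ⟨Q, e⟩
    by_cases hQ : ∃ k, Q = chain Q₀ k
    · obtain ⟨k, rfl⟩ := hQ
      rw [hterm]; positivity
    · push Not at hQ
      have : haarCoeff w Q.1 e = 0 := haarCoeff_profile_eq_zero h.pos h.mul_lt hQ e
      simp [this]
  let e₀ : Signature n := ⟨fun _ => 0, fun h => by
    have := congrFun h ⟨0, Nat.pos_of_ne_zero (NeZero.ne n)⟩
    simp at this⟩
  have hgeo := ((hasSum_extremal_geometric h).mul_left c₀).tendsto_sum_nat
  have hlow : c₀ * (r / (r - a)) ≤ -∫ x, g x * f x := by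
    refine le_of_tendsto hgeo (Eventually.of_forall fun N => ?_)
    -- All terms are nonnegative, so keeping a single signature per chain cube loses only a
    -- dimensional factor.
    have hN := sum_le_hasSum ((Finset.range N).map ⟨fun k => ((chain Q₀ k, e₀) : HaarIndex D),
      fun j k hjk => chain_injective (congrArg Prod.fst hjk)⟩) (fun i _ => hnn i) hsum
    rw [Finset.sum_map] at hN
    have hN' : ∑ k ∈ Finset.range N, -(haarCoeff w (chain Q₀ k).1 e₀ *
        avg f (chain Q₀ k).1.toSet * haarCoeff f (chain Q₀ k).1 e₀) ≤ -∫ x, g x * f x := hN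
    simpa only [hterm] using hN'
  have hsq : sqNorm w f = B * vol Q₀ := sqNorm_extremizer h Q₀
  have hup : c₀ * (r / (r - a)) ≤ K.toReal * (B * vol Q₀) := by
    rw [← hsq]; exact hlow.trans ((neg_le_abs _).trans hL)
  have hratio : c₀ * (r / (r - a)) = a * ((t - 1) * (r / (r - a))) * (B * vol Q₀) := by
    have h5 : t - 1 = a * (1 - r) ^ 2 / ((1 - r * a) * (r - a)) := by
      rw [eq_div_iff (by positivity)]; exact h.sub_one_mul
    rw [hc₀, h5]; field_simp
  rw [hratio] at hup
  have h6 := le_of_mul_le_mul_right hup (by positivity)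
  refine le_trans ?_ h6
  have h7 := h.le_div
  have h8 := sub_nonneg.2 h.one_le
  gcongr

/-- The same chain computation with the squares `(f,h)² ⟨w⟩`; it gives the square of the norm, hence
linear growth. -/
theorem squareNorm_extremal_ge (h : ExtremalParam n t r) (Q₀ : D.cubes) {c : ℝ}
    (hc : c ^ 2 ≤ childRatio n * ((t - 1) * t)) :
    ENNReal.ofReal c ≤ squareNorm D (extremal Q₀ r) := by
  have hA2 := memA2_extremal h Q₀
  have hr := h.pos
  have h2 := sub_pos.2 h.lt
  have h3 := sub_pos.2 h.mul_lt
  have ha := childRatio_pos n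
  have ha1 := sub_pos.2 (childRatio_lt_one n)
  have hf := memLp_extremizer h Q₀
  have hv := vol_pos Q₀
  have hBpos : 0 < layerMean n r⁻¹ := by rw [h.layerMean_inv]; positivity
  have hsq := sqNorm_extremizer h Q₀
  set w := extremal Q₀ r with hw
  set f := extremizer Q₀ r with hfdef
  set a := childRatio n with haeq
  set A := layerMean n r with hA
  set B := layerMean n r⁻¹ with hB
  refine le_squareNorm hA2 hf (by rw [hsq]; positivity) ?_
  let e₀ : Signature n := ⟨fun _ => 0, fun h => by
    have := congrFun h ⟨0, Nat.pos_of_ne_zero (NeZero.ne n)⟩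
    simp at this⟩
  set c₀ := a ^ 2 * vol Q₀ * A * ((1 - r) / (r - a)) ^ 2 with hc₀
  have hterm : ∀ k : ℕ, haarCoeff f (chain Q₀ k).1 e₀ ^ 2 *
      (mass w (chain Q₀ k) / vol (chain Q₀ k)) = c₀ * (r⁻¹ * a) ^ k := by
    intro k
    have hvk := vol_pos (chain Q₀ k)
    have e2 := haarCoeff_profile_chain (Q₀ := Q₀) (inv_pos.2 h.pos) h.inv_mul_lt 0 k e₀
    have e3 := mass_profile_chain (Q₀ := Q₀) h.pos h.mul_lt (layerMean n r) k
    rw [(extremal_slope h).2] at e2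
    have e4 := haarVal_sq (chain Q₀ k).1 e₀.1 fun _ => false
    have e5 : (chain Q₀ k).1.vol = vol (chain Q₀ k) := rfl
    rw [e5] at e4
    rw [hw, hfdef, extremal, extremizer, e2, e3]
    set H := haarVal (chain Q₀ k).1 e₀.1 fun _ => false with hH
    calc _ = (r ^ k * r⁻¹ ^ k) * (r⁻¹ ^ k) * a ^ 2 * A *
          ((1 - r) / (r - a)) ^ 2 * (vol (chain Q₀ k) ^ 2 * H ^ 2) := by
          rw [mul_div_assoc, div_self hvk.ne']; ring
      _ = _ := by
          rw [e4, ← mul_pow, mul_inv_cancel₀ hr.ne', one_pow, sq (vol (chain Q₀ k)),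
            mul_assoc (vol (chain Q₀ k)), mul_inv_cancel₀ hvk.ne', vol_chain, hc₀, mul_pow]
          ring
  have hA0 : 0 < A := h.layerMean_pos
  have hc₀0 : 0 ≤ c₀ := by positivity
  have hgeo := (hasSum_extremal_geometric h).mul_left c₀
  have hinj : Function.Injective fun k => ((chain Q₀ k, e₀) : HaarIndex D) :=
    fun j k hjk => chain_injective (congrArg Prod.fst hjk)
  refine le_trans ?_ (ENNReal.tsum_comp_le_tsum_of_injective hinj _)
  simp only [hterm]
  rw [← ENNReal.ofReal_tsum_of_nonneg (fun k => by positivity) hgeo.summable, hgeo.tsum_eq, hsq]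
  refine ENNReal.ofReal_le_ofReal ?_
  have hratio : c₀ * (r / (r - a)) = a * ((t - 1) * (1 / (r - a))) * (B * vol Q₀) := by
    have h5 : t - 1 = a * (1 - r) ^ 2 / ((1 - r * a) * (r - a)) := by
      rw [eq_div_iff (by positivity)]; exact h.sub_one_mul
    rw [hc₀, h5, hB, h.layerMean_inv, hA, layerMean, ← haeq]; field_simp
  rw [hratio]
  refine mul_le_mul_of_nonneg_right (hc.trans ?_) (by positivity)
  have h7 : t ≤ 1 / (r - a) := h.le_div.trans (div_le_div_of_nonneg_right h.le_one h2.le)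
  have h8 := sub_nonneg.2 h.one_le
  gcongr

end DyadicGrid

end

/-! ### Lower bounds in terms of the characteristic. -/

namespace DyadicGrid

variable {n : ℕ} [NeZero n]

theorem exists_paraNorm_ge (D : DyadicGrid n) {t : ℝ} (ht : 2 ≤ t) :
    ∃ w, MemA2 D w ∧ a2Char D w = ENNReal.ofReal t ∧
      ENNReal.ofReal (childRatio n / 2 * t ^ 2) ≤ paraNorm D w w w⁻¹ := by
  obtain ⟨r, hr⟩ := exists_extremalParam n (show 1 ≤ t by linarith)
  obtain ⟨Q₀⟩ : Nonempty D.cubes := inferInstance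
  refine ⟨extremal Q₀ r, memA2_extremal hr Q₀, a2Char_extremal hr Q₀,
    (ENNReal.ofReal_le_ofReal ?_).trans (paraNorm_extremal_ge hr Q₀)⟩
  have ha := childRatio_pos n
  rw [div_mul_eq_mul_div, mul_div_assoc]
  exact mul_le_mul_of_nonneg_left (by nlinarith) ha.le

/-- For `t ≥ 2` the symbol `b = w` is extremal, its norm being at most `2`. For `t ≤ 2` any symbol
of nonzero norm gives `φ ≥ 1 / 2`, which suffices as `childRatio n < 1` and `t² ≤ 4`. -/
theorem ofReal_le_of_paraNorm_le (D : DyadicGrid n) {φ : ℝ≥0∞ → ℝ≥0∞}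
    (hφ : ∀ w, MemA2 D w → ∀ b, MemBMO D w b →
      paraNorm D b w w⁻¹ ≤ bmoNorm D.sets w b * φ (a2Char D w)) {t : ℝ} (ht : 1 ≤ t) :
    ENNReal.ofReal (childRatio n / 8 * t ^ 2) ≤ φ (ENNReal.ofReal t) := by
  have ha := childRatio_pos n
  have ha1 := childRatio_lt_one n
  rcases le_total 2 t with h2 | h2
  · obtain ⟨w, hw, hwt, hge⟩ := exists_paraNorm_ge D h2
    have h3 := hφ w hw w (memBMO_self D hw.1)
    rw [hwt] at h3
    have h4 := (hge.trans h3).trans (mul_le_mul_left (bmoNorm_grid_self_le D hw.1) _)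
    rw [show childRatio n / 2 * t ^ 2 = 2 * (childRatio n / 4 * t ^ 2) by ring,
      ENNReal.ofReal_mul zero_le_two, ENNReal.ofReal_ofNat,
      ENNReal.mul_le_mul_iff_right two_ne_zero ENNReal.ofNat_ne_top] at h4
    exact (ENNReal.ofReal_le_ofReal (by nlinarith [sq_nonneg t])).trans h4
  · obtain ⟨r, hr⟩ := exists_extremalParam n ht
    obtain ⟨Q₀⟩ : Nonempty D.cubes := inferInstance
    have hw := memA2_extremal hr Q₀
    obtain ⟨b, hb, hb0, hle⟩ := exists_bmo_test hw
    have h3 := hφ _ hw b hb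
    rw [a2Char_extremal hr Q₀] at h3
    have h4 : bmoNorm D.sets (extremal Q₀ r) b * 1 ≤
        bmoNorm D.sets (extremal Q₀ r) b * (2 * φ (ENNReal.ofReal t)) := by
      rw [mul_one, mul_left_comm]
      exact hle.trans (mul_le_mul_right h3 _)
    rw [ENNReal.mul_le_mul_iff_right hb0 hb.2.ne] at h4
    have h5 : ENNReal.ofReal (1 / 2) ≤ φ (ENNReal.ofReal t) := by
      rw [← ENNReal.mul_le_mul_iff_right two_ne_zero ENNReal.ofNat_ne_top]
      refine le_trans (le_of_eq ?_) h4
      rw [← ENNReal.ofReal_ofNat, ← ENNReal.ofReal_mul (by norm_num)]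
      norm_num
    exact (ENNReal.ofReal_le_ofReal (by nlinarith)).trans h5

theorem exists_squareNorm_ge (D : DyadicGrid 1) {t : ℝ} (ht : 1 ≤ t) :
    ∃ w, MemA2 D w ∧ a2Char D w = ENNReal.ofReal t ∧
      ENNReal.ofReal (1 / 2 * t) ≤ squareNorm D w := by
  obtain ⟨r, hr⟩ := exists_extremalParam 1 ht
  obtain ⟨Q₀⟩ : Nonempty D.cubes := inferInstance
  refine ⟨extremal Q₀ r, memA2_extremal hr Q₀, a2Char_extremal hr Q₀, ?_⟩
  rcases le_total 2 t with h2 | h2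
  -- With `c = t / 2` the requirement is `t² / 4 ≤ t (t - 1) / 2`, that is `t ≥ 2`.
  · refine squareNorm_extremal_ge hr Q₀ ?_
    rw [childRatio, pow_one]
    nlinarith
  · refine le_trans ?_ (one_le_squareNorm (memA2_extremal hr Q₀))
    rw [ENNReal.ofReal_le_one]
    linarith

end DyadicGrid

end Bloom

end

theorem mainTheorem9 :
    -- every weight belongs to its own weighted `BMO` space, with norm at most `2`
    (∀ n : ℕ, 1 ≤ n → ∀ w : (Fin n → ℝ) → ℝ, Bloom.IsWeight w →
      Bloom.bmoNorm (Bloom.allCubes n) w w ≤ 2) ∧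
    -- the `BMO` norm is controlled by the norm of the paraproduct
    (∀ n : ℕ, 1 ≤ n → ∀ (D : Bloom.DyadicGrid n) (w : (Fin n → ℝ) → ℝ), Bloom.MemA2 D w →
      ∀ b : (Fin n → ℝ) → ℝ, Bloom.MemBMO D w b →
        Bloom.bmoNorm D.sets w b ≤ 2 * Bloom.paraNorm D b w w⁻¹) ∧
    -- the quadratic bound, and its sharpness
    (∀ n : ℕ, 1 ≤ n → ∃ C c : ℝ, 0 < C ∧ 0 < c ∧ ∀ D : Bloom.DyadicGrid n,
      (∀ w : (Fin n → ℝ) → ℝ, Bloom.MemA2 D w → ∀ b : (Fin n → ℝ) → ℝ, Bloom.MemBMO D w b →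
        Bloom.paraNorm D b w w⁻¹ ≤
          ENNReal.ofReal C * Bloom.bmoNorm D.sets w b * Bloom.a2Char D w ^ 2) ∧
      (∀ t : ℝ, 2 ≤ t → ∃ w : (Fin n → ℝ) → ℝ, Bloom.MemA2 D w ∧
        Bloom.a2Char D w = ENNReal.ofReal t ∧
        ENNReal.ofReal (c * t ^ 2) ≤ Bloom.paraNorm D w w w⁻¹) ∧
      (∀ φ : ℝ≥0∞ → ℝ≥0∞,
        (∀ w : (Fin n → ℝ) → ℝ, Bloom.MemA2 D w → ∀ b : (Fin n → ℝ) → ℝ, Bloom.MemBMO D w b →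
          Bloom.paraNorm D b w w⁻¹ ≤ Bloom.bmoNorm D.sets w b * φ (Bloom.a2Char D w)) →
        ∀ t : ℝ, 1 ≤ t → ENNReal.ofReal (c * t ^ 2) ≤ φ (ENNReal.ofReal t))) ∧
    -- on the line, the paraproducts control the dyadic square function
    (∀ (D : Bloom.DyadicGrid 1) (w : (Fin 1 → ℝ) → ℝ), Bloom.MemA2 D w →
      (∀ f : (Fin 1 → ℝ) → ℝ, MemLp f 2 (Bloom.weightMeasure w) →
        eLpNorm (Bloom.squareFunction D f) 2 (Bloom.weightMeasure w) ^ 2 ≤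
          (1 + 2 * Bloom.paraNorm D w w w⁻¹) * eLpNorm f 2 (Bloom.weightMeasure w) ^ 2) ∧
      Bloom.squareNorm D w ^ 2 ≤
        6 * ⨆ (b : (Fin 1 → ℝ) → ℝ) (_ : Bloom.MemBMO D w b ∧ Bloom.bmoNorm D.sets w b ≠ 0),
          Bloom.paraNorm D b w w⁻¹ / Bloom.bmoNorm D.sets w b) ∧
    -- the sharp dependence of the dyadic square function on the characteristic is linear
    (∃ C c : ℝ, 0 < C ∧ 0 < c ∧ ∀ D : Bloom.DyadicGrid 1,
      (∀ w : (Fin 1 → ℝ) → ℝ, Bloom.MemA2 D w →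
        Bloom.squareNorm D w ≤ ENNReal.ofReal C * Bloom.a2Char D w) ∧
      (∀ t : ℝ, 1 ≤ t → ∃ w : (Fin 1 → ℝ) → ℝ, Bloom.MemA2 D w ∧
        Bloom.a2Char D w = ENNReal.ofReal t ∧
        ENNReal.ofReal (c * t) ≤ Bloom.squareNorm D w)) := by
  refine ⟨fun n _ w hw => Bloom.bmoNorm_self_le hw, fun n hn D w hw b hb => ?_, fun n hn => ?_,
    fun D w hw => ⟨fun f hf => Bloom.DyadicGrid.eLpNorm_squareFunction_sq_le hw hf,
      Bloom.DyadicGrid.squareNorm_sq_le_iSup hw⟩,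
    240, 1 / 2, by norm_num, by norm_num, fun D => ⟨fun w hw => Bloom.DyadicGrid.squareNorm_le hw,
      fun t ht => D.exists_squareNorm_ge ht⟩⟩
  · have : NeZero n := ⟨by omega⟩
    exact Bloom.DyadicGrid.bmoNorm_le hw hb.1
  · have : NeZero n := ⟨by omega⟩
    have ha := Bloom.childRatio_pos n
    -- One `c` must serve both lower bounds: the one on `φ` needs `childRatio n / 8`, while the
    -- extremal weight allows `childRatio n / 2`.
    refine ⟨3456 * (2 ^ n) ^ 2, Bloom.childRatio n / 8, by positivity, by positivity, fun D =>
      ⟨fun w hw b hb => Bloom.DyadicGrid.paraNorm_le hw hb, fun t ht => ?_,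
        fun φ hφ t ht => D.ofReal_le_of_paraNorm_le hφ ht⟩⟩
    obtain ⟨w, hw, hwt, hge⟩ := D.exists_paraNorm_ge ht
    exact ⟨w, hw, hwt, (ENNReal.ofReal_le_ofReal (by nlinarith [sq_nonneg t])).trans hge⟩
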